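/- **Setting.** Let $\Theta\subset\mathbb R^d$, $\mathcal A\subset\mathbb R^s$, $\Phi=(0,1)\times\Theta\times\mathcal A$, and write $\phi=(\lambda,\theta,\alpha)$. For $\theta\in\Theta$ let $P_1(\cdot|\theta)$ be a probability measure on $\mathbb R^r$ with Lebesgue density $p_1(\cdot|\theta)$, such that for almost every $x$ the function $\theta\mapsto p_1(x|\theta)$ is $\mathcal C^2$ on $\mathrm{int}(\Theta)$. Let $g_1,\dots,g_\ell:\mathbb R^r\to\mathbb R$ be measurable and integrable under every $P_1(\cdot|\theta)$, let $m_1,\dots,m_\ell:\mathcal A\to\mathbb R$, and put $g=(1,g_1,\dots,g_\ell)^t$, $m=(1,m_1,\dots,m_\ell)^t$. Let $\phi^*=(\lambda^*,\theta^*,\alpha^*)\in\Phi$ and let $P_0^*$ be a probability measure with $\int g\,dP_0^*=m(\alpha^*)$. Let $X_1,X_2,\dots$ be i.i.d. with law $P_T=\lambda^*P_1(\cdot|\theta^*)+(1-\lambda^*)P_0^*$. Let $\varphi:\mathbb R\to[0,\infty]$ be strictly convex with $\varphi(1)=0$, with $1$ in the interior of its domain, and differentiable there, and let $\psi(t)=\sup_x\{tx-\varphi(x)\}$.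 Suppose that $\psi$ is real-valued and of class $\mathcal C^2$ on $\mathbb R$ with $\psi'(0)=\psi''(0)=1$. Put, for $\xi\in\mathbb R^{\ell+1}$, $$H_n(\phi,\xi)=\xi^tm(\alpha)-\frac1{1-\lambda}\frac1n\sum_{i=1}^n\psi(\xi^tg(X_i))+\frac{\lambda}{1-\lambda}\int\psi(\xi^tg(x))\,dP_1(x|\theta)\in(-\infty,+\infty].$$ Let $\hat\phi=\hat\phi_n$ be random vectors which, with probability tending to $1$, attain $\inf_{\phi\in\Phi}\sup_{\xi\in\mathbb R^{\ell+1}}H_n(\phi,\xi)$. Let $\tilde r,\rho>0$ with $B(\phi^*,\tilde r)\subset\Phi$, and suppose that with probability tending to $1$, for every $\phi\in B(\phi^*,\tilde r)$ the supremum $\sup_{\xi\in\mathbb R^{\ell+1}}H_n(\phi,\xi)$ is attained at the selected point $\xi_n(\phi)$, with $\|\xi_n(\phi)\|\le\rho$; $\xi_n(\hat\phi)$ is measurable. **Matrices.** Let $$J_{\phi^*,\xi^*}=\Big(\tfrac1{(1-\lambda^*)^2}\big[-\mathbb E_{P_T}g(X)+\mathbb E_{P_1(\cdot|\theta^*)}g(X)\big],\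 \tfrac{\lambda^*}{1-\lambda^*}\int g(x)\nabla_\theta p_1(x|\theta^*)^t\,dx,\ \nabla m(\alpha^*)\Big),\qquad J_{\xi^*,\xi^*}=-\mathbb E_{P_0^*}[g(X)g(X)^t],$$ $$\Sigma=\big(J_{\phi^*,\xi^*}^tJ_{\xi^*,\xi^*}^{-1}J_{\phi^*,\xi^*}\big)^{-1},\qquad H=\Sigma J_{\phi^*,\xi^*}^tJ_{\xi^*,\xi^*}^{-1},\qquad W=J_{\xi^*,\xi^*}^{-1}-J_{\xi^*,\xi^*}^{-1}J_{\phi^*,\xi^*}\Sigma J_{\phi^*,\xi^*}^tJ_{\xi^*,\xi^*}^{-1}.$$ **Theorem.** Suppose that 1. $\hat\phi\to\phi^*$ in probability, and $\phi^*\in\mathrm{int}(\Phi)$; 2. $m$ is $\mathcal C^2$ on $\mathrm{int}(\mathcal A)$; 3. there are $h_{1,1},h_{1,2}\in L^1(dx)$ with $\|\psi'(\xi^tg(x))g(x)\|\,p_1(x|\theta)\le h_{1,1}(x)$ and $\|\psi''(\xi^tg(x))g(x)g(x)^t\|\,p_1(x|\theta)\le h_{1,2}(x)$; 4. there are $h_{2,1},h_{2,2}\in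 L^1(dx)$ with $\|\psi(\xi^tg(x))\nabla_\theta p_1(x|\theta)\|\le h_{2,1}(x)$ and $\|\psi(\xi^tg(x))\nabla^2_\theta p_1(x|\theta)\|\le h_{2,2}(x)$; 5. there is $h_3\in L^1(dx)$ with $\|\psi'(\xi^tg(x))g(x)\nabla_\theta p_1(x|\theta)^t\|\le h_3(x)$; 6. $\mathbb E_{P_T}|g_i(X)g_j(X)|<\infty$ for $1\le i,j\le\ell$; 7. $J_{\xi^*,\xi^*}$ and $J_{\phi^*,\xi^*}^tJ_{\xi^*,\xi^*}J_{\phi^*,\xi^*}$ are invertible, where the bounds in 3, 4 and 5 hold for almost every $x$, simultaneously for all $(\lambda,\theta,\alpha)\in B(\phi^*,\tilde r)$ and all $\xi$ with $\|\xi\|\le\rho$. Then $$\begin{pmatrix}\sqrt n(\hat\phi-\phi^*)\\ \sqrt n\,\xi_n(\hat\phi)\end{pmatrix}\xrightarrow{\ \mathcal L\ }\mathcal N\left(0,\ \frac1{(1-\lambda^*)^2}\begin{pmatrix}H\\W\end{pmatrix}\mathrm{Var}_{P_T}(g(X))\begin{pmatrix}H^t&W^t\end{pmatrix}\right).$$ 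-/

import Mathlib

open MeasureTheory ProbabilityTheory Filter Topology
open scoped ENNReal Matrix

noncomputable section

namespace SemiparamMixture

/-- Euclidean space `ℝᵏ`. -/
abbrev E (k : ℕ) := EuclideanSpace ℝ (Fin k)

/-- A parameter `φ = (λ, θ, α)`. -/
abbrev Param (d s : ℕ) := ℝ × E d × E s

/-- Index set of the coordinates of `φ = (λ, θ, α)`. -/
abbrev ParamIdx (d s : ℕ) := Unit ⊕ (Fin d ⊕ Fin s)

/-! ### Divergence generators and the Fenchel-Legendre transform -/

/-- The domain `{x | φ x < ∞}` of an extended-valued function. -/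
def effDom (φ : ℝ → ℝ≥0∞) : Set ℝ := {x | φ x < ∞}

/-- A strictly convex, differentiable function `φ : ℝ → [0, ∞]` with `φ 1 = 0` whose domain is an
interval having `1` in its interior. -/
structure IsDivergenceGenerator (φ : ℝ → ℝ≥0∞) : Prop where
  convex : ∀ x y a b : ℝ, 0 ≤ a → 0 ≤ b → a + b = 1 →
    φ (a * x + b * y) ≤ ENNReal.ofReal a * φ x + ENNReal.ofReal b * φ y
  strictConvex : ∀ x ∈ effDom φ, ∀ y ∈ effDom φ, x ≠ y → ∀ a b : ℝ, 0 < a → 0 < b → a + b = 1 →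
    φ (a * x + b * y) < ENNReal.ofReal a * φ x + ENNReal.ofReal b * φ y
  map_one : φ 1 = 0
  one_mem : (1 : ℝ) ∈ interior (effDom φ)
  differentiable : DifferentiableOn ℝ (fun x => (φ x).toReal) (interior (effDom φ))

/-- The Fenchel-Legendre transform `t ↦ sup_x (t x - φ x)`. -/
def fenchelLegendre (φ : ℝ → ℝ≥0∞) (t : ℝ) : EReal :=
  ⨆ x : ℝ, ((t * x : ℝ) : EReal) - ((φ x : ℝ≥0∞) : EReal)

/-- The integral of a function as an extended real, `∫ f⁺ dμ - ∫ f⁻ dμ`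
(meaningful as soon as `∫ f⁻ dμ < ∞`). -/
def eintegral {X : Type*} [MeasurableSpace X] (μ : Measure X) (f : X → ℝ) : EReal :=
  ((∫⁻ x, ENNReal.ofReal (f x) ∂μ : ℝ≥0∞) : EReal) -
    ((∫⁻ x, ENNReal.ofReal (-f x) ∂μ : ℝ≥0∞) : EReal)

/-- Prepend the coordinate `1` to a vector: `(v₁, …, v_ℓ) ↦ (1, v₁, …, v_ℓ)`. -/
def augment {ℓ : ℕ} (v : E ℓ) : E (ℓ + 1) :=
  WithLp.toLp 2 (Fin.cons (1 : ℝ) (fun i => v i))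

/-! ### The model -/

/-- The data of a two-component semiparametric mixture model on `ℝʳ` under linear constraints:
parameter sets `Θ ⊆ ℝᵈ` and `𝒜 ⊆ ℝˢ`, a family of probability densities `p₁(· | θ)`, the constraint
functions `g = (g₁, …, g_ℓ)` and the constraint values `m(α) = (m₁(α), …, m_ℓ(α))`. -/
structure Model (r d s ℓ : ℕ) where
  Θ : Set (E d)
  𝒜 : Set (E s)
  p₁ : E d → E r → ℝ
  g : E r → E ℓ
  m : E s → E ℓ
  measurable_p₁ : ∀ θ ∈ Θ, Measurable (p₁ θ)
  p₁_nonneg : ∀ θ ∈ Θ, ∀ x, 0 ≤ p₁ θ x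
  lintegral_p₁ : ∀ θ ∈ Θ, ∫⁻ x, ENNReal.ofReal (p₁ θ x) = 1
  measurable_g : Measurable g
  integrable_g : ∀ θ ∈ Θ, Integrable (fun x => p₁ θ x • g x)

namespace Model

variable {r d s ℓ : ℕ} (M : Model r d s ℓ)

/-- The parameter set `Φ = (0, 1) × Θ × 𝒜`. -/
def Φ : Set (Param d s) := Set.Ioo (0 : ℝ) 1 ×ˢ M.Θ ×ˢ M.𝒜

/-- The parametric component `P₁(· | θ)`. -/
def P₁ (θ : E d) : Measure (E r) := volume.withDensity (fun x => ENNReal.ofReal (M.p₁ θ x))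

/-- The augmented constraint functions `(1, g₁, …, g_ℓ)`. -/
def ga (x : E r) : E (ℓ + 1) := augment (M.g x)

/-- The augmented constraint values `(1, m₁(α), …, m_ℓ(α))`. -/
def ma (α : E s) : E (ℓ + 1) := augment (M.m α)

/-- The probability measures `Q` which satisfy the constraints `∫ g dQ = m(α)`. -/
def constraintSet (α : E s) : Set (Measure (E r)) :=
  {Q | IsProbabilityMeasure Q ∧ Integrable M.g Q ∧ ∫ x, M.g x ∂Q = M.m α}

/-- The mixture `λ P₁(· | θ) + (1 - λ) P₀`. -/
def mixture (φ : Param d s) (P₀ : Measure (E r)) : Measure (E r) :=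
  ENNReal.ofReal φ.1 • M.P₁ φ.2.1 + ENNReal.ofReal (1 - φ.1) • P₀

/-! ### The estimation procedure -/

/-- The empirical dual criterion `Hₙ(φ, ξ) = ξᵗ m(α) - 1/(1-λ) (1/n) ∑ᵢ ψ(ξᵗ g(xᵢ))
+ λ/(1-λ) ∫ ψ(ξᵗ g(x)) dP₁(x | θ)`, with `g` and `m` augmented and `xᵢ = x 0, …, x (n - 1)`. -/
def Hn (ψ : ℝ → ℝ) (n : ℕ) (x : ℕ → E r) (φ : Param d s) (ξ : E (ℓ + 1)) : EReal :=
  ((inner ℝ ξ (M.ma φ.2.2)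
      - 1 / (1 - φ.1) * ((1 / (n : ℝ)) * ∑ i ∈ Finset.range n, ψ (inner ℝ ξ (M.ga (x i)))) : ℝ) :
        EReal)
    + ((φ.1 / (1 - φ.1) : ℝ) : EReal) * eintegral (M.P₁ φ.2.1) (fun y => ψ (inner ℝ ξ (M.ga y)))

/-- `ξ` is a point at which `sup_ξ Hₙ(φ, ξ)`, over all of `ℝ^{ℓ+1}`, is attained. -/
def IsInnerArgmax (ψ : ℝ → ℝ) (n : ℕ) (x : ℕ → E r) (φ : Param d s) (ξ : E (ℓ + 1)) : Prop :=
  ∀ ξ', M.Hn ψ n x φ ξ' ≤ M.Hn ψ n x φ ξ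

/-- `φ` is a point of `Φ` at which `inf_{φ ∈ Φ} sup_ξ Hₙ(φ, ξ)` is attained. -/
def IsEstimate (ψ : ℝ → ℝ) (n : ℕ) (x : ℕ → E r) (φ : Param d s) : Prop :=
  φ ∈ M.Φ ∧ ∀ φ' ∈ M.Φ, ⨆ ξ, M.Hn ψ n x φ ξ ≤ ⨆ ξ, M.Hn ψ n x φ' ξ

/-! ### The matrices of the limit law -/

/-- The matrix with the columns `(1-λ)⁻² (-E_{P_T} g + E_{P₁(·|θ)} g)`,
`λ/(1-λ) ∫ g ∂_{θ_j} p₁(x | θ) dx` and `∂_{α_k} m(α)`. -/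
def Jφξ (φ : Param d s) (PT : Measure (E r)) : Matrix (Fin (ℓ + 1)) (ParamIdx d s) ℝ :=
  Matrix.of fun i c =>
    match c with
    | Sum.inl _ =>
        1 / (1 - φ.1) ^ 2 * (-(∫ x, M.ga x i ∂PT) + ∫ x, M.ga x i ∂(M.P₁ φ.2.1))
    | Sum.inr (Sum.inl j) =>
        φ.1 / (1 - φ.1) * ∫ x, M.ga x i * gradient (fun θ => M.p₁ θ x) φ.2.1 j
    | Sum.inr (Sum.inr k) =>
        fderiv ℝ M.ma φ.2.2 (EuclideanSpace.single k 1) i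

/-- The limit `-E_{P₀}[g gᵗ]` of the second derivative of `Hₙ` with respect to `ξ`. -/
def Jξξ (P₀ : Measure (E r)) : Matrix (Fin (ℓ + 1)) (Fin (ℓ + 1)) ℝ :=
  Matrix.of fun i j => -∫ x, M.ga x i * M.ga x j ∂P₀

/-- The covariance matrix of `g(X)` for `X ∼ PT`. -/
def varG (PT : Measure (E r)) : Matrix (Fin (ℓ + 1)) (Fin (ℓ + 1)) ℝ :=
  Matrix.of fun i j => covariance (fun x => M.ga x i) (fun x => M.ga x j) PT

end Model

section matrices

variable {ι κ : Type*} [Fintype ι] [DecidableEq ι] [Fintype κ] [DecidableEq κ]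

/-- `Σ = (Jᵗ K⁻¹ J)⁻¹`. -/
def matSigma (J : Matrix κ ι ℝ) (K : Matrix κ κ ℝ) : Matrix ι ι ℝ := (Jᵀ * K⁻¹ * J)⁻¹

/-- `H = Σ Jᵗ K⁻¹`. -/
def matH (J : Matrix κ ι ℝ) (K : Matrix κ κ ℝ) : Matrix ι κ ℝ := matSigma J K * Jᵀ * K⁻¹

/-- `W = K⁻¹ - K⁻¹ J Σ Jᵗ K⁻¹`. -/
def matW (J : Matrix κ ι ℝ) (K : Matrix κ κ ℝ) : Matrix κ κ ℝ :=
  K⁻¹ - K⁻¹ * J * matSigma J K * Jᵀ * K⁻¹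

/-- `(1-λ)⁻² (H; W) V (Hᵗ Wᵗ)`. -/
def limitCov (lam : ℝ) (J : Matrix κ ι ℝ) (K V : Matrix κ κ ℝ) : Matrix (ι ⊕ κ) (ι ⊕ κ) ℝ :=
  (1 / (1 - lam) ^ 2) •
    (Matrix.fromRows (matH J K) (matW J K) * V * (Matrix.fromRows (matH J K) (matW J K))ᵀ)

end matrices

/-- The vector `(λ, θ, α, ξ)` as one element of a Euclidean space. -/
def jointVec {d s ℓ : ℕ} (φ : Param d s) (ξ : E (ℓ + 1)) :
    EuclideanSpace ℝ (ParamIdx d s ⊕ Fin (ℓ + 1)) :=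
  WithLp.toLp 2 (Sum.elim (Sum.elim (fun _ => φ.1) (Sum.elim (fun j => φ.2.1 j) fun k => φ.2.2 k))
    fun i => ξ i)

end SemiparamMixture

end

/-!
The rescaled estimator and inner maximiser are asymptotically linear in a normalised i.i.d. sum, and
the multivariate central limit theorem then gives the limit law.

The structural point is the splitting `ψ(t) = t + tilt ψ t`, where `tilt ψ t = t² / 2 + o(t²)` is
nonnegative and vanishes at `0` only. It turns the criterion into
`Hₙ(φ, ξ) = ⟪ξ, Zₙ(φ)⟫ - (second-order part in ξ)` with a linear part
`Zₙ(φ) = z(φ) - (1 - λ)⁻¹ Dₙ`. Here `Dₙ = Pₙ g - E g` (`Model.noise`) is the random part, and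
`z` (`Model.linLim`) is a deterministic function which vanishes at the true parameter by the
constraint and has the derivative `J_{φ,ξ}` there (`Regular.hasFDerivAt_linLim`).

Two facts about the second-order part hold with probability tending to one, for all `φ` near `φ*`.
At distance `O(1/√n)` from `ξ = 0` it is `½ E_{P₀}⟪ξ, g⟫² + o(‖ξ‖²)` (`Regular.local_expansion`); the
largest `g(X_i)` is `o(√n)` because `g` has second moments. On the whole ball `‖ξ‖ ≤ ρ` it is at
least `c ‖ξ‖²` (`Regular.exists_upper_bound`). This holds near `0` by the law of large numbers for
second moments and near every other point by a truncation, since the limit is positive there; the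
ball is compact. Neither fact differentiates the empirical criterion, so no smoothness of
`φ ↦ ξₙ(φ)` and no uniform law of large numbers for derivatives is needed.

The rest is a deterministic argmin theorem (`SaddleProblem.tendsto_saddle`). The concave bound gives
`‖ξₙ(φ)‖ = O(‖Zₙ(φ)‖)`, and the comparison of the inner suprema at `φ̂` and at `φ*` gives
`Zₙ(φ̂) = O(1/√n)`, whence `φ̂ - φ* = O(1/√n)` as `J_{φ,ξ}` is injective. On this scale the criterion
is the quadratic saddle function `⟪v, S + J u⟫ - ½⟪v, A v⟫`, with `A = -J_{ξ,ξ}` and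
`S = -(1 - λ*)⁻¹ √n Dₙ`. Completing squares, and comparing with two test points, shows that the
rescaled pair converges to its saddle point, which is `(-H S, -W S)`.

"With probability tending to one" is encoded as a filter `whp μ` on `ℕ × Ω`, so that stochastic
`O` and `o` statements become ordinary asymptotics along `whp μ`, restricted to the event that the
tight sequence `√n Dₙ` is bounded (`tendstoInMeasure_of_tight`).
-/

namespace SemiparamMixture

noncomputable section

/-! ### Convergence in probability as convergence along a filter -/

section WithHighProbability

variable {Ω : Type*} [MeasurableSpace Ω] {μ : Measure Ω}

/-- The filter of the events which hold with probability tending to one: a set `S ⊆ ℕ × Ω`, a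
sequence of events, belongs to it when the outer measure of the complement of its `n`-th section
tends to `0`. No measurability of the sections is asked for. -/
def whp (μ : Measure Ω) : Filter (ℕ × Ω) where
  sets := {S | Tendsto (fun n => μ {ω | (n, ω) ∉ S}) atTop (𝓝 0)}
  univ_sets := by simp
  sets_of_superset := by
    intro S T hS hST
    refine tendsto_of_tendsto_of_tendsto_of_le_of_le tendsto_const_nhds hS (fun _ => zero_le)
      fun n => measure_mono fun ω h h' => h (hST h')
  inter_sets := by
    intro S T hS hT
    have h := Tendsto.add hS hT
    rw [add_zero] at h
    refine tendsto_of_tendsto_of_tendsto_of_le_of_le tendsto_const_nhds h (fun _ => zero_le)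
      fun n => (measure_mono ?_).trans (measure_union_le _ _)
    intro ω hω
    by_contra hcon
    simp only [Set.mem_union, Set.mem_ofPred_eq, not_or, not_not] at hcon
    exact hω hcon

lemma eventually_whp {p : ℕ × Ω → Prop} :
    (∀ᶠ i in whp μ, p i) ↔ Tendsto (fun n => μ {ω | ¬ p (n, ω)}) atTop (𝓝 0) := Iff.rfl

lemma tendsto_fst_whp : Tendsto Prod.fst (whp μ) atTop := by
  refine tendsto_atTop.2 fun N => eventually_whp.2 ?_
  refine tendsto_const_nhds.congr' ?_
  filter_upwards [eventually_ge_atTop N] with n hn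
  simp [hn]

lemma _root_.MeasureTheory.TendstoInMeasure.tendsto_whp {F : Type*} [PseudoMetricSpace F]
    {f : ℕ → Ω → F} {c : F} (h : TendstoInMeasure μ f atTop fun _ => c) :
    Tendsto (fun i : ℕ × Ω => f i.1 i.2) (whp μ) (𝓝 c) := by
  rw [tendstoInMeasure_iff_dist] at h
  refine Metric.tendsto_nhds.2 fun ε hε => eventually_whp.2 ?_
  simpa using h ε hε

/-- Let `S n` be a tight sequence of random vectors. If, for every `M`, `f` tends to zero along the
high-probability filter restricted to `‖S‖ ≤ M`, then `f` tends to zero in probability. -/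
lemma tendstoInMeasure_of_tight {F G : Type*} [SeminormedAddCommGroup F] [Norm G]
    {f : ℕ → Ω → F} {S : ℕ → Ω → G}
    (hS : ∀ ε : ℝ≥0∞, 0 < ε → ∃ M : ℝ, ∀ n, μ {ω | M < ‖S n ω‖} ≤ ε)
    (h : ∀ M : ℝ, Tendsto (fun i : ℕ × Ω => f i.1 i.2)
      (whp μ ⊓ 𝓟 {i | ‖S i.1 i.2‖ ≤ M}) (𝓝 0)) :
    TendstoInMeasure μ f atTop 0 := by
  rw [tendstoInMeasure_iff_norm]
  intro η hη
  refine ENNReal.tendsto_nhds_zero.2 fun ε hε => ?_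
  obtain ⟨M, hM⟩ := hS (ε / 2) (ENNReal.half_pos hε.ne')
  have h1 := (Metric.tendsto_nhds.1 (h M)) η hη
  rw [eventually_inf_principal, eventually_whp] at h1
  filter_upwards [ENNReal.tendsto_nhds_zero.1 h1 (ε / 2) (ENNReal.half_pos hε.ne')] with n hn
  calc μ {x | η ≤ ‖f n x - (0 : Ω → F) x‖}
      ≤ μ ({ω | ¬ ((n, ω) ∈ {i : ℕ × Ω | ‖S i.1 i.2‖ ≤ M} → dist (f n ω) 0 < η)}
          ∪ {ω | M < ‖S n ω‖}) := by
        refine measure_mono fun ω hω => ?_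
        simp only [Set.mem_ofPred_eq, Pi.zero_apply, sub_zero] at hω
        by_cases hM' : M < ‖S n ω‖
        · exact Or.inr hM'
        · refine Or.inl ?_
          simp only [Set.mem_ofPred_eq, dist_zero_right]
          intro hcon
          exact absurd (hcon (not_lt.1 hM')) (not_lt.2 hω)
    _ ≤ ε / 2 + ε / 2 := (measure_union_le _ _).trans (add_le_add hn (hM n))
    _ = ε := ENNReal.add_halves ε

variable {α : Type*} [MeasurableSpace α] {P : Measure α} {X : ℕ → Ω → α}

/-- The empirical mean of `f` over the first `n` points of the sample, at `(n, ω)`. -/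
def empMean (X : ℕ → Ω → α) (f : α → ℝ) (i : ℕ × Ω) : ℝ :=
  (1 / (i.1 : ℝ)) * ∑ k ∈ Finset.range i.1, f (X k i.2)

omit [MeasurableSpace Ω] [MeasurableSpace α] in
lemma empMean_mono {f g : α → ℝ} (h : ∀ x, f x ≤ g x) (i : ℕ × Ω) :
    empMean X f i ≤ empMean X g i := by
  unfold empMean
  gcongr with k
  exact h _

/-- The law of large numbers. -/
lemma tendsto_empMean [IsProbabilityMeasure μ] (hind : iIndepFun X μ)
    (hlaw : ∀ k, HasLaw (X k) P μ) {f : α → ℝ} (hf : Measurable f) (hfi : Integrable f P) :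
    Tendsto (empMean X f) (whp μ) (𝓝 (∫ x, f x ∂P)) := by
  have hae : ∀ k, AEMeasurable (fun ω => f (X k ω)) μ := fun k =>
    hf.comp_aemeasurable (hlaw k).aemeasurable
  have hid : ∀ k, IdentDistrib (fun ω => f (X k ω)) (fun ω => f (X 0 ω)) μ μ := fun k =>
    (IdentDistrib.mk (hlaw k).aemeasurable (hlaw 0).aemeasurable
      ((hlaw k).map_eq.trans (hlaw 0).map_eq.symm)).comp hf
  have hint : Integrable (fun ω => f (X 0 ω)) μ := by
    have := hfi
    rw [← (hlaw 0).map_eq] at this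
    exact this.comp_aemeasurable (hlaw 0).aemeasurable
  have hexp : ∫ ω, f (X 0 ω) ∂μ = ∫ x, f x ∂P := by
    rw [← (hlaw 0).map_eq, integral_map (hlaw 0).aemeasurable hf.aestronglyMeasurable]
  have hsl := strong_law_ae_real (fun k ω => f (X k ω)) hint
    (fun a b hab => ((hind.indepFun hab).comp hf hf)) hid
  rw [hexp] at hsl
  have : TendstoInMeasure μ (fun (n : ℕ) ω => (∑ k ∈ Finset.range n, f (X k ω)) / n) atTop
      (fun _ => ∫ x, f x ∂P) := by
    refine tendstoInMeasure_of_tendsto_ae (fun n => ?_) hsl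
    exact ((Finset.aemeasurable_fun_sum _ fun k _ => hae k).div_const _).aestronglyMeasurable
  refine this.tendsto_whp.congr fun i => ?_
  unfold empMean
  ring

/-- If `f²` is integrable, then the largest of `f (X 0), …, f (X (n - 1))` is `o(√n)` in
probability. -/
lemma eventually_forall_lt_sqrt (hlaw : ∀ k, HasLaw (X k) P μ) {f : α → ℝ}
    (hf : Measurable f) (hfi : Integrable (fun x => f x ^ 2) P) {η : ℝ}
    (hη : 0 < η) :
    ∀ᶠ i : ℕ × Ω in whp μ, ∀ k < i.1, f (X k i.2) ≤ η * √(i.1 : ℝ) := by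
  have hset : ∀ n : ℕ, MeasurableSet {x | η ^ 2 * n < f x ^ 2} := fun n =>
    measurableSet_lt measurable_const (hf.pow_const 2)
  -- the union bound `n P(f² > η² n) ≤ η⁻² E[f²; f² > η² n] → 0`
  have htail : Tendsto (fun n : ℕ => ∫⁻ x, {x | η ^ 2 * n < f x ^ 2}.indicator
      (fun _ => (n : ℝ≥0∞)) x ∂P) atTop (𝓝 (∫⁻ _, 0 ∂P)) := by
    refine tendsto_lintegral_of_dominated_convergence
      (fun x => ENNReal.ofReal ((η ^ 2)⁻¹ * f x ^ 2)) (fun n => measurable_const.indicator (hset n))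
      (fun n => ae_of_all _ fun x => ?_) ?_ (ae_of_all _ fun x => ?_)
    · by_cases hx : η ^ 2 * n < f x ^ 2
      · rw [Set.indicator_of_mem (by exact hx), ← ENNReal.ofReal_natCast]
        refine ENNReal.ofReal_le_ofReal ?_
        rw [← div_eq_inv_mul, le_div_iff₀ (by positivity)]
        nlinarith
      · rw [Set.indicator_of_notMem (by exact hx)]
        exact zero_le
    · exact (hfi.const_mul _).lintegral_lt_top.ne
    · refine tendsto_const_nhds.congr' ?_
      obtain ⟨N, hN⟩ := exists_nat_gt (f x ^ 2 / η ^ 2)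
      filter_upwards [eventually_ge_atTop N] with n hn
      rw [Set.indicator_of_notMem]
      simp only [Set.mem_ofPred_eq, not_lt]
      rw [div_lt_iff₀ (by positivity)] at hN
      have : (N : ℝ) ≤ n := by exact_mod_cast hn
      nlinarith [sq_nonneg η]
  rw [lintegral_zero] at htail
  refine eventually_whp.2 (tendsto_of_tendsto_of_tendsto_of_le_of_le tendsto_const_nhds htail
    (fun _ => zero_le) fun n => ?_)
  calc μ {ω | ¬ ∀ k < n, f (X k ω) ≤ η * √(n : ℝ)}
      ≤ μ (⋃ k ∈ Finset.range n, {ω | η ^ 2 * n < f (X k ω) ^ 2}) := by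
        refine measure_mono fun ω hω => ?_
        simp only [Set.mem_ofPred_eq, not_forall, not_le] at hω
        obtain ⟨k, hk, hlt⟩ := hω
        simp only [Set.mem_iUnion, Finset.mem_range, Set.mem_ofPred_eq]
        refine ⟨k, hk, ?_⟩
        have := pow_lt_pow_left₀ hlt (by positivity) two_ne_zero
        rwa [mul_pow, Real.sq_sqrt (Nat.cast_nonneg n)] at this
    _ ≤ ∑ k ∈ Finset.range n, μ {ω | η ^ 2 * n < f (X k ω) ^ 2} :=
        measure_biUnion_finset_le _ _
    _ = ∑ k ∈ Finset.range n, P {x | η ^ 2 * n < f x ^ 2} := by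
        refine Finset.sum_congr rfl fun k _ => ?_
        rw [← (hlaw k).map_eq, Measure.map_apply_of_aemeasurable (hlaw k).aemeasurable (hset n)]
        rfl
    _ = _ := by
        rw [lintegral_indicator_const (hset n)]
        simp

end WithHighProbability

/-! ### The convex conjugate and its second-order expansion at zero -/

section Conjugate

variable {φ : ℝ → ℝ≥0∞} {ψ : ℝ → ℝ}

lemma mul_sub_le_conjugate (hψ : ∀ t, (ψ t : EReal) = fenchelLegendre φ t) (t x : ℝ) (hx : φ x ≠ ∞) :
    t * x - (φ x).toReal ≤ ψ t := by
  have h1 : ((t * x : ℝ) : EReal) - ((φ x : ℝ≥0∞) : EReal) ≤ (ψ t : EReal) := by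
    rw [hψ, fenchelLegendre]
    exact le_iSup (fun x : ℝ => ((t * x : ℝ) : EReal) - ((φ x : ℝ≥0∞) : EReal)) x
  rw [← EReal.coe_toReal (x := ((φ x : ℝ≥0∞) : EReal)) (by simpa using hx) (by simp)] at h1
  rw [EReal.toReal_coe_ennreal] at h1
  exact_mod_cast h1

lemma conjugate_le (hψ : ∀ t, (ψ t : EReal) = fenchelLegendre φ t) {t B : ℝ}
    (h : ∀ x, φ x ≠ ∞ → t * x - (φ x).toReal ≤ B) : ψ t ≤ B := by
  have h1 : (ψ t : EReal) ≤ (B : EReal) := by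
    rw [hψ, fenchelLegendre]
    refine iSup_le fun x => ?_
    by_cases hx : φ x = ∞
    · simp [hx]
    · rw [← EReal.coe_toReal (x := ((φ x : ℝ≥0∞) : EReal)) (by simpa using hx) (by simp),
        EReal.toReal_coe_ennreal]
      exact_mod_cast h x hx
  exact_mod_cast h1

lemma le_conjugate (hφ : φ 1 = 0) (hψ : ∀ t, (ψ t : EReal) = fenchelLegendre φ t) (t : ℝ) :
    t ≤ ψ t := by
  have := mul_sub_le_conjugate hψ t 1 (by simp [hφ])
  simpa [hφ] using this

lemma conjugate_zero (hφ : φ 1 = 0) (hψ : ∀ t, (ψ t : EReal) = fenchelLegendre φ t) :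
    ψ 0 = 0 :=
  le_antisymm (conjugate_le hψ fun x _ => by simp) (le_conjugate hφ hψ 0)

lemma convexOn_conjugate (hψ : ∀ t, (ψ t : EReal) = fenchelLegendre φ t) :
    ConvexOn ℝ Set.univ ψ := by
  refine ⟨convex_univ, fun s _ t _ a b ha hb hab => ?_⟩
  refine conjugate_le hψ fun x hx => ?_
  have h1 := mul_le_mul_of_nonneg_left (mul_sub_le_conjugate hψ s x hx) ha
  have h2 := mul_le_mul_of_nonneg_left (mul_sub_le_conjugate hψ t x hx) hb
  have h3 : (φ x).toReal = (a + b) * (φ x).toReal := by rw [hab, one_mul]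
  simp only [smul_eq_mul]
  nlinarith

end Conjugate

/-- The part `ψ(t) - t` of a convex conjugate which is of second order at zero. -/
def tilt (ψ : ℝ → ℝ) (t : ℝ) : ℝ := ψ t - t

/-- The properties of a convex conjugate `ψ` used in the asymptotic analysis. -/
structure ConjugateFacts (ψ : ℝ → ℝ) : Prop where
  contDiff : ContDiff ℝ 2 ψ
  zero : ψ 0 = 0
  deriv_zero : deriv ψ 0 = 1
  deriv2_zero : deriv (deriv ψ) 0 = 1
  le : ∀ t, t ≤ ψ t
  convex : ConvexOn ℝ Set.univ ψ

/-- A bound on the second derivative between `0` and `t` bounds the remainder of the first-order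
Taylor expansion at `0`. -/
lemma abs_le_of_second_deriv_le {f f' f'' : ℝ → ℝ} (hf : ∀ t, HasDerivAt f (f' t) t)
    (hf' : ∀ t, HasDerivAt f' (f'' t) t) (h0 : f 0 = 0) (h0' : f' 0 = 0) {t B : ℝ}
    (hB : ∀ s ∈ Set.Icc (0 : ℝ) 1, |f'' (s * t)| ≤ B) : |f t| ≤ B * t ^ 2 := by
  have h1 : ∀ s ∈ Set.Icc (0 : ℝ) 1, |f' (s * t)| ≤ B * |t| := by
    intro s hs
    have h2 := Convex.norm_image_sub_le_of_norm_hasDerivWithin_le (f := fun r => f' (r * t))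
      (f' := fun r => f'' (r * t) * t) (C := B * |t|) (s := Set.Icc (0 : ℝ) 1) (x := 0) (y := s)
      (fun r _ => ((hf' (r * t)).comp r (hasDerivAt_mul_const t)).hasDerivWithinAt)
      (fun r hr => by
        rw [Real.norm_eq_abs, abs_mul]
        exact mul_le_mul_of_nonneg_right (hB r hr) (abs_nonneg t))
      (convex_Icc 0 1) (by simp) hs
    simp only [zero_mul, h0', sub_zero, Real.norm_eq_abs, abs_of_nonneg hs.1] at h2
    have hB0 : 0 ≤ B := (abs_nonneg _).trans (hB 0 (by simp))
    exact h2.trans (mul_le_of_le_one_right (by positivity) hs.2)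
  have h3 := Convex.norm_image_sub_le_of_norm_hasDerivWithin_le (f := fun r => f (r * t))
      (f' := fun r => f' (r * t) * t) (C := B * |t| * |t|) (s := Set.Icc (0 : ℝ) 1) (x := 0) (y := 1)
      (fun r _ => ((hf (r * t)).comp r (hasDerivAt_mul_const t)).hasDerivWithinAt)
      (fun r hr => by
        rw [Real.norm_eq_abs, abs_mul]
        exact mul_le_mul_of_nonneg_right (h1 r hr) (abs_nonneg t))
      (convex_Icc 0 1) (by simp) (by simp)
  simp only [zero_mul, h0, sub_zero, Real.norm_eq_abs, one_mul, abs_one, mul_one] at h3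
  rwa [mul_assoc, abs_mul_abs_self, ← sq] at h3

namespace ConjugateFacts

variable {ψ : ℝ → ℝ} (h : ConjugateFacts ψ)
include h

lemma hasDerivAt (t : ℝ) : HasDerivAt ψ (deriv ψ t) t :=
  (h.contDiff.differentiable (by norm_num) t).hasDerivAt

lemma contDiff_deriv : ContDiff ℝ 1 (deriv ψ) :=
  (contDiff_succ_iff_deriv (n := 1).1 (by simpa [one_add_one_eq_two] using h.contDiff)).2.2

lemma hasDerivAt_deriv (t : ℝ) : HasDerivAt (deriv ψ) (deriv (deriv ψ) t) t :=
  (h.contDiff_deriv.differentiable (by norm_num) t).hasDerivAt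

lemma continuous_deriv2 : Continuous (deriv (deriv ψ)) :=
  h.contDiff_deriv.continuous_deriv le_rfl

lemma continuous_tilt : Continuous (tilt ψ) := h.contDiff.continuous.sub continuous_id

lemma tilt_nonneg (t : ℝ) : 0 ≤ tilt ψ t := sub_nonneg.2 (h.le t)

lemma tilt_zero : tilt ψ 0 = 0 := by simp [tilt, h.zero]

lemma tilt_le {t B : ℝ} (hB : ∀ s ∈ Set.Icc (0 : ℝ) 1, |deriv (deriv ψ) (s * t)| ≤ B) :
    tilt ψ t ≤ B * t ^ 2 :=
  (le_abs_self _).trans <| abs_le_of_second_deriv_le (f' := fun t => deriv ψ t - 1)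
    (fun t => (h.hasDerivAt t).sub (hasDerivAt_id t)) (fun t => (h.hasDerivAt_deriv t).sub_const 1)
    h.tilt_zero (by simp [h.deriv_zero]) hB

/-- `ψ(t) - t = t² / 2 + o(t²)`. -/
lemma exists_abs_tilt_sub_le {ε : ℝ} (hε : 0 < ε) :
    ∃ δ > 0, ∀ t, |t| ≤ δ → |tilt ψ t - 2⁻¹ * t ^ 2| ≤ ε * t ^ 2 := by
  obtain ⟨δ, hδ, h2⟩ := Metric.continuousAt_iff.1 (h.continuous_deriv2.continuousAt (x := 0)) ε hε
  refine ⟨δ / 2, half_pos hδ, fun t ht => ?_⟩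
  refine abs_le_of_second_deriv_le (f := fun t => tilt ψ t - 2⁻¹ * t ^ 2)
    (f' := fun t => deriv ψ t - 1 - t)
    (f'' := fun t => deriv (deriv ψ) t - 1) (fun t => ?_)
    (fun t => ((h.hasDerivAt_deriv t).sub_const 1).sub (hasDerivAt_id t))
    (by simp [h.tilt_zero]) (by simp [h.deriv_zero]) fun s hs => ?_
  · have h3 := ((h.hasDerivAt t).sub (hasDerivAt_id t)).sub ((hasDerivAt_pow 2 t).const_mul 2⁻¹)
    exact h3.congr_deriv (by simp)
  · have h4 : dist (s * t) 0 < δ := by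
      rw [dist_zero_right, norm_mul, Real.norm_eq_abs, Real.norm_eq_abs, abs_of_nonneg hs.1]
      have : s * |t| ≤ |t| := mul_le_of_le_one_left (abs_nonneg t) hs.2
      linarith
    have h5 := h2 h4
    rw [h.deriv2_zero, Real.dist_eq] at h5
    exact h5.le

/-- By convexity and the positive curvature at zero, `ψ(t) - t` vanishes at `0` only. -/
lemma tilt_pos {t : ℝ} (ht : t ≠ 0) : 0 < tilt ψ t := by
  refine (h.tilt_nonneg t).lt_of_ne' fun h0 => ?_
  obtain ⟨δ, hδ, h1⟩ := h.exists_abs_tilt_sub_le (ε := 4⁻¹) (by norm_num)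
  -- a point of the segment from `0` to `t`, close to `0`
  set s := min 1 (δ / |t|) with hs
  have ht' : 0 < |t| := abs_pos.2 ht
  have hs0 : 0 < s := lt_min one_pos (by positivity)
  have hs1 : s ≤ 1 := min_le_left _ _
  have h2 := h.convex.2 (Set.mem_univ t) (Set.mem_univ 0) hs0.le (sub_nonneg.2 hs1) (by ring)
  simp only [smul_eq_mul, mul_zero, add_zero, h.zero] at h2
  have h3 : |s * t| ≤ δ := by
    rw [abs_mul, abs_of_pos hs0, ← le_div_iff₀ ht']
    exact min_le_right _ _
  have h4 := (abs_le.1 (h1 _ h3)).1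
  have h5 : tilt ψ (s * t) ≤ 0 := by
    unfold tilt at h0 ⊢
    nlinarith
  have h6 : 0 < (s * t) ^ 2 := by positivity
  linarith

end ConjugateFacts

/-! ### A saddle-point argmin theorem -/

section Saddle

variable {ι P V : Type*} [NormedAddCommGroup P] [NormedSpace ℝ P] [NormedAddCommGroup V]
  [InnerProductSpace ℝ V]

/-- The quadratic saddle function `⟪v, S + J u⟫ - ½ ⟪v, A v⟫`, the limit of the rescaled
criterion. -/
def saddleQuad (A : V →L[ℝ] V) (J : P →L[ℝ] V) (S : V) (u : P) (v : V) : ℝ :=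
  inner ℝ v (S + J u) - 2⁻¹ * inner ℝ v (A v)

/-- Completing the square in the saddle function, first in `v` and then in `u`, around its saddle
point `(u₀, v₀)`. With `x = B J (u - u₀)`, the maximiser in `v` is `v₀ + x`. -/
lemma saddleQuad_eq {A B : V →L[ℝ] V} {J : P →L[ℝ] V}
    (hsymm : ∀ v w, inner ℝ v (A w) = inner ℝ w (A v)) (hAB : ∀ v, A (B v) = v)
    {S v₀ : V} {u₀ : P} (h1 : A v₀ = S + J u₀) (h2 : ∀ u, inner ℝ v₀ (J u) = 0) (u : P) (v : V) :
    saddleQuad A J S u v = 2⁻¹ * inner ℝ v₀ (A v₀)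
      + 2⁻¹ * inner ℝ (B (J (u - u₀))) (A (B (J (u - u₀))))
      - 2⁻¹ * inner ℝ (v - (v₀ + B (J (u - u₀)))) (A (v - (v₀ + B (J (u - u₀))))) := by
  set x := B (J (u - u₀)) with hx
  have hAx : A x = J (u - u₀) := hAB _
  have hS : S + J u = A (v₀ + x) := by
    rw [map_add, h1, hAx, map_sub]
    abel
  have h3 : inner ℝ v₀ (A x) = 0 := by rw [hAx, h2]
  have h4 : inner ℝ x (A v₀) = 0 := by rw [hsymm, h3]
  unfold saddleQuad
  rw [hS]
  simp only [map_add, map_sub, inner_add_left, inner_add_right, inner_sub_left, inner_sub_right,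
    h3, h4]
  rw [hsymm v₀ v, hsymm x v]
  ring

omit [InnerProductSpace ℝ V] in
lemma tendsto_zero_of_sq_le {F : Filter ι} {x : ι → V} {q : ι → ℝ} {a : ℝ} (ha : 0 < a)
    (hq : Tendsto q F (𝓝 0)) (h : ∀ᶠ i in F, a * ‖x i‖ ^ 2 ≤ q i) : Tendsto x F (𝓝 0) := by
  have h1 : Tendsto (fun i => ‖x i‖ ^ 2) F (𝓝 0) := by
    have h2 : Tendsto (fun i => a⁻¹ * q i) F (𝓝 0) := by simpa using hq.const_mul a⁻¹
    refine tendsto_of_tendsto_of_tendsto_of_le_of_le' tendsto_const_nhds h2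
      (Eventually.of_forall fun i => sq_nonneg _) ?_
    filter_upwards [h] with i hi
    rw [← div_eq_inv_mul, le_div_iff₀ ha]
    linarith
  rw [tendsto_zero_iff_norm_tendsto_zero]
  have := h1.sqrt
  simpa using this

/-- The data of a rescaled saddle-point problem along a filter `F`: criteria `h i φ ξ`, with linear
parts `⟪ξ, Z i φ⟫` where `Z i φ = z φ - b φ • D i`, at the scale `τ i → ∞`. The noise `τ D` is
bounded, the criterion lies globally below a concave quadratic function, and at distance `O(1/τ)`
from `ξ = 0` it is close to a quadratic function. `sel i φ` is an inner maximiser and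
`φhat i` an outer minimiser. The constants are the curvature `c` of the global bound, the radius `ρ`
of the ball on which it holds, the coercivity constant `a` of the limiting quadratic form `A`, with
right inverse `B`, and the injectivity constant `κ` of the derivative `J` of `z`. -/
structure SaddleProblem (F : Filter ι) (τ : ι → ℝ) (h : ι → P → V → ℝ) (Z : ι → P → V)
    (z : P → V) (b : P → ℝ) (D : ι → V) (φs : P) (U : Set P) (c ρ : ℝ) (A B : V →L[ℝ] V)
    (J : P →L[ℝ] V) (a κ : ℝ) (φhat : ι → P) (sel : ι → P → V) : Prop where
  scale : Tendsto τ F atTop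
  nhds : U ∈ 𝓝 φs
  c_pos : 0 < c
  ρ_pos : 0 < ρ
  a_pos : 0 < a
  κ_pos : 0 < κ
  coercive : ∀ v, a * ‖v‖ ^ 2 ≤ inner ℝ v (A v)
  symm : ∀ v w, inner ℝ v (A w) = inner ℝ w (A v)
  right_inv : ∀ v, A (B v) = v
  inj : ∀ u, κ * ‖u‖ ≤ ‖J u‖
  h_zero : ∀ i φ, h i φ 0 = 0
  upper : ∀ᶠ i in F, ∀ φ ∈ U, ∀ ξ, ‖ξ‖ ≤ ρ → h i φ ξ ≤ inner ℝ ξ (Z i φ) - c * ‖ξ‖ ^ 2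
  loc : ∀ R ε : ℝ, 0 < ε → ∃ U' ∈ 𝓝 φs, ∀ᶠ i in F, ∀ φ ∈ U', ∀ ξ, ‖τ i • ξ‖ ≤ R →
    |τ i ^ 2 * (h i φ ξ - inner ℝ ξ (Z i φ)) + 2⁻¹ * inner ℝ (τ i • ξ) (A (τ i • ξ))| ≤ ε
  Z_eq : ∀ i φ, Z i φ = z φ - b φ • D i
  z_zero : z φs = 0
  z_deriv : HasFDerivAt z J φs
  b_cont : ContinuousAt b φs
  noise : (fun i => τ i • D i) =O[F] fun _ => (1 : ℝ)
  φhat_tendsto : Tendsto φhat F (𝓝 φs)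
  isMax : ∀ᶠ i in F, ∀ φ ∈ U, ‖sel i φ‖ ≤ ρ ∧ ∀ ξ, ‖ξ‖ ≤ ρ → h i φ ξ ≤ h i φ (sel i φ)
  isMin : ∀ᶠ i in F, ∀ φ ∈ U, h i (φhat i) (sel i (φhat i)) ≤ h i φ (sel i φ)

namespace SaddleProblem

variable {F : Filter ι} {τ : ι → ℝ} {h : ι → P → V → ℝ} {Z : ι → P → V}
    {z : P → V} {b : P → ℝ} {D : ι → V} {φs : P} {U : Set P} {c ρ : ℝ} {A B : V →L[ℝ] V}
    {J : P →L[ℝ] V} {a κ : ℝ} {φhat : ι → P} {sel : ι → P → V}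

/-- A point at distance `O(1/τ)` from `φs` tends to `φs`. -/
lemma tendsto_of_isBigO (hp : SaddleProblem F τ h Z z b D φs U c ρ A B J a κ φhat sel) {φ : ι → P}
    (hφ : (fun i => τ i • (φ i - φs)) =O[F] fun _ => (1 : ℝ)) : Tendsto φ F (𝓝 φs) := by
  have h1 : Tendsto (fun i => (τ i)⁻¹ • (τ i • (φ i - φs))) F (𝓝 0) := by
    have h2 : (fun i => (τ i)⁻¹ • (τ i • (φ i - φs))) =o[F] fun _ => (1 : ℝ) := by
      have := ((Asymptotics.isLittleO_one_iff ℝ).2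
        (tendsto_inv_atTop_zero.comp hp.scale)).smul_isBigO hφ
      simpa using this
    exact (Asymptotics.isLittleO_one_iff ℝ).1 h2
  have h3 : Tendsto (fun i => φ i - φs) F (𝓝 0) := by
    refine h1.congr' ?_
    filter_upwards [hp.scale.eventually_gt_atTop 0] with i hi
    rw [smul_smul, inv_mul_cancel₀ hi.ne', one_smul]
  simpa using h3.add_const φs

/-- The expansion `τ Z(φ) = S + J u + o(1)` at a point `φ = φs + u / τ` with `u = O(1)`, where
`S = -b(φs) τ D`. -/
lemma tendsto_Z (hp : SaddleProblem F τ h Z z b D φs U c ρ A B J a κ φhat sel) {φ : ι → P}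
    (hφ : (fun i => τ i • (φ i - φs)) =O[F] fun _ => (1 : ℝ)) :
    Tendsto (fun i => τ i • Z i (φ i) - (-(b φs • τ i • D i) + J (τ i • (φ i - φs)))) F (𝓝 0) := by
  have ht := hp.tendsto_of_isBigO hφ
  have h1 : (fun i => τ i • (z (φ i) - z φs - J (φ i - φs))) =o[F] fun _ => (1 : ℝ) := by
    have h2 := (hp.z_deriv.isLittleO).comp_tendsto ht
    have h3 : (fun i => τ i • (z (φ i) - z φs - J (φ i - φs))) =o[F]
        fun i => τ i • (φ i - φs) := (Asymptotics.isBigO_refl τ F).smul_isLittleO h2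
    exact h3.trans_isBigO hφ
  have h4 : (fun i => (b (φ i) - b φs) • τ i • D i) =o[F] fun _ => (1 : ℝ) := by
    have h5 : Tendsto (fun i => b (φ i) - b φs) F (𝓝 0) := by
      simpa using (hp.b_cont.tendsto.comp ht).sub_const (b φs)
    simpa using ((Asymptotics.isLittleO_one_iff ℝ).2 h5).smul_isBigO hp.noise
  refine ((Asymptotics.isLittleO_one_iff ℝ).1 (h1.sub h4)).congr fun i => ?_
  rw [hp.Z_eq, hp.z_zero, map_smul, smul_comm (b φs) (τ i), smul_sub, smul_sub, smul_sub, sub_smul,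
    smul_comm (b (φ i)), smul_comm (b φs), smul_zero]
  abel

/-- On the scale `1/τ` the criterion is close to the quadratic saddle function. -/
lemma tendsto_local (hp : SaddleProblem F τ h Z z b D φs U c ρ A B J a κ φhat sel) {φ : ι → P}
    {ξ : ι → V} (hφ : (fun i => τ i • (φ i - φs)) =O[F] fun _ => (1 : ℝ))
    (hξ : (fun i => τ i • ξ i) =O[F] fun _ => (1 : ℝ)) :
    Tendsto (fun i => τ i ^ 2 * h i (φ i) (ξ i) -
      saddleQuad A J (-(b φs • τ i • D i)) (τ i • (φ i - φs)) (τ i • ξ i)) F (𝓝 0) := by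
  have h1 : Tendsto (fun i => τ i ^ 2 * (h i (φ i) (ξ i) - inner ℝ (ξ i) (Z i (φ i)))
      + 2⁻¹ * inner ℝ (τ i • ξ i) (A (τ i • ξ i))) F (𝓝 0) := by
    obtain ⟨R, hR⟩ := (Asymptotics.isBigO_one_iff ℝ).1 hξ
    rw [eventually_map] at hR
    refine Metric.tendsto_nhds.2 fun ε hε => ?_
    obtain ⟨U', hU', hev⟩ := hp.loc R (ε / 2) (half_pos hε)
    filter_upwards [hev, hR, (hp.tendsto_of_isBigO hφ).eventually hU'] with i h1 h2 h3
    rw [Real.dist_eq, sub_zero]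
    exact (h1 _ h3 _ h2).trans_lt (half_lt_self hε)
  have h2 : Tendsto (fun i => (inner ℝ (τ i • ξ i)
      (τ i • Z i (φ i) - (-(b φs • τ i • D i) + J (τ i • (φ i - φs)))) : ℝ)) F (𝓝 0) := by
    have h3 := hξ.norm_left.mul_isLittleO
      ((Asymptotics.isLittleO_one_iff ℝ).2 (hp.tendsto_Z hφ)).norm_left
    simp only [mul_one] at h3
    refine (Asymptotics.isLittleO_one_iff ℝ).1 (Asymptotics.IsBigO.trans_isLittleO ?_ h3)
    refine Asymptotics.IsBigO.of_bound 1 (Eventually.of_forall fun i => ?_)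
    rw [one_mul, norm_mul, norm_norm, norm_norm]
    exact norm_inner_le_norm _ _
  have h3 := h1.add h2
  rw [add_zero] at h3
  refine h3.congr fun i => ?_
  unfold saddleQuad
  rw [inner_sub_right (𝕜 := ℝ) (τ i • ξ i) (τ i • Z i (φ i)),
    real_inner_smul_left (ξ i) (τ i • Z i (φ i)), real_inner_smul_right (ξ i) (Z i (φ i))]
  ring

/-- The inner maximisers are controlled by the linear parts of the criterion. -/
lemma eventually_norm_sel_le (hp : SaddleProblem F τ h Z z b D φs U c ρ A B J a κ φhat sel) :
    ∀ᶠ i in F, ∀ φ ∈ U, c * ‖sel i φ‖ ≤ ‖Z i φ‖ ∧ c * h i φ (sel i φ) ≤ ‖Z i φ‖ ^ 2 := by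
  filter_upwards [hp.upper, hp.isMax] with i h1 h2 φ hφ
  obtain ⟨h3, h4⟩ := h2 φ hφ
  have h5 := h1 φ hφ _ h3
  have h6 := h4 0 (by simpa using hp.ρ_pos.le)
  rw [hp.h_zero] at h6
  have h7 := real_inner_le_norm (sel i φ) (Z i φ)
  have hc := hp.c_pos
  have h8 : c * ‖sel i φ‖ ≤ ‖Z i φ‖ := by
    rcases (norm_nonneg (sel i φ)).eq_or_lt with h0 | h0
    · rw [← h0, mul_zero]
      exact norm_nonneg _
    · refine le_of_mul_le_mul_left ?_ h0
      nlinarith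
  refine ⟨h8, ?_⟩
  have h9 : c * h i φ (sel i φ) ≤ (c * ‖sel i φ‖) * ‖Z i φ‖ := by
    nlinarith [mul_nonneg hc.le (sq_nonneg ‖sel i φ‖)]
  nlinarith [norm_nonneg (Z i φ)]

lemma isBigO_sel (hp : SaddleProblem F τ h Z z b D φs U c ρ A B J a κ φhat sel) {φ : ι → P}
    (hφ : ∀ᶠ i in F, φ i ∈ U) (hZ : (fun i => τ i • Z i (φ i)) =O[F] fun _ => (1 : ℝ)) :
    (fun i => τ i • sel i (φ i)) =O[F] fun _ => (1 : ℝ) := by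
  refine Asymptotics.IsBigO.trans (Asymptotics.IsBigO.of_bound c⁻¹ ?_) hZ
  filter_upwards [hp.eventually_norm_sel_le, hφ] with i h1 h2
  rw [norm_smul, norm_smul, ← div_eq_inv_mul, le_div_iff₀ hp.c_pos]
  nlinarith [(h1 _ h2).1, norm_nonneg (τ i)]

lemma isBigO_Z (hp : SaddleProblem F τ h Z z b D φs U c ρ A B J a κ φhat sel) {φ : ι → P}
    (hφ : (fun i => τ i • (φ i - φs)) =O[F] fun _ => (1 : ℝ)) :
    (fun i => τ i • Z i (φ i)) =O[F] fun _ => (1 : ℝ) := by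
  have h1 := ((Asymptotics.isLittleO_one_iff ℝ).2 (hp.tendsto_Z hφ)).isBigO
  have h2 := ((hp.noise.const_smul_left (b φs)).neg_left).add ((J.isBigO_comp _ _).trans hφ)
  refine (h1.add h2).congr_left fun i => ?_
  simp

/-- The linear part of the criterion at the outer minimiser is `O(1/τ)`: otherwise the inner
supremum at the minimiser, tested at a point of norm `1/τ` in the direction of the linear part,
would exceed the inner supremum at `φs`, which is `O(1/τ²)`. -/
lemma isBigO_Z_φhat (hp : SaddleProblem F τ h Z z b D φs U c ρ A B J a κ φhat sel) :
    (fun i => τ i • Z i (φhat i)) =O[F] fun _ => (1 : ℝ) := by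
  obtain ⟨U', hU', hloc⟩ := hp.loc 1 1 one_pos
  have hZs : (fun i => τ i • Z i φs) =O[F] fun _ => (1 : ℝ) :=
    hp.isBigO_Z (φ := fun _ => φs) (by
      simp only [sub_self, smul_zero]
      exact Asymptotics.isBigO_zero _ _)
  obtain ⟨C, hC⟩ := (Asymptotics.isBigO_one_iff ℝ).1 hZs
  rw [eventually_map] at hC
  refine Asymptotics.IsBigO.of_bound (c⁻¹ * C ^ 2 + 2⁻¹ * ‖A‖ + 1) ?_
  filter_upwards [hloc, hC, hp.φhat_tendsto.eventually hU', hp.φhat_tendsto.eventually hp.nhds,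
    hp.isMax, hp.isMin, hp.eventually_norm_sel_le, hp.scale.eventually_gt_atTop 0,
    (hp.scale.eventually_ge_atTop (ρ⁻¹))] with i h1 h2 h3 h4 h5 h6 h7 h8 h9
  have hφs : φs ∈ U := mem_of_mem_nhds hp.nhds
  have hc := hp.c_pos
  rw [norm_one, mul_one]
  rcases eq_or_ne (Z i (φhat i)) 0 with h0 | h0
  · rw [h0, smul_zero, norm_zero]
    positivity
  set w : V := ‖Z i (φhat i)‖⁻¹ • Z i (φhat i) with hw
  have hwn : ‖w‖ = 1 := by
    rw [hw, norm_smul, norm_inv, norm_norm, inv_mul_cancel₀ (norm_ne_zero_iff.2 h0)]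
  have hτw : τ i • (τ i)⁻¹ • w = w := by rw [smul_smul, mul_inv_cancel₀ h8.ne', one_smul]
  have h10 := h1 _ h3 ((τ i)⁻¹ • w) (by rw [hτw, hwn])
  rw [hτw] at h10
  have hnorm : ‖(τ i)⁻¹ • w‖ ≤ ρ := by
    rw [norm_smul, hwn, mul_one, norm_inv, Real.norm_of_nonneg h8.le]
    exact inv_le_of_inv_le₀ hp.ρ_pos h9
  have h11 := (h5 _ h4).2 _ hnorm
  have h12 := h6 _ hφs
  have h13 := (h7 _ hφs).2
  have h14 : (inner ℝ ((τ i)⁻¹ • w) (Z i (φhat i)) : ℝ) = (τ i)⁻¹ * ‖Z i (φhat i)‖ := by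
    rw [real_inner_smul_left, hw, real_inner_smul_left, real_inner_self_eq_norm_sq]
    field_simp
  have h15 : (inner ℝ w (A w) : ℝ) ≤ ‖A‖ := by
    refine (real_inner_le_norm _ _).trans ?_
    have := A.le_opNorm w
    rw [hwn, mul_one] at this
    rw [hwn, one_mul]
    exact this
  have h16 : τ i ^ 2 * ((τ i)⁻¹ * ‖Z i (φhat i)‖) = τ i * ‖Z i (φhat i)‖ := by
    field_simp
  rw [h14, mul_sub, h16] at h10
  have h17 : τ i ^ 2 * h i (φhat i) ((τ i)⁻¹ • w) ≤ c⁻¹ * C ^ 2 := by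
    have h18 : c * h i (φhat i) ((τ i)⁻¹ • w) ≤ ‖Z i φs‖ ^ 2 :=
      (mul_le_mul_of_nonneg_left (h11.trans h12) hc.le).trans h13
    rw [← div_eq_inv_mul, le_div_iff₀ hc]
    have h19 : (τ i * ‖Z i φs‖) ^ 2 ≤ C ^ 2 := by
      rw [norm_smul, Real.norm_of_nonneg h8.le] at h2
      exact pow_le_pow_left₀ (by positivity) h2 2
    nlinarith [mul_le_mul_of_nonneg_left h18 (sq_nonneg (τ i))]
  rw [norm_smul, Real.norm_of_nonneg h8.le]
  have h20 := (abs_le.1 h10).1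
  linarith

/-- The outer minimiser converges at the rate `1/τ`. -/
lemma isBigO_φhat (hp : SaddleProblem F τ h Z z b D φs U c ρ A B J a κ φhat sel) :
    (fun i => τ i • (φhat i - φs)) =O[F] fun _ => (1 : ℝ) := by
  have h1 : (fun i => τ i • z (φhat i)) =O[F] fun _ => (1 : ℝ) := by
    have hb : (fun i => b (φhat i)) =O[F] fun _ => (1 : ℝ) :=
      (hp.b_cont.tendsto.comp hp.φhat_tendsto).isBigO_one ℝ
    have h2 := hb.smul hp.noise
    refine (hp.isBigO_Z_φhat.add (by simpa using h2)).congr_left fun i => ?_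
    rw [hp.Z_eq, smul_sub, smul_comm (τ i) (b (φhat i))]
    abel
  refine Asymptotics.IsBigO.trans (Asymptotics.IsBigO.of_bound (2 / κ) ?_) h1
  have hκ := hp.κ_pos
  have h3 := (hp.z_deriv.isLittleO.comp_tendsto hp.φhat_tendsto).def (half_pos hκ)
  filter_upwards [h3] with i h4
  simp only [Function.comp_apply, hp.z_zero, sub_zero] at h4
  have h5 := hp.inj (φhat i - φs)
  have h6 : ‖J (φhat i - φs)‖ ≤ ‖z (φhat i) - J (φhat i - φs)‖ + ‖z (φhat i)‖ := by
    have := norm_sub_le (z (φhat i)) (z (φhat i) - J (φhat i - φs))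
    rw [sub_sub_cancel] at this
    linarith
  have h7 : κ * ‖φhat i - φs‖ ≤ 2 * ‖z (φhat i)‖ := by linarith
  rw [norm_smul, norm_smul, div_mul_eq_mul_div, le_div_iff₀ hκ]
  nlinarith [norm_nonneg (τ i)]

/-- The rescaled saddle point of the criterion is asymptotically the saddle point
`(u S, v S)`, `S = -b(φs) τ D`, of the limiting quadratic function. -/
theorem tendsto_saddle (hp : SaddleProblem F τ h Z z b D φs U c ρ A B J a κ φhat sel)
    (u : V →L[ℝ] P) (v : V →L[ℝ] V) (huv : ∀ S, A (v S) = S + J (u S))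
    (hv : ∀ S x, inner ℝ (v S) (J x) = 0) :
    Tendsto (fun i => τ i • (φhat i - φs) - u (-(b φs • τ i • D i))) F (𝓝 0) ∧
    Tendsto (fun i => τ i • sel i (φhat i) - v (-(b φs • τ i • D i))) F (𝓝 0) := by
  set S : ι → V := fun i => -(b φs • τ i • D i) with hS
  have hSO : S =O[F] fun _ => (1 : ℝ) := (hp.noise.const_smul_left (b φs)).neg_left
  have hu := hp.isBigO_φhat
  have hsel := hp.isBigO_sel (hp.φhat_tendsto.eventually hp.nhds) hp.isBigO_Z_φhat
  have ha := hp.a_pos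
  -- the deviation from the saddle point, and the inner maximiser of the limit at `φhat`
  set w : ι → P := fun i => τ i • (φhat i - φs) - u (S i) with hw
  set x : ι → V := fun i => B (J (w i)) with hx
  have huO : (fun i => u (S i)) =O[F] fun _ => (1 : ℝ) := (u.isBigO_comp _ _).trans hSO
  have hwO : w =O[F] fun _ => (1 : ℝ) := hu.sub huO
  have hxO : x =O[F] fun _ => (1 : ℝ) :=
    (B.isBigO_comp _ _).trans ((J.isBigO_comp _ _).trans hwO)
  have hv1O : (fun i => v (S i) + x i) =O[F] fun _ => (1 : ℝ) :=
    ((v.isBigO_comp _ _).trans hSO).add hxO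
  -- test points in the original scale
  set ξ₁ : ι → V := fun i => (τ i)⁻¹ • (v (S i) + x i) with hξ₁
  set φ₁ : ι → P := fun i => φs + (τ i)⁻¹ • u (S i) with hφ₁
  have hτ0 := hp.scale.eventually_gt_atTop 0
  have e1 : ∀ᶠ i in F, τ i • ξ₁ i = v (S i) + x i := by
    filter_upwards [hτ0] with i hi
    rw [hξ₁, smul_smul, mul_inv_cancel₀ hi.ne', one_smul]
  have e2 : ∀ᶠ i in F, τ i • (φ₁ i - φs) = u (S i) := by
    filter_upwards [hτ0] with i hi
    simp only [hφ₁, add_sub_cancel_left]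
    rw [smul_smul, mul_inv_cancel₀ hi.ne', one_smul]
  have hξ₁O : (fun i => τ i • ξ₁ i) =O[F] fun _ => (1 : ℝ) :=
    hv1O.congr' (e1.mono fun i hi => hi.symm) EventuallyEq.rfl
  have hφ₁O : (fun i => τ i • (φ₁ i - φs)) =O[F] fun _ => (1 : ℝ) :=
    huO.congr' (e2.mono fun i hi => hi.symm) EventuallyEq.rfl
  have hφ₁U := (hp.tendsto_of_isBigO hφ₁O).eventually hp.nhds
  have hsel₁ := hp.isBigO_sel hφ₁U (hp.isBigO_Z hφ₁O)
  have L1 := hp.tendsto_local hu hsel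
  have L2 := hp.tendsto_local hu hξ₁O
  have L3 := hp.tendsto_local hφ₁O hsel₁
  have hξ₁small : ∀ᶠ i in F, ‖ξ₁ i‖ ≤ ρ := by
    have h1 : Tendsto ξ₁ F (𝓝 0) := by
      have h2 := ((Asymptotics.isLittleO_one_iff ℝ).2
        (tendsto_inv_atTop_zero.comp hp.scale)).smul_isBigO hv1O
      exact (Asymptotics.isLittleO_one_iff ℝ).1 (h2.congr_right fun _ => one_smul _ _)
    have h3 := h1.norm
    rw [norm_zero] at h3
    exact h3.eventually_le_const hp.ρ_pos
  -- the criterion at the saddle point exceeds its value at `(φhat, ξ₁)`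
  have Q := fun (i : ι) => saddleQuad_eq hp.symm hp.right_inv (huv (S i)) (hv (S i))
  have K1 : Tendsto (fun i => τ i • sel i (φhat i) - (v (S i) + x i)) F (𝓝 0) := by
    have hlim := L1.sub L2
    rw [sub_zero] at hlim
    refine tendsto_zero_of_sq_le (a := 2⁻¹ * a) (by positivity) hlim ?_
    filter_upwards [e1, hp.isMax, hp.φhat_tendsto.eventually hp.nhds, hξ₁small] with i h1 h2 h3 h4
    have h5 := (h2 _ h3).2 _ h4
    have h6 := hp.coercive (τ i • sel i (φhat i) - (v (S i) + x i))
    have h7 := mul_le_mul_of_nonneg_left h5 (sq_nonneg (τ i))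
    rw [h1]
    change _ ≤ _ - saddleQuad A J (S i) _ _ - (_ - saddleQuad A J (S i) _ _)
    rw [Q i, Q i]
    simp only [hx, hw] at h6 ⊢
    rw [sub_self (v (S i) + _), inner_zero_left]
    linarith
  have K2 : Tendsto x F (𝓝 0) := by
    have hlim := L3.sub L2
    rw [sub_zero] at hlim
    refine tendsto_zero_of_sq_le (a := 2⁻¹ * a) (by positivity) hlim ?_
    filter_upwards [e1, e2, hp.isMax, hp.isMin, hp.φhat_tendsto.eventually hp.nhds, hξ₁small,
      hφ₁U] with i h1 h1' h2 h2' h3 h4 h4'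
    have h5 := (h2 _ h3).2 _ h4
    have h6 := hp.coercive (x i)
    have h7 := mul_le_mul_of_nonneg_left (h5.trans (h2' _ h4')) (sq_nonneg (τ i))
    have h8 := (mul_nonneg ha.le (sq_nonneg _)).trans
      (hp.coercive (τ i • sel i (φ₁ i) - (v (S i) + 0)))
    rw [h1, h1']
    change _ ≤ _ - saddleQuad A J (S i) _ _ - (_ - saddleQuad A J (S i) _ _)
    rw [Q i, Q i]
    simp only [hx, hw] at h6 ⊢
    rw [sub_self (v (S i) + _), sub_self (u (S i)), map_zero, map_zero, inner_zero_left]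
    linarith
  have K3 : Tendsto w F (𝓝 0) := by
    have h1 : Tendsto (fun i => ‖A (x i)‖) F (𝓝 0) := by
      simpa using ((A.continuous.tendsto 0).comp K2).norm
    have h2 : Tendsto (fun i => κ⁻¹ * ‖A (x i)‖) F (𝓝 0) := by simpa using h1.const_mul κ⁻¹
    refine squeeze_zero_norm (fun i => ?_) h2
    rw [← div_eq_inv_mul, le_div_iff₀ hp.κ_pos, hx, hp.right_inv]
    have := hp.inj (w i)
    linarith
  refine ⟨K3, ?_⟩
  have := K1.add K2
  rw [add_zero] at this
  refine this.congr fun i => ?_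
  abel

end SaddleProblem

end Saddle

/-! ### The augmented constraint functions and the mixture -/

lemma augment_zero {ℓ : ℕ} (v : E ℓ) : augment v 0 = 1 := rfl

lemma augment_succ {ℓ : ℕ} (v : E ℓ) (i : Fin ℓ) : augment v i.succ = v i := rfl

lemma norm_sq_augment {ℓ : ℕ} (v : E ℓ) : ‖augment v‖ ^ 2 = 1 + ‖v‖ ^ 2 := by
  rw [EuclideanSpace.real_norm_sq_eq, EuclideanSpace.real_norm_sq_eq, Fin.sum_univ_succ]
  simp [augment_zero, augment_succ]

/-- `augment` as an affine map: its linear part `v ↦ (0, v₁, …, v_ℓ)`. -/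
def augmentLin (ℓ : ℕ) : E ℓ →L[ℝ] E (ℓ + 1) :=
  LinearMap.toContinuousLinearMap
    { toFun := fun v => WithLp.toLp 2 (Fin.cons (0 : ℝ) fun i => v i)
      map_add' := fun v w => by
        ext i
        refine Fin.cases ?_ (fun j => ?_) i <;> simp
      map_smul' := fun c v => by
        ext i
        refine Fin.cases ?_ (fun j => ?_) i <;> simp }

lemma augment_eq {ℓ : ℕ} (v : E ℓ) : augment v = augmentLin ℓ v + EuclideanSpace.single 0 1 := by
  ext i
  refine Fin.cases ?_ (fun j => ?_) i
  · simp [augment, augmentLin]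
  · simp [augment, augmentLin]

namespace Model

variable {r d s ℓ : ℕ} {M : Model r d s ℓ}

lemma measurable_ga : Measurable M.ga := by
  have : M.ga = fun x => augmentLin ℓ (M.g x) + EuclideanSpace.single 0 1 :=
    funext fun x => augment_eq _
  rw [this]
  exact ((augmentLin ℓ).continuous.measurable.comp M.measurable_g).add_const _

lemma integrable_ga_of_integrable {Q : Measure (E r)} [IsProbabilityMeasure Q] (h : Integrable M.g Q) :
    Integrable M.ga Q := by
  have : M.ga = fun x => augmentLin ℓ (M.g x) + EuclideanSpace.single 0 1 :=
    funext fun x => augment_eq _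
  rw [this]
  exact ((augmentLin ℓ).integrable_comp h).add (integrable_const _)

lemma integral_ga {Q : Measure (E r)} [IsProbabilityMeasure Q] (h : Integrable M.g Q) :
    ∫ x, M.ga x ∂Q = augment (∫ x, M.g x ∂Q) := by
  have : M.ga = fun x => augmentLin ℓ (M.g x) + EuclideanSpace.single 0 1 :=
    funext fun x => augment_eq _
  rw [this, integral_add ((augmentLin ℓ).integrable_comp h) (integrable_const _),
    (augmentLin ℓ).integral_comp_comm h, augment_eq]
  simp

section P₁

variable {θ : E d}

lemma isProbabilityMeasure_P₁ (hθ : θ ∈ M.Θ) : IsProbabilityMeasure (M.P₁ θ) :=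
  ⟨by simpa [P₁] using M.lintegral_p₁ θ hθ⟩

lemma integral_P₁ {F : Type*} [NormedAddCommGroup F] [NormedSpace ℝ F] (hθ : θ ∈ M.Θ)
    (f : E r → F) : ∫ x, f x ∂M.P₁ θ = ∫ x, M.p₁ θ x • f x := by
  rw [P₁, integral_withDensity_eq_integral_toReal_smul
    (M.measurable_p₁ θ hθ).ennreal_ofReal (ae_of_all _ fun x => ENNReal.ofReal_lt_top)]
  simp only [ENNReal.toReal_ofReal (M.p₁_nonneg θ hθ _)]

lemma integrable_P₁ {F : Type*} [NormedAddCommGroup F] [NormedSpace ℝ F] (hθ : θ ∈ M.Θ)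
    {f : E r → F} : Integrable f (M.P₁ θ) ↔ Integrable fun x => M.p₁ θ x • f x := by
  rw [P₁, integrable_withDensity_iff_integrable_smul'
    (M.measurable_p₁ θ hθ).ennreal_ofReal (ae_of_all _ fun x => ENNReal.ofReal_lt_top)]
  simp only [ENNReal.toReal_ofReal (M.p₁_nonneg θ hθ _)]

end P₁

lemma integrable_mixture {F : Type*} [NormedAddCommGroup F] {φ : Param d s}
    (h0 : 0 < φ.1) (h1 : φ.1 < 1) {P₀ : Measure (E r)} {f : E r → F} :
    Integrable f (M.mixture φ P₀) ↔ Integrable f (M.P₁ φ.2.1) ∧ Integrable f P₀ := by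
  rw [mixture, integrable_add_measure,
    integrable_smul_measure (by simpa using h0) ENNReal.ofReal_ne_top,
    integrable_smul_measure (by simpa using h1) ENNReal.ofReal_ne_top]

lemma integral_mixture {F : Type*} [NormedAddCommGroup F] [NormedSpace ℝ F]
    {φ : Param d s} (h0 : 0 < φ.1) (h1 : φ.1 < 1) {P₀ : Measure (E r)} {f : E r → F}
    (hf : Integrable f (M.mixture φ P₀)) :
    ∫ x, f x ∂M.mixture φ P₀ = φ.1 • ∫ x, f x ∂M.P₁ φ.2.1 + (1 - φ.1) • ∫ x, f x ∂P₀ := by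
  have hf' := hf
  rw [mixture, integrable_add_measure] at hf'
  rw [mixture, integral_add_measure hf'.1 hf'.2, integral_smul_measure, integral_smul_measure,
    ENNReal.toReal_ofReal h0.le, ENNReal.toReal_ofReal (sub_nonneg.2 h1.le)]

end Model

lemma eintegral_eq_integral {α : Type*} [MeasurableSpace α] {Q : Measure α} {f : α → ℝ}
    (hf : Integrable f Q) : eintegral Q f = ((∫ x, f x ∂Q : ℝ) : EReal) := by
  have h1 : ∫⁻ x, ENNReal.ofReal (f x) ∂Q ≠ ∞ := hf.lintegral_lt_top.ne
  have h2 : ∫⁻ x, ENNReal.ofReal (-f x) ∂Q ≠ ∞ := hf.neg.lintegral_lt_top.ne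
  rw [eintegral, integral_eq_lintegral_pos_part_sub_lintegral_neg_part hf, EReal.coe_sub,
    ← EReal.coe_ennreal_toReal h1, ← EReal.coe_ennreal_toReal h2]

/-! ### Regularity of the parametric part of the criterion -/

/-- The regularity conditions on the model at the true parameter `φs`, with the true unknown
component `P₀`, which drive the asymptotic expansion of the criterion. -/
structure Regular {r d s ℓ : ℕ} (M : Model r d s ℓ) (ψ : ℝ → ℝ) (φs : Param d s)
    (P₀ : Measure (E r)) (rt ρ : ℝ) : Prop where
  conj : ConjugateFacts ψ
  rt_pos : 0 < rt
  ρ_pos : 0 < ρ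
  ball_subset : Metric.ball φs rt ⊆ M.Φ
  mem_constraintSet : P₀ ∈ M.constraintSet φs.2.2
  p₁_C2 : ∀ᵐ x, ContDiffOn ℝ 2 (fun θ => M.p₁ θ x) (interior M.Θ)
  m_C2 : ContDiffOn ℝ 2 M.m (interior M.𝒜)
  dom₁₂ : ∃ h : E r → ℝ, Integrable h ∧ ∀ᵐ x, ∀ φ ∈ Metric.ball φs rt, ∀ ξ : E (ℓ + 1), ‖ξ‖ ≤ ρ →
    |deriv (deriv ψ) (inner ℝ ξ (M.ga x))| * ‖M.ga x‖ ^ 2 * M.p₁ φ.2.1 x ≤ h x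
  dom₃ : ∃ h : E r → ℝ, Integrable h ∧ ∀ᵐ x, ∀ φ ∈ Metric.ball φs rt, ∀ ξ : E (ℓ + 1), ‖ξ‖ ≤ ρ →
    ‖deriv ψ (inner ℝ ξ (M.ga x)) • M.ga x‖ * ‖gradient (fun θ => M.p₁ θ x) φ.2.1‖ ≤ h x
  moments : ∀ i j : Fin ℓ, Integrable (fun x => M.g x i * M.g x j) (M.mixture φs P₀)

/-- The mean `∫ g dP₁(· | θ)` of the augmented constraint functions. -/
def Model.mean₁ {r d s ℓ : ℕ} (M : Model r d s ℓ) (θ : E d) : E (ℓ + 1) :=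
  ∫ x, M.p₁ θ x • M.ga x

/-- The second-order part `∫ (ψ(ξᵗ g) - ξᵗ g) dP₁(· | θ)` of the parametric term of the
criterion. -/
def Model.rem₁ {r d s ℓ : ℕ} (M : Model r d s ℓ) (ψ : ℝ → ℝ) (θ : E d) (ξ : E (ℓ + 1)) : ℝ :=
  ∫ x, M.p₁ θ x * tilt ψ (inner ℝ ξ (M.ga x))

namespace Regular

variable {r d s ℓ : ℕ} {M : Model r d s ℓ} {ψ : ℝ → ℝ} {φs : Param d s}
  {P₀ : Measure (E r)} {rt ρ : ℝ} (h : Regular M ψ φs P₀ rt ρ)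
include h

omit h in
lemma mem_ball {θ : E d} (hθ : θ ∈ Metric.ball φs.2.1 rt) :
    ((φs.1, θ, φs.2.2) : Param d s) ∈ Metric.ball φs rt := by
  rw [Metric.mem_ball] at hθ ⊢
  simp [Prod.dist_eq, hθ]

lemma ball_subset_Θ : Metric.ball φs.2.1 rt ⊆ M.Θ := fun _ hθ =>
  (h.ball_subset (mem_ball hθ)).2.1

lemma ball_subset_𝒜 : Metric.ball φs.2.2 rt ⊆ M.𝒜 := fun α hα => by
  have : ((φs.1, φs.2.1, α) : Param d s) ∈ Metric.ball φs rt := by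
    rw [Metric.mem_ball] at hα ⊢
    simp [Prod.dist_eq, hα]
  exact (h.ball_subset this).2.2

lemma θ_mem : φs.2.1 ∈ Metric.ball φs.2.1 rt := Metric.mem_ball_self h.rt_pos

lemma lam_mem : φs.1 ∈ Set.Ioo (0 : ℝ) 1 :=
  (h.ball_subset (Metric.mem_ball_self h.rt_pos)).1

lemma isProbabilityMeasure_P₀ : IsProbabilityMeasure P₀ := h.mem_constraintSet.1

lemma isProbabilityMeasure_mixture : IsProbabilityMeasure (M.mixture φs P₀) := by
  have := h.isProbabilityMeasure_P₀
  have := M.isProbabilityMeasure_P₁ (h.ball_subset_Θ h.θ_mem)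
  refine ⟨?_⟩
  rw [Model.mixture]
  simp only [Measure.coe_add, Measure.coe_smul, Pi.add_apply, Pi.smul_apply, measure_univ,
    smul_eq_mul, mul_one]
  rw [← ENNReal.ofReal_add h.lam_mem.1.le (sub_nonneg.2 h.lam_mem.2.le)]
  simp

/-! ### Second moments -/

lemma integrable_norm_sq : Integrable (fun x => ‖M.ga x‖ ^ 2) (M.mixture φs P₀) := by
  have := h.isProbabilityMeasure_mixture
  have h1 : (fun x => ‖M.ga x‖ ^ 2) = fun x => 1 + ∑ i, M.g x i * M.g x i := by
    funext x
    rw [Model.ga, norm_sq_augment, EuclideanSpace.real_norm_sq_eq]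
    simp [sq]
  rw [h1]
  exact (integrable_const _).add (integrable_finsetSum _ fun i _ => h.moments i i)

omit h in
lemma inner_sq_le (ξ : E (ℓ + 1)) (x : E r) :
    (inner ℝ ξ (M.ga x) : ℝ) ^ 2 ≤ ‖ξ‖ ^ 2 * ‖M.ga x‖ ^ 2 := by
  rw [← mul_pow, ← sq_abs]
  exact pow_le_pow_left₀ (abs_nonneg _) (abs_real_inner_le_norm _ _) 2

omit h in
lemma integrable_inner_mul_inner {Q : Measure (E r)}
    (hQ : Integrable (fun x => ‖M.ga x‖ ^ 2) Q) (v w : E (ℓ + 1)) :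
    Integrable (fun x => (inner ℝ v (M.ga x) : ℝ) * inner ℝ w (M.ga x)) Q := by
  refine (hQ.const_mul (‖v‖ * ‖w‖)).mono' ?_ (ae_of_all _ fun x => ?_)
  · exact ((measurable_const.inner Model.measurable_ga).mul
      (measurable_const.inner Model.measurable_ga)).aestronglyMeasurable
  · rw [norm_mul]
    calc _ ≤ (‖v‖ * ‖M.ga x‖) * (‖w‖ * ‖M.ga x‖) := by
          gcongr <;> exact norm_inner_le_norm _ _
      _ = _ := by ring

lemma integrable_norm_sq_P₁ : Integrable (fun x => ‖M.ga x‖ ^ 2) (M.P₁ φs.2.1) :=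
  ((Model.integrable_mixture h.lam_mem.1 h.lam_mem.2).1 h.integrable_norm_sq).1

lemma integrable_norm_sq_P₀ : Integrable (fun x => ‖M.ga x‖ ^ 2) P₀ :=
  ((Model.integrable_mixture h.lam_mem.1 h.lam_mem.2).1 h.integrable_norm_sq).2

lemma integrable_ga_P₁ {θ : E d} (hθ : θ ∈ Metric.ball φs.2.1 rt) :
    Integrable M.ga (M.P₁ θ) := by
  have := M.isProbabilityMeasure_P₁ (h.ball_subset_Θ hθ)
  exact Model.integrable_ga_of_integrable
    ((Model.integrable_P₁ (h.ball_subset_Θ hθ)).2 (M.integrable_g θ (h.ball_subset_Θ hθ)))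

lemma integrable_ga_P₀ : Integrable M.ga P₀ := by
  have := h.isProbabilityMeasure_P₀
  exact Model.integrable_ga_of_integrable h.mem_constraintSet.2.1

lemma integrable_ga : Integrable M.ga (M.mixture φs P₀) :=
  (Model.integrable_mixture h.lam_mem.1 h.lam_mem.2).2
    ⟨h.integrable_ga_P₁ h.θ_mem, h.integrable_ga_P₀⟩

lemma mean₁_eq {θ : E d} (hθ : θ ∈ Metric.ball φs.2.1 rt) :
    M.mean₁ θ = ∫ x, M.ga x ∂M.P₁ θ := (Model.integral_P₁ (h.ball_subset_Θ hθ) _).symm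

/-! ### The second-order part of the parametric term -/

/-- The second-order part of the parametric integrand is dominated by an integrable function,
uniformly in the parameters, and quadratically small in `ξ`. The bound on `ψ''` holds along the
whole segment from `0` to `ξ`, and at `ξ = 0`, where `ψ'' = 1`, it bounds the second moments. -/
lemma exists_tilt_dom : ∃ H : E r → ℝ, Integrable H ∧ ∀ᵐ x, ∀ θ ∈ Metric.ball φs.2.1 rt,
    M.p₁ θ x * ‖M.ga x‖ ^ 2 ≤ H x ∧
    ∀ ξ : E (ℓ + 1), ‖ξ‖ ≤ ρ → M.p₁ θ x * tilt ψ (inner ℝ ξ (M.ga x)) ≤ ‖ξ‖ ^ 2 * H x := by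
  obtain ⟨H, hH, hdom⟩ := h.dom₁₂
  refine ⟨H, hH, hdom.mono fun x hx θ hθ => ?_⟩
  have hp := M.p₁_nonneg θ (h.ball_subset_Θ hθ) x
  have h0 : M.p₁ θ x * ‖M.ga x‖ ^ 2 ≤ H x := by
    have := hx _ (mem_ball hθ) 0 (by simpa using h.ρ_pos.le)
    simp only [inner_zero_left, h.conj.deriv2_zero, abs_one, one_mul] at this
    linarith
  refine ⟨h0, fun ξ hξ => ?_⟩
  rcases (mul_nonneg hp (sq_nonneg ‖M.ga x‖)).eq_or_lt with hz | hz
  · -- the augmented vector does not vanish, so the density does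
    have hga : ‖M.ga x‖ ^ 2 ≠ 0 := by
      rw [Model.ga, norm_sq_augment]
      positivity
    have hp0 : M.p₁ θ x = 0 := (mul_eq_zero.1 hz.symm).resolve_right hga
    rw [hp0, zero_mul]
    exact mul_nonneg (sq_nonneg _) (hz.le.trans h0)
  set q := M.p₁ θ x * ‖M.ga x‖ ^ 2 with hq
  have h1 : tilt ψ (inner ℝ ξ (M.ga x)) ≤ (H x / q) * (inner ℝ ξ (M.ga x)) ^ 2 := by
    refine h.conj.tilt_le fun t ht => ?_
    rw [le_div_iff₀ hz]
    have hξ' : ‖t • ξ‖ ≤ ρ := by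
      rw [norm_smul, Real.norm_of_nonneg ht.1]
      exact (mul_le_of_le_one_left (norm_nonneg _) ht.2).trans hξ
    have := hx _ (mem_ball hθ) (t • ξ) hξ'
    rw [real_inner_smul_left] at this
    calc _ = _ := by rw [hq]; ring
      _ ≤ _ := this
  have h2 := inner_sq_le (M := M) ξ x
  have h3 : 0 ≤ H x / q := div_nonneg (hz.le.trans h0) hz.le
  calc M.p₁ θ x * tilt ψ (inner ℝ ξ (M.ga x))
      ≤ M.p₁ θ x * ((H x / q) * (‖ξ‖ ^ 2 * ‖M.ga x‖ ^ 2)) := by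
        gcongr
        exact h1.trans (mul_le_mul_of_nonneg_left h2 h3)
    _ = ‖ξ‖ ^ 2 * (H x / q * q) := by rw [hq]; ring
    _ = ‖ξ‖ ^ 2 * H x := by rw [div_mul_cancel₀ _ hz.ne']

lemma measurable_tilt_inner (ξ : E (ℓ + 1)) :
    Measurable fun x => tilt ψ (inner ℝ ξ (M.ga x)) :=
  h.conj.continuous_tilt.measurable.comp (measurable_const.inner Model.measurable_ga)

lemma measurable_rem₁_integrand {θ : E d} (hθ : θ ∈ Metric.ball φs.2.1 rt) (ξ : E (ℓ + 1)) :
    Measurable fun x => M.p₁ θ x * tilt ψ (inner ℝ ξ (M.ga x)) :=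
  (M.measurable_p₁ θ (h.ball_subset_Θ hθ)).mul (h.measurable_tilt_inner ξ)

lemma integrable_rem₁ {θ : E d} (hθ : θ ∈ Metric.ball φs.2.1 rt) {ξ : E (ℓ + 1)} (hξ : ‖ξ‖ ≤ ρ) :
    Integrable fun x => M.p₁ θ x * tilt ψ (inner ℝ ξ (M.ga x)) := by
  obtain ⟨H, hH, hdom⟩ := h.exists_tilt_dom
  refine (hH.const_mul (‖ξ‖ ^ 2)).mono' (h.measurable_rem₁_integrand hθ ξ).aestronglyMeasurable
    (hdom.mono fun x hx => ?_)
  rw [Real.norm_of_nonneg (mul_nonneg (M.p₁_nonneg θ (h.ball_subset_Θ hθ) x)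
    (h.conj.tilt_nonneg _))]
  exact (hx θ hθ).2 ξ hξ

lemma integral_tilt_P₁ {θ : E d} (hθ : θ ∈ Metric.ball φs.2.1 rt) (ξ : E (ℓ + 1)) :
    ∫ x, tilt ψ (inner ℝ ξ (M.ga x)) ∂M.P₁ θ = M.rem₁ ψ θ ξ :=
  Model.integral_P₁ (h.ball_subset_Θ hθ) _

lemma integrable_tilt_P₁ {θ : E d} (hθ : θ ∈ Metric.ball φs.2.1 rt) {ξ : E (ℓ + 1)}
    (hξ : ‖ξ‖ ≤ ρ) : Integrable (fun x => tilt ψ (inner ℝ ξ (M.ga x))) (M.P₁ θ) :=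
  (Model.integrable_P₁ (h.ball_subset_Θ hθ)).2 (h.integrable_rem₁ hθ hξ)

/-- Where the domination holds, the parametric term of the criterion is finite, and splits into its
parts of first and of second order. -/
lemma eintegral_eq {θ : E d} (hθ : θ ∈ Metric.ball φs.2.1 rt) {ξ : E (ℓ + 1)} (hξ : ‖ξ‖ ≤ ρ) :
    eintegral (M.P₁ θ) (fun x => ψ (inner ℝ ξ (M.ga x))) =
      ((inner ℝ ξ (M.mean₁ θ) + M.rem₁ ψ θ ξ : ℝ) : EReal) := by
  have h1 : (fun x => ψ (inner ℝ ξ (M.ga x))) =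
      fun x => inner ℝ ξ (M.ga x) + tilt ψ (inner ℝ ξ (M.ga x)) := by
    funext x
    simp [tilt]
  have h2 : Integrable (fun x => (inner ℝ ξ (M.ga x) : ℝ)) (M.P₁ θ) :=
    (h.integrable_ga_P₁ hθ).const_inner ξ
  have h3 := h.integrable_tilt_P₁ hθ hξ
  have h4 : Integrable (fun x => (inner ℝ ξ (M.ga x) : ℝ) + tilt ψ (inner ℝ ξ (M.ga x)))
      (M.P₁ θ) := h2.add h3
  rw [h1, eintegral_eq_integral h4, integral_add h2 h3, h.integral_tilt_P₁ hθ,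
    integral_inner (h.integrable_ga_P₁ hθ), h.mean₁_eq hθ]

lemma tendsto_p₁ : ∀ᵐ x, Tendsto (fun θ => M.p₁ θ x) (𝓝 φs.2.1) (𝓝 (M.p₁ φs.2.1 x)) := by
  refine h.p₁_C2.mono fun x hx => ?_
  have hmem : interior M.Θ ∈ 𝓝 φs.2.1 := isOpen_interior.mem_nhds
    (interior_maximal h.ball_subset_Θ Metric.isOpen_ball h.θ_mem)
  exact (hx.continuousOn.continuousAt hmem)

/-- Joint continuity of the second-order part. -/
lemma tendsto_rem₁ (ξ₀ : E (ℓ + 1)) :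
    Tendsto (fun q : E d × E (ℓ + 1) => M.rem₁ ψ q.1 q.2)
      (𝓝 φs.2.1 ×ˢ 𝓝[Metric.closedBall 0 ρ] ξ₀) (𝓝 (M.rem₁ ψ φs.2.1 ξ₀)) := by
  obtain ⟨H, hH, hdom⟩ := h.exists_tilt_dom
  have hθ : ∀ᶠ q : E d × E (ℓ + 1) in 𝓝 φs.2.1 ×ˢ 𝓝[Metric.closedBall 0 ρ] ξ₀,
      q.1 ∈ Metric.ball φs.2.1 rt :=
    tendsto_fst.eventually (Metric.isOpen_ball.mem_nhds h.θ_mem)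
  have hξ : ∀ᶠ q : E d × E (ℓ + 1) in 𝓝 φs.2.1 ×ˢ 𝓝[Metric.closedBall 0 ρ] ξ₀, ‖q.2‖ ≤ ρ := by
    have : ∀ᶠ ξ in 𝓝[Metric.closedBall 0 ρ] ξ₀, ‖ξ‖ ≤ ρ := by
      filter_upwards [self_mem_nhdsWithin] with ξ hξ
      simpa using hξ
    exact tendsto_snd.eventually this
  refine tendsto_integral_filter_of_dominated_convergence (fun x => ρ ^ 2 * H x) ?_ ?_
    (hH.const_mul _) ?_
  · exact hθ.mono fun q hq => (h.measurable_rem₁_integrand hq q.2).aestronglyMeasurable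
  · filter_upwards [hθ, hξ] with q hq hq'
    filter_upwards [hdom] with x hx
    rw [Real.norm_of_nonneg (mul_nonneg (M.p₁_nonneg _ (h.ball_subset_Θ hq) x)
      (h.conj.tilt_nonneg _))]
    refine ((hx _ hq).2 _ hq').trans ?_
    have hH0 : 0 ≤ H x := (mul_nonneg (M.p₁_nonneg _ (h.ball_subset_Θ hq) x) (sq_nonneg _)).trans
      (hx _ hq).1
    gcongr
  · filter_upwards [h.tendsto_p₁] with x hx
    refine (hx.comp tendsto_fst).mul ?_
    have h2 : Tendsto (fun q : E d × E (ℓ + 1) => q.2)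
        (𝓝 φs.2.1 ×ˢ 𝓝[Metric.closedBall 0 ρ] ξ₀) (𝓝 ξ₀) :=
      tendsto_snd.mono_right nhdsWithin_le_nhds
    exact (h.conj.continuous_tilt.tendsto _).comp (h2.inner tendsto_const_nhds)

/-- The second-order part is, near `ξ = 0`, half of the quadratic form of the second moments of `g`
under `P₁(· | θ*)`. -/
lemma eventually_abs_rem₁_sub_le {ε : ℝ} (hε : 0 < ε) :
    ∀ᶠ q : E d × E (ℓ + 1) in 𝓝 φs.2.1 ×ˢ 𝓝 0,
      |M.rem₁ ψ q.1 q.2 - 2⁻¹ * ∫ x, (inner ℝ q.2 (M.ga x)) ^ 2 ∂M.P₁ φs.2.1| ≤ ε * ‖q.2‖ ^ 2 := by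
  obtain ⟨H, hH, hdom⟩ := h.exists_tilt_dom
  have hΘ := h.ball_subset_Θ h.θ_mem
  have hθ : ∀ᶠ q : E d × E (ℓ + 1) in 𝓝 φs.2.1 ×ˢ 𝓝 0, q.1 ∈ Metric.ball φs.2.1 rt :=
    tendsto_fst.eventually (Metric.isOpen_ball.mem_nhds h.θ_mem)
  have hξ : ∀ᶠ q : E d × E (ℓ + 1) in 𝓝 φs.2.1 ×ˢ 𝓝 0, ‖q.2‖ ≤ ρ := by
    have : Tendsto (fun ξ : E (ℓ + 1) => ‖ξ‖) (𝓝 0) (𝓝 0) := by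
      simpa using (continuous_norm (E := E (ℓ + 1))).tendsto 0
    exact tendsto_snd.eventually (this.eventually_le_const h.ρ_pos)
  have hint2 : ∀ ξ : E (ℓ + 1), Integrable fun x => M.p₁ φs.2.1 x * (inner ℝ ξ (M.ga x)) ^ 2 := by
    intro ξ
    have := integrable_inner_mul_inner h.integrable_norm_sq_P₁ ξ ξ
    simpa [sq] using (Model.integrable_P₁ hΘ).1 this
  -- dominated convergence for the difference, rescaled by `‖ξ‖²`
  have key : Tendsto (fun q : E d × E (ℓ + 1) => ∫ x, (‖q.2‖ ^ 2)⁻¹ *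
      (M.p₁ q.1 x * tilt ψ (inner ℝ q.2 (M.ga x)) -
        2⁻¹ * (M.p₁ φs.2.1 x * (inner ℝ q.2 (M.ga x)) ^ 2)))
      (𝓝 φs.2.1 ×ˢ 𝓝 0) (𝓝 (∫ _ : E r, (0 : ℝ))) := by
    refine tendsto_integral_filter_of_dominated_convergence (fun x => 2 * H x) ?_ ?_
      (hH.const_mul _) ?_
    · refine hθ.mono fun q hq => Measurable.aestronglyMeasurable ?_
      refine ((h.measurable_rem₁_integrand hq q.2).sub ?_).const_mul _
      exact ((M.measurable_p₁ _ hΘ).mul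
        ((measurable_const.inner Model.measurable_ga).pow_const 2)).const_mul _
    · filter_upwards [hθ, hξ] with q hq hq'
      filter_upwards [hdom] with x hx
      have hp := M.p₁_nonneg _ hΘ x
      have hH0 : 0 ≤ H x := (mul_nonneg hp (sq_nonneg _)).trans (hx _ h.θ_mem).1
      have h1 := (hx _ hq).2 _ hq'
      have h2 : M.p₁ φs.2.1 x * (inner ℝ q.2 (M.ga x)) ^ 2 ≤ ‖q.2‖ ^ 2 * H x := by
        calc _ ≤ M.p₁ φs.2.1 x * (‖q.2‖ ^ 2 * ‖M.ga x‖ ^ 2) := by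
              gcongr
              exact inner_sq_le _ _
          _ = ‖q.2‖ ^ 2 * (M.p₁ φs.2.1 x * ‖M.ga x‖ ^ 2) := by ring
          _ ≤ _ := by
              gcongr
              exact (hx _ h.θ_mem).1
      have h3 : 0 ≤ M.p₁ φs.2.1 x * (inner ℝ q.2 (M.ga x)) ^ 2 := by positivity
      have h4 : 0 ≤ M.p₁ q.1 x * tilt ψ (inner ℝ q.2 (M.ga x)) :=
        mul_nonneg (M.p₁_nonneg _ (h.ball_subset_Θ hq) x) (h.conj.tilt_nonneg _)
      rw [norm_mul, norm_inv, Real.norm_of_nonneg (sq_nonneg ‖q.2‖)]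
      rcases eq_or_ne q.2 0 with h0 | h0
      · simp [h0, hH0]
      · rw [inv_mul_le_iff₀ (by positivity), Real.norm_eq_abs, abs_le]
        constructor <;> nlinarith
    · filter_upwards [h.tendsto_p₁] with x hx
      refine Metric.tendsto_nhds.2 fun η hη => ?_
      -- split the budget between the density and the expansion of `ψ`
      set C := (M.p₁ φs.2.1 x + 1) * ‖M.ga x‖ ^ 2 + ‖M.ga x‖ ^ 2 + 1 with hC
      have hp := M.p₁_nonneg _ hΘ x
      have hC0 : 0 < C := by positivity
      set e := min 1 (η / (2 * C)) with he
      have he0 : 0 < e := lt_min one_pos (by positivity)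
      have he1 : e ≤ 1 := min_le_left _ _
      have heC : e * C < η := by
        have : e ≤ η / (2 * C) := min_le_right _ _
        calc e * C ≤ η / (2 * C) * C := by gcongr
          _ = η / 2 := by field_simp
          _ < η := half_lt_self hη
      obtain ⟨δ, hδ, htilt⟩ := h.conj.exists_abs_tilt_sub_le he0
      have h1 : ∀ᶠ q : E d × E (ℓ + 1) in 𝓝 φs.2.1 ×ˢ 𝓝 0,
          |M.p₁ q.1 x - M.p₁ φs.2.1 x| < e :=
        tendsto_fst.eventually ((Metric.tendsto_nhds.1 hx) e he0)
      have h2 : ∀ᶠ q : E d × E (ℓ + 1) in 𝓝 φs.2.1 ×ˢ 𝓝 0, |(inner ℝ q.2 (M.ga x) : ℝ)| ≤ δ := by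
        have h3 : Tendsto (fun ξ : E (ℓ + 1) => |(inner ℝ ξ (M.ga x) : ℝ)|) (𝓝 0) (𝓝 0) := by
          have : Continuous fun ξ : E (ℓ + 1) => |(inner ℝ ξ (M.ga x) : ℝ)| := by fun_prop
          simpa using this.tendsto 0
        exact tendsto_snd.eventually (h3.eventually_le_const hδ)
      filter_upwards [h1, h2, hθ] with q hq1 hq2 hq3
      rw [dist_zero_right, norm_mul, norm_inv, Real.norm_of_nonneg (sq_nonneg ‖q.2‖)]
      rcases eq_or_ne q.2 0 with h0 | h0
      · simp [h0, hη]
      · refine lt_of_le_of_lt ?_ heC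
        rw [inv_mul_le_iff₀ (by positivity)]
        have h4 := htilt _ hq2
        set t : ℝ := inner ℝ q.2 (M.ga x) with ht
        have h5 := inner_sq_le (M := M) q.2 x
        have hp1 := M.p₁_nonneg _ (h.ball_subset_Θ hq3) x
        have hp2 : M.p₁ q.1 x ≤ M.p₁ φs.2.1 x + 1 := by linarith [(abs_lt.1 hq1).2]
        calc ‖M.p₁ q.1 x * tilt ψ t - 2⁻¹ * (M.p₁ φs.2.1 x * t ^ 2)‖
            = |M.p₁ q.1 x * (tilt ψ t - 2⁻¹ * t ^ 2)
                + (M.p₁ q.1 x - M.p₁ φs.2.1 x) * (2⁻¹ * t ^ 2)| := by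
              rw [Real.norm_eq_abs]
              ring_nf
          _ ≤ (M.p₁ φs.2.1 x + 1) * (e * t ^ 2) + e * (1 * t ^ 2) := by
              refine (abs_add_le _ _).trans ?_
              rw [abs_mul, abs_mul, abs_of_nonneg hp1, abs_of_nonneg (by positivity : 0 ≤ 2⁻¹ * t ^ 2)]
              gcongr
              norm_num
          _ = e * ((M.p₁ φs.2.1 x + 1) + 1) * t ^ 2 := by ring
          _ ≤ e * ((M.p₁ φs.2.1 x + 1) + 1) * (‖q.2‖ ^ 2 * ‖M.ga x‖ ^ 2) := by
              gcongr
          _ ≤ ‖q.2‖ ^ 2 * (e * C) := by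
              rw [hC]
              nlinarith [mul_nonneg (sq_nonneg ‖q.2‖) he0.le]
  rw [integral_zero] at key
  filter_upwards [(Metric.tendsto_nhds.1 key) ε hε, hθ, hξ] with q hq hq1 hq2
  rw [integral_const_mul, integral_sub (h.integrable_rem₁ hq1 hq2) ((hint2 _).const_mul _),
    integral_const_mul, dist_zero_right, norm_mul, norm_inv,
    Real.norm_of_nonneg (sq_nonneg ‖q.2‖)] at hq
  rw [Model.integral_P₁ hΘ]
  rcases eq_or_ne q.2 0 with h0 | h0
  · simp [h0, Model.rem₁, h.conj.tilt_zero]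
  · rw [inv_mul_lt_iff₀ (by positivity)] at hq
    rw [mul_comm ε]
    exact hq.le

end Regular

/-! ### The linear part of the criterion and its derivative -/

lemma gradient_apply_eq_fderiv {d : ℕ} (f : E d → ℝ) (θ : E d) (j : Fin d) :
    gradient f θ j = fderiv ℝ f θ (EuclideanSpace.single j 1) := by
  have h1 : (inner ℝ (gradient f θ) (EuclideanSpace.single j (1 : ℝ)) : ℝ) =
      fderiv ℝ f θ (EuclideanSpace.single j 1) := by
    rw [gradient, InnerProductSpace.toDual_symm_apply]
  rw [← h1, EuclideanSpace.inner_single_right]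
  simp

lemma norm_gradient_eq {d : ℕ} (f : E d → ℝ) (θ : E d) : ‖gradient f θ‖ = ‖fderiv ℝ f θ‖ := by
  rw [gradient, LinearIsometryEquiv.norm_map]

/-- The coordinates of a parameter `(λ, θ, α)`. -/
def paramCoords {d s : ℕ} (φ : Param d s) : ParamIdx d s → ℝ :=
  Sum.elim (fun _ => φ.1) (Sum.elim (fun j => φ.2.1 j) fun k => φ.2.2 k)

/-- The linear map `φ ↦ N φ` with a given matrix, from the parameters to a Euclidean space. -/
def paramCLM {d s k : ℕ} (N : Matrix (Fin k) (ParamIdx d s) ℝ) : Param d s →L[ℝ] E k :=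
  LinearMap.toContinuousLinearMap
    { toFun := fun φ => WithLp.toLp 2 (N *ᵥ paramCoords φ)
      map_add' := fun φ φ' => by
        have : paramCoords (φ + φ') = paramCoords φ + paramCoords φ' := by
          ext c
          rcases c with c | c | c <;> simp [paramCoords]
        rw [this, Matrix.mulVec_add]
        rfl
      map_smul' := fun c φ => by
        have : paramCoords (c • φ) = c • paramCoords φ := by
          ext c
          rcases c with c | c | c <;> simp [paramCoords]
        rw [this, Matrix.mulVec_smul]
        rfl }

lemma paramCLM_apply {d s k : ℕ} (N : Matrix (Fin k) (ParamIdx d s) ℝ) (φ : Param d s) :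
    paramCLM N φ = WithLp.toLp 2 (N *ᵥ paramCoords φ) := rfl

lemma paramCLM_apply_apply {d s k : ℕ} (N : Matrix (Fin k) (ParamIdx d s) ℝ) (φ : Param d s)
    (i : Fin k) : paramCLM N φ i = N i (Sum.inl ()) * φ.1 +
      (∑ j, N i (Sum.inr (Sum.inl j)) * φ.2.1 j + ∑ j, N i (Sum.inr (Sum.inr j)) * φ.2.2 j) := by
  simp [paramCLM_apply, Matrix.mulVec, dotProduct, paramCoords, Fintype.sum_sum_type]

lemma eq_sum_single {d : ℕ} (v : E d) : v = ∑ j, v j • EuclideanSpace.single j (1 : ℝ) := by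
  ext i
  simp [Pi.single_apply]

lemma clm_apply_eq_sum {d k : ℕ} (L : E d →L[ℝ] E k) (v : E d) (i : Fin k) :
    L v i = ∑ j, L (EuclideanSpace.single j 1) i * v j := by
  conv_lhs => rw [eq_sum_single v, map_sum]
  simp [mul_comm]

namespace Model

variable {r d s ℓ : ℕ} (M : Model r d s ℓ)

/-- The limit `m(α) - (1-λ)⁻¹ E_{P_T} g + λ (1-λ)⁻¹ E_{P₁(·|θ)} g` of the linear part of the
criterion. -/
def linLim (PT : Measure (E r)) (φ : Param d s) : E (ℓ + 1) :=
  M.ma φ.2.2 - (1 / (1 - φ.1)) • ∫ x, M.ga x ∂PT + (φ.1 / (1 - φ.1)) • M.mean₁ φ.2.1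

end Model

namespace Regular

variable {r d s ℓ : ℕ} {M : Model r d s ℓ} {ψ : ℝ → ℝ} {φs : Param d s}
  {P₀ : Measure (E r)} {rt ρ : ℝ} (h : Regular M ψ φs P₀ rt ρ)
include h

lemma interior_Θ_mem_nhds {θ : E d} (hθ : θ ∈ Metric.ball φs.2.1 rt) :
    interior M.Θ ∈ 𝓝 θ := isOpen_interior.mem_nhds
  (interior_maximal h.ball_subset_Θ Metric.isOpen_ball hθ)

lemma hasFDerivAt_p₁ : ∀ᵐ x, ∀ θ ∈ Metric.ball φs.2.1 rt,
    HasFDerivAt (fun θ => M.p₁ θ x) (fderiv ℝ (fun θ => M.p₁ θ x) θ) θ := by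
  refine h.p₁_C2.mono fun x hx θ hθ => ?_
  exact ((hx.contDiffAt (h.interior_Θ_mem_nhds hθ)).differentiableAt (by norm_num)).hasFDerivAt

/-- The derivative of the density in the parameter is measurable in `x`, as a limit of difference
quotients. -/
lemma aestronglyMeasurable_fderiv_p₁ :
    AEStronglyMeasurable (fun x => fderiv ℝ (fun θ => M.p₁ θ x) φs.2.1) := by
  have hdir : ∀ v : E d, AEStronglyMeasurable (fun x => fderiv ℝ (fun θ => M.p₁ θ x) φs.2.1 v) := by
    intro v
    have ht : Tendsto (fun n : ℕ => φs.2.1 + ((n : ℝ) + 1)⁻¹ • v) atTop (𝓝 φs.2.1) := by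
      have h1 : Tendsto (fun n : ℕ => ((n : ℝ) + 1)⁻¹) atTop (𝓝 0) := by
        simpa [one_div] using tendsto_one_div_add_atTop_nhds_zero_nat (𝕜 := ℝ)
      simpa using (h1.smul_const v).const_add φs.2.1
    obtain ⟨N, hN⟩ := eventually_atTop.1 (ht.eventually (Metric.isOpen_ball.mem_nhds h.θ_mem))
    refine aestronglyMeasurable_of_tendsto_ae (u := atTop) (f := fun (n : ℕ) x =>
      ((((n + N : ℕ) : ℝ) + 1) * (M.p₁ (φs.2.1 + (((n + N : ℕ) : ℝ) + 1)⁻¹ • v) x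
        - M.p₁ φs.2.1 x))) (fun n => ?_) ?_
    · exact (((M.measurable_p₁ _ (h.ball_subset_Θ (hN (n + N) (by omega)))).sub
        (M.measurable_p₁ _ (h.ball_subset_Θ h.θ_mem))).const_mul _).aestronglyMeasurable
    · filter_upwards [h.hasFDerivAt_p₁] with x hx
      have h2 := (hx _ h.θ_mem).lim v (α := ℕ) (l := atTop)
        (c := fun n => (((n + N : ℕ) : ℝ) + 1)) ?_
      · simpa [smul_eq_mul] using h2
      · refine tendsto_norm_atTop_atTop.comp ?_
        exact tendsto_atTop_add_const_right _ _
          (tendsto_natCast_atTop_atTop.comp (tendsto_add_atTop_nat N))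
  have hsum : (fun x => fderiv ℝ (fun θ => M.p₁ θ x) φs.2.1) = fun x =>
      ∑ j : Fin d, (fderiv ℝ (fun θ => M.p₁ θ x) φs.2.1 (EuclideanSpace.single j 1)) •
        (EuclideanSpace.proj j : E d →L[ℝ] ℝ) := by
    funext x
    refine ContinuousLinearMap.ext fun v => ?_
    conv_lhs => rw [eq_sum_single v, map_sum]
    simp [mul_comm]
  rw [hsum]
  exact Finset.aestronglyMeasurable_fun_sum _ fun j _ => (hdir _).smul_const _

/-- The integrand of the derivative of `θ ↦ ∫ g dP₁(· | θ)`, dominated in a ball around the true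
parameter. -/
lemma exists_dom_fderiv : ∃ H : E r → ℝ, Integrable H ∧ ∀ᵐ x, ∀ θ ∈ Metric.ball φs.2.1 rt,
    ‖(fderiv ℝ (fun θ => M.p₁ θ x) θ).smulRight (M.ga x)‖ ≤ H x := by
  obtain ⟨H, hH, hdom⟩ := h.dom₃
  refine ⟨H, hH, hdom.mono fun x hx θ hθ => ?_⟩
  have := hx _ (mem_ball hθ) 0 (by simpa using h.ρ_pos.le)
  rw [inner_zero_left, h.conj.deriv_zero, one_smul, norm_gradient_eq] at this
  rw [ContinuousLinearMap.norm_smulRight_apply, mul_comm]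
  exact this

lemma aestronglyMeasurable_smulRight : AEStronglyMeasurable
    (fun x => (fderiv ℝ (fun θ => M.p₁ θ x) φs.2.1).smulRight (M.ga x)) := by
  have h1 := (ContinuousLinearMap.smulRightL ℝ (E d) (E (ℓ + 1))).aestronglyMeasurable_comp₂
    h.aestronglyMeasurable_fderiv_p₁ (Model.measurable_ga (M := M)).aestronglyMeasurable
  simpa using h1

lemma integrable_smulRight :
    Integrable (fun x => (fderiv ℝ (fun θ => M.p₁ θ x) φs.2.1).smulRight (M.ga x)) := by
  obtain ⟨H, hH, hdom⟩ := h.exists_dom_fderiv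
  exact hH.mono' h.aestronglyMeasurable_smulRight (hdom.mono fun x hx => hx _ h.θ_mem)

lemma hasFDerivAt_mean₁ : HasFDerivAt M.mean₁
    (∫ x, (fderiv ℝ (fun θ => M.p₁ θ x) φs.2.1).smulRight (M.ga x)) φs.2.1 := by
  obtain ⟨H, hH, hdom⟩ := h.exists_dom_fderiv
  refine hasFDerivAt_integral_of_dominated_of_fderiv_le
    (F := fun θ x => M.p₁ θ x • M.ga x)
    (F' := fun θ x => (fderiv ℝ (fun θ => M.p₁ θ x) θ).smulRight (M.ga x))
    (Metric.ball_mem_nhds _ h.rt_pos) ?_ ?_ h.aestronglyMeasurable_smulRight hdom hH ?_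
  · filter_upwards [Metric.ball_mem_nhds φs.2.1 h.rt_pos] with θ hθ
    exact ((M.measurable_p₁ θ (h.ball_subset_Θ hθ)).smul
      Model.measurable_ga).aestronglyMeasurable
  · exact (Model.integrable_P₁ (h.ball_subset_Θ h.θ_mem)).1 (h.integrable_ga_P₁ h.θ_mem)
  · exact h.hasFDerivAt_p₁.mono fun x hx θ hθ => (hx θ hθ).smul_const _

lemma fderiv_mean₁_apply (j : Fin d) (i : Fin (ℓ + 1)) :
    (∫ x, (fderiv ℝ (fun θ => M.p₁ θ x) φs.2.1).smulRight (M.ga x)) (EuclideanSpace.single j 1) i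
      = ∫ x, M.ga x i * gradient (fun θ => M.p₁ θ x) φs.2.1 j := by
  rw [ContinuousLinearMap.integral_apply h.integrable_smulRight]
  have h1 := (EuclideanSpace.proj i : E (ℓ + 1) →L[ℝ] ℝ).integral_comp_comm
    (h.integrable_smulRight.apply_continuousLinearMap (EuclideanSpace.single j 1))
  simp only [PiLp.proj_apply] at h1
  rw [← h1]
  refine integral_congr_ae (ae_of_all _ fun x => ?_)
  simp [gradient_apply_eq_fderiv, mul_comm]

lemma differentiableAt_ma : DifferentiableAt ℝ M.ma φs.2.2 := by
  have h1 : M.ma = fun α => augmentLin ℓ (M.m α) + EuclideanSpace.single 0 1 :=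
    funext fun α => augment_eq _
  rw [h1]
  have hmem : interior M.𝒜 ∈ 𝓝 φs.2.2 := isOpen_interior.mem_nhds
    (interior_maximal h.ball_subset_𝒜 Metric.isOpen_ball (Metric.mem_ball_self h.rt_pos))
  exact (((augmentLin ℓ).differentiableAt).comp _
    ((h.m_C2.contDiffAt hmem).differentiableAt (by norm_num))).add_const _

omit h in
lemma integral_ga_apply {Q : Measure (E r)} (hQ : Integrable M.ga Q) (i : Fin (ℓ + 1)) :
    (∫ x, M.ga x ∂Q) i = ∫ x, M.ga x i ∂Q := by
  have h1 := (EuclideanSpace.proj i : E (ℓ + 1) →L[ℝ] ℝ).integral_comp_comm hQ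
  simpa using h1.symm

/-- At the true parameter the linear part of the criterion vanishes, by the constraint. -/
lemma linLim_zero : M.linLim (M.mixture φs P₀) φs = 0 := by
  have := h.isProbabilityMeasure_P₀
  have hl := sub_pos.2 h.lam_mem.2
  have h0 : M.ma φs.2.2 = ∫ x, M.ga x ∂P₀ := by
    rw [Model.integral_ga h.mem_constraintSet.2.1, h.mem_constraintSet.2.2, Model.ma]
  rw [Model.linLim, h0, Model.integral_mixture h.lam_mem.1 h.lam_mem.2 h.integrable_ga,
    h.mean₁_eq h.θ_mem, smul_add, smul_smul, smul_smul, one_div_mul_cancel hl.ne', one_smul,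
    one_div_mul_eq_div]
  abel

/-- The matrix `J_{φ,ξ}` is the derivative of the limit of the linear part of the criterion. -/
lemma hasFDerivAt_linLim : HasFDerivAt (M.linLim (M.mixture φs P₀))
    (paramCLM (M.Jφξ φs (M.mixture φs P₀))) φs := by
  have hl := sub_pos.2 h.lam_mem.2
  have hf1 : HasFDerivAt (fun φ : Param d s => φ.1) (ContinuousLinearMap.fst ℝ ℝ (E d × E s)) φs :=
    hasFDerivAt_fst
  have hf2 : HasFDerivAt (fun φ : Param d s => φ.2.1) ((ContinuousLinearMap.fst ℝ (E d) (E s)).comp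
    (ContinuousLinearMap.snd ℝ ℝ (E d × E s))) φs := hasFDerivAt_fst.comp φs hasFDerivAt_snd
  have hf3 : HasFDerivAt (fun φ : Param d s => φ.2.2) ((ContinuousLinearMap.snd ℝ (E d) (E s)).comp
    (ContinuousLinearMap.snd ℝ ℝ (E d × E s))) φs := hasFDerivAt_snd.comp φs hasFDerivAt_snd
  have d1 : HasDerivAt (fun l : ℝ => 1 / (1 - l)) (1 / (1 - φs.1) ^ 2) φs.1 := by
    have := ((hasDerivAt_id φs.1).const_sub 1).inv hl.ne'
    refine (this.congr_deriv (by simp)).congr_of_eventuallyEq (Eventually.of_forall fun l => ?_)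
    simp
  have d2 : HasDerivAt (fun l : ℝ => l / (1 - l)) (1 / (1 - φs.1) ^ 2) φs.1 := by
    have := (hasDerivAt_id φs.1).div ((hasDerivAt_id φs.1).const_sub 1) hl.ne'
    exact this.congr_deriv (by simp)
  have e1 := (d1.comp_hasFDerivAt φs hf1).smul_const (∫ x, M.ga x ∂M.mixture φs P₀)
  have e2 := (d2.comp_hasFDerivAt φs hf1).smul (h.hasFDerivAt_mean₁.comp φs hf2)
  have e3 := h.differentiableAt_ma.hasFDerivAt.comp φs hf3
  refine ((e3.sub e1).add e2).congr_fderiv ?_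
  refine ContinuousLinearMap.ext fun u => ?_
  ext i
  rw [paramCLM_apply_apply]
  have s1 := clm_apply_eq_sum (fderiv ℝ M.ma φs.2.2) u.2.2 i
  have s2 := clm_apply_eq_sum
    (∫ x, (fderiv ℝ (fun θ => M.p₁ θ x) φs.2.1).smulRight (M.ga x)) u.2.1 i
  simp only [h.fderiv_mean₁_apply] at s2
  have s3 := h.mean₁_eq h.θ_mem
  have s4 := integral_ga_apply h.integrable_ga i
  have s5 := integral_ga_apply (h.integrable_ga_P₁ h.θ_mem) i
  simp only [Model.Jφξ, Matrix.of_apply]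
  simp [s1, s2, s3, s4, s5, mul_assoc, ← Finset.mul_sum]
  ring

end Regular

/-! ### The empirical criterion -/

section EmpMean

variable {Ω α : Type*} {X : ℕ → Ω → α}

lemma empMean_const_mul (c : ℝ) (f : α → ℝ) (i : ℕ × Ω) :
    empMean X (fun x => c * f x) i = c * empMean X f i := by
  simp only [empMean, ← Finset.mul_sum]
  ring

lemma empMean_sub (f g : α → ℝ) (i : ℕ × Ω) :
    empMean X (fun x => f x - g x) i = empMean X f i - empMean X g i := by
  simp only [empMean, Finset.sum_sub_distrib, mul_sub]

lemma empMean_sum {κ : Type*} (t : Finset κ) (f : κ → α → ℝ) (i : ℕ × Ω) :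
    empMean X (fun x => ∑ k ∈ t, f k x) i = ∑ k ∈ t, empMean X (f k) i := by
  simp only [empMean, Finset.mul_sum]
  rw [Finset.sum_comm]

lemma abs_empMean_le {f g : α → ℝ} {i : ℕ × Ω} (h : ∀ k < i.1, |f (X k i.2)| ≤ g (X k i.2)) :
    |empMean X f i| ≤ empMean X g i := by
  unfold empMean
  rw [abs_mul, abs_of_nonneg (by positivity : (0 : ℝ) ≤ 1 / (i.1 : ℝ))]
  gcongr
  refine (Finset.abs_sum_le_sum_abs _ _).trans (Finset.sum_le_sum fun k hk => ?_)
  exact h k (Finset.mem_range.1 hk)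

end EmpMean

namespace Model

variable {r d s ℓ : ℕ} (M : Model r d s ℓ) {Ω : Type*}

/-- The centred empirical mean of the augmented constraint functions. -/
def noise (PT : Measure (E r)) (X : ℕ → Ω → E r) (i : ℕ × Ω) : E (ℓ + 1) :=
  (1 / (i.1 : ℝ)) • ∑ k ∈ Finset.range i.1, M.ga (X k i.2) - ∫ x, M.ga x ∂PT

/-- The linear part of the empirical criterion: the criterion is `⟪ξ, linPart⟫` up to terms of second
order in `ξ`. -/
def linPart (PT : Measure (E r)) (X : ℕ → Ω → E r) (i : ℕ × Ω) (φ : Param d s) : E (ℓ + 1) :=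
  M.linLim PT φ - (1 / (1 - φ.1)) • M.noise PT X i

/-- The empirical criterion as a real number, split into its linear part in `ξ` and its second-order
part. -/
def crit (ψ : ℝ → ℝ) (PT : Measure (E r)) (X : ℕ → Ω → E r) (i : ℕ × Ω) (φ : Param d s)
    (ξ : E (ℓ + 1)) : ℝ :=
  inner ℝ ξ (M.linPart PT X i φ)
    - 1 / (1 - φ.1) * empMean X (fun x => tilt ψ (inner ℝ ξ (M.ga x))) i
    + φ.1 / (1 - φ.1) * M.rem₁ ψ φ.2.1 ξ

end Model

/-- Error propagation in a combination `-β T + β' R` of two approximately quadratic terms with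
perturbed coefficients. -/
lemma abs_second_order_le {b b' β β' T R QT Q₁ e N mT m₁ : ℝ} (hb : 0 ≤ b) (hb' : 0 ≤ b')
    (he : 0 ≤ e) (he1 : e ≤ 1) (h1 : |β - b| ≤ e) (h2 : |β' - b'| ≤ e)
    (h3 : |T - 2⁻¹ * QT| ≤ e * N) (h4 : |R - 2⁻¹ * Q₁| ≤ e * N) (h5 : 0 ≤ QT) (h6 : QT ≤ mT * N)
    (h7 : 0 ≤ Q₁) (h8 : Q₁ ≤ m₁ * N) :
    |-β * T + β' * R + 2⁻¹ * (b * QT - b' * Q₁)| ≤ e * (b + b' + 2 + mT + m₁) * N := by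
  have hβ : |β| ≤ b + 1 := by
    have := abs_sub_abs_le_abs_sub β b
    rw [abs_of_nonneg hb] at this
    linarith
  have hβ' : |β'| ≤ b' + 1 := by
    have := abs_sub_abs_le_abs_sub β' b'
    rw [abs_of_nonneg hb'] at this
    linarith
  have hsplit : -β * T + β' * R + 2⁻¹ * (b * QT - b' * Q₁) =
      -(β * (T - 2⁻¹ * QT)) + β' * (R - 2⁻¹ * Q₁) + (-((β - b) * (2⁻¹ * QT))
        + (β' - b') * (2⁻¹ * Q₁)) := by ring
  have k1 : |β * (T - 2⁻¹ * QT)| ≤ (b + 1) * (e * N) := by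
    rw [abs_mul]
    gcongr
  have k2 : |β' * (R - 2⁻¹ * Q₁)| ≤ (b' + 1) * (e * N) := by
    rw [abs_mul]
    gcongr
  have k3 : |(β - b) * (2⁻¹ * QT)| ≤ e * (mT * N) := by
    rw [abs_mul, abs_of_nonneg (by positivity : 0 ≤ 2⁻¹ * QT)]
    exact mul_le_mul h1 (by linarith) (by positivity) he
  have k4 : |(β' - b') * (2⁻¹ * Q₁)| ≤ e * (m₁ * N) := by
    rw [abs_mul, abs_of_nonneg (by positivity : 0 ≤ 2⁻¹ * Q₁)]
    exact mul_le_mul h2 (by linarith) (by positivity) he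
  rw [hsplit]
  calc _ ≤ (b + 1) * (e * N) + (b' + 1) * (e * N) + (e * (mT * N) + e * (m₁ * N)) := by
        refine (abs_add_le _ _).trans (add_le_add ((abs_add_le _ _).trans (add_le_add ?_ k2))
          ((abs_add_le _ _).trans (add_le_add ?_ k4)))
        · rwa [abs_neg]
        · rwa [abs_neg]
    _ = _ := by ring

namespace Regular

variable {r d s ℓ : ℕ} {M : Model r d s ℓ} {ψ : ℝ → ℝ} {φs : Param d s}
  {P₀ : Measure (E r)} {rt ρ : ℝ} (h : Regular M ψ φs P₀ rt ρ)
include h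

/-- Near the true parameter and on the ball of radius `ρ` the extended-valued criterion is finite, and
equal to the real-valued one. -/
lemma Hn_eq {Ω : Type*} (X : ℕ → Ω → E r) (n : ℕ) (ω : Ω) {φ : Param d s}
    (hφ : φ ∈ Metric.ball φs rt) {ξ : E (ℓ + 1)} (hξ : ‖ξ‖ ≤ ρ) :
    M.Hn ψ n (fun k => X k ω) φ ξ = ((M.crit ψ (M.mixture φs P₀) X (n, ω) φ ξ : ℝ) : EReal) := by
  have hθ : φ.2.1 ∈ Metric.ball φs.2.1 rt := by
    rw [Metric.mem_ball, Prod.dist_eq, Prod.dist_eq] at hφ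
    exact lt_of_le_of_lt ((le_max_left _ _).trans (le_max_right _ _)) hφ
  rw [Model.Hn, h.eintegral_eq hθ hξ, ← EReal.coe_mul, ← EReal.coe_add]
  congr 1
  have h1 : ∀ x, ψ (inner ℝ ξ (M.ga x)) = inner ℝ ξ (M.ga x) + tilt ψ (inner ℝ ξ (M.ga x)) :=
    fun x => by simp [tilt]
  simp only [h1, Model.crit, Model.linPart, Model.linLim, Model.noise, empMean,
    Finset.sum_add_distrib, inner_add_right, inner_sub_right, real_inner_smul_right, inner_sum]
  ring

lemma crit_zero {Ω : Type*} (PT : Measure (E r)) (X : ℕ → Ω → E r) (i : ℕ × Ω) (φ : Param d s) :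
    M.crit ψ PT X i φ 0 = 0 := by
  simp [Model.crit, Model.rem₁, h.conj.tilt_zero, empMean]

/-! ### Quadratic forms of second moments -/

omit h in
lemma integral_sq_nonneg (Q : Measure (E r)) (ξ : E (ℓ + 1)) :
    0 ≤ ∫ x, (inner ℝ ξ (M.ga x)) ^ 2 ∂Q := integral_nonneg fun _ => sq_nonneg _

omit h in
lemma integrable_inner_sq {Q : Measure (E r)} (hQ : Integrable (fun x => ‖M.ga x‖ ^ 2) Q)
    (ξ : E (ℓ + 1)) : Integrable (fun x => (inner ℝ ξ (M.ga x) : ℝ) ^ 2) Q := by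
  simpa [sq] using integrable_inner_mul_inner hQ ξ ξ

omit h in
lemma integral_sq_le {Q : Measure (E r)} (hQ : Integrable (fun x => ‖M.ga x‖ ^ 2) Q)
    (ξ : E (ℓ + 1)) :
    ∫ x, (inner ℝ ξ (M.ga x)) ^ 2 ∂Q ≤ (∫ x, ‖M.ga x‖ ^ 2 ∂Q) * ‖ξ‖ ^ 2 := by
  rw [mul_comm, ← integral_const_mul]
  exact integral_mono (integrable_inner_sq hQ ξ) (hQ.const_mul _) fun x => inner_sq_le ξ x

lemma integral_sq_mixture (ξ : E (ℓ + 1)) :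
    ∫ x, (inner ℝ ξ (M.ga x)) ^ 2 ∂M.mixture φs P₀ =
      φs.1 * ∫ x, (inner ℝ ξ (M.ga x)) ^ 2 ∂M.P₁ φs.2.1
        + (1 - φs.1) * ∫ x, (inner ℝ ξ (M.ga x)) ^ 2 ∂P₀ :=
  Model.integral_mixture h.lam_mem.1 h.lam_mem.2 (integrable_inner_sq h.integrable_norm_sq ξ)

variable {Ω : Type*} [MeasurableSpace Ω] {μ : Measure Ω} [IsProbabilityMeasure μ]
  {X : ℕ → Ω → E r} (hind : iIndepFun X μ) (hlaw : ∀ k, HasLaw (X k) (M.mixture φs P₀) μ)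
include hind hlaw

/-- The empirical second moments converge, uniformly as quadratic forms. -/
lemma eventually_abs_empMean_sq_sub_le {ε : ℝ} (hε : 0 < ε) :
    ∀ᶠ i in whp μ, ∀ ξ : E (ℓ + 1), |empMean X (fun x => (inner ℝ ξ (M.ga x)) ^ 2) i
      - ∫ x, (inner ℝ ξ (M.ga x)) ^ 2 ∂M.mixture φs P₀| ≤ ε * ‖ξ‖ ^ 2 := by
  set c := ε / ((ℓ + 1) ^ 2 : ℝ) with hc
  have hc0 : 0 < c := by positivity
  have hint : ∀ a b : Fin (ℓ + 1), Integrable (fun x => M.ga x a * M.ga x b) (M.mixture φs P₀) := by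
    intro a b
    simpa [EuclideanSpace.inner_single_left] using
      integrable_inner_mul_inner h.integrable_norm_sq (EuclideanSpace.single a 1)
        (EuclideanSpace.single b 1)
  have hmeas : ∀ a : Fin (ℓ + 1), Measurable fun x => M.ga x a := fun a =>
    (EuclideanSpace.proj a : E (ℓ + 1) →L[ℝ] ℝ).continuous.measurable.comp Model.measurable_ga
  have hlln : ∀ᶠ i in whp μ, ∀ a b : Fin (ℓ + 1), |empMean X (fun x => M.ga x a * M.ga x b) i
      - ∫ x, M.ga x a * M.ga x b ∂M.mixture φs P₀| ≤ c := by
    refine eventually_all.2 fun a => eventually_all.2 fun b => ?_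
    have := tendsto_empMean hind hlaw ((hmeas a).mul (hmeas b)) (hint a b)
    filter_upwards [(Metric.tendsto_nhds.1 this) c hc0] with i hi
    exact hi.le
  filter_upwards [hlln] with i hi ξ
  have hexp : ∀ x, (inner ℝ ξ (M.ga x) : ℝ) ^ 2 =
      ∑ a, ∑ b, (ξ a * ξ b) * (M.ga x a * M.ga x b) := by
    intro x
    rw [PiLp.inner_apply, sq, Finset.sum_mul_sum]
    refine Finset.sum_congr rfl fun a _ => Finset.sum_congr rfl fun b _ => ?_
    simp
    ring
  simp only [hexp]
  rw [integral_finsetSum _ fun a _ => integrable_finsetSum _ fun b _ => (hint a b).const_mul _]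
  simp only [empMean_sum, empMean_const_mul]
  rw [← Finset.sum_sub_distrib]
  have hco : ∀ a, |ξ a| ≤ ‖ξ‖ := fun a => by simpa using PiLp.norm_apply_le ξ a
  calc |∑ a, (∑ b, ξ a * ξ b * empMean X (fun x => M.ga x a * M.ga x b) i
        - ∫ x, ∑ b, ξ a * ξ b * (M.ga x a * M.ga x b) ∂M.mixture φs P₀)|
      ≤ ∑ a : Fin (ℓ + 1), ∑ b : Fin (ℓ + 1), ‖ξ‖ * ‖ξ‖ * c := by
        refine (Finset.abs_sum_le_sum_abs _ _).trans (Finset.sum_le_sum fun a _ => ?_)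
        rw [integral_finsetSum _ fun b _ => (hint a b).const_mul _, ← Finset.sum_sub_distrib]
        refine (Finset.abs_sum_le_sum_abs _ _).trans (Finset.sum_le_sum fun b _ => ?_)
        rw [integral_const_mul, ← mul_sub, abs_mul, abs_mul]
        gcongr
        · exact hco a
        · exact hco b
        · exact hi a b
    _ = ε * ‖ξ‖ ^ 2 := by
        simp only [Finset.sum_const, Finset.card_univ, Fintype.card_fin, nsmul_eq_mul]
        rw [hc]
        push_cast
        field_simp

/-- On the scale `1/√n` the empirical mean of `ψ(ξᵗ g) - ξᵗ g` is half of the quadratic form of the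
second moments of `g`, because the largest `g(X_i)` is `o(√n)`. -/
lemma eventually_abs_empMean_tilt_sub_le (R : ℝ) {ε : ℝ} (hε : 0 < ε) :
    ∀ᶠ i in whp μ, ∀ ξ : E (ℓ + 1), ‖√(i.1 : ℝ) • ξ‖ ≤ R →
      |empMean X (fun x => tilt ψ (inner ℝ ξ (M.ga x))) i
        - 2⁻¹ * ∫ x, (inner ℝ ξ (M.ga x)) ^ 2 ∂M.mixture φs P₀| ≤ ε * ‖ξ‖ ^ 2 := by
  set m := ∫ x, ‖M.ga x‖ ^ 2 ∂M.mixture φs P₀ with hm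
  have hm0 : 0 ≤ m := integral_nonneg fun _ => sq_nonneg _
  set e := ε / (2 * (m + 1)) with he
  have he0 : 0 < e := by positivity
  obtain ⟨δ, hδ, htilt⟩ := h.conj.exists_abs_tilt_sub_le he0
  have hmax := eventually_forall_lt_sqrt hlaw (f := fun x => ‖M.ga x‖) Model.measurable_ga.norm
    h.integrable_norm_sq (η := δ / (|R| + 1)) (by positivity)
  have hlln := (tendsto_empMean hind hlaw (f := fun x => ‖M.ga x‖ ^ 2)
    (Model.measurable_ga.norm.pow_const 2) h.integrable_norm_sq).eventually_le_const
    (lt_add_one m)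
  filter_upwards [hmax, hlln, h.eventually_abs_empMean_sq_sub_le hind hlaw hε] with i h1 h2 h3 ξ hξ
  rw [norm_smul, Real.norm_of_nonneg (Real.sqrt_nonneg _)] at hξ
  have h4 : |empMean X (fun x => tilt ψ (inner ℝ ξ (M.ga x)) - 2⁻¹ * (inner ℝ ξ (M.ga x)) ^ 2) i|
      ≤ empMean X (fun x => (e * ‖ξ‖ ^ 2) * ‖M.ga x‖ ^ 2) i := by
    refine abs_empMean_le fun k hk => ?_
    refine (htilt _ ?_).trans ?_
    · calc |(inner ℝ ξ (M.ga (X k i.2)) : ℝ)| ≤ ‖ξ‖ * ‖M.ga (X k i.2)‖ :=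
            abs_real_inner_le_norm _ _
        _ ≤ ‖ξ‖ * (δ / (|R| + 1) * √(i.1 : ℝ)) := by
            gcongr
            exact h1 k hk
        _ = (√(i.1 : ℝ) * ‖ξ‖) * (δ / (|R| + 1)) := by ring
        _ ≤ (|R| + 1) * (δ / (|R| + 1)) := by
            gcongr
            linarith [le_abs_self R]
        _ = δ := by field_simp
    · rw [mul_assoc]
      exact mul_le_mul_of_nonneg_left (inner_sq_le ξ _) he0.le
  rw [empMean_sub, empMean_const_mul, empMean_const_mul] at h4
  have h5 := h3 ξ
  have h6 : e * ‖ξ‖ ^ 2 * empMean X (fun x => ‖M.ga x‖ ^ 2) i ≤ 2⁻¹ * ε * ‖ξ‖ ^ 2 := by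
    calc _ ≤ e * ‖ξ‖ ^ 2 * (m + 1) := by gcongr
      _ = _ := by rw [he]; field_simp
  rw [abs_le] at *
  constructor <;> nlinarith [h4.1, h4.2, h5.1, h5.2]

/-- The local quadratic expansion of the second-order part of the criterion. The second moments under
`P_T` and under `P₁(· | θ*)`, with the weights `(1 - λ*)⁻¹` and `-λ* (1 - λ*)⁻¹`, combine to those
under `P₀`. -/
lemma local_expansion (R : ℝ) {ε : ℝ} (hε : 0 < ε) :
    ∃ U ∈ 𝓝 φs, ∀ᶠ i in whp μ, ∀ φ ∈ U, ∀ ξ : E (ℓ + 1), ‖√(i.1 : ℝ) • ξ‖ ≤ R →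
      |M.crit ψ (M.mixture φs P₀) X i φ ξ - inner ℝ ξ (M.linPart (M.mixture φs P₀) X i φ)
        + 2⁻¹ * ∫ x, (inner ℝ ξ (M.ga x)) ^ 2 ∂P₀| ≤ ε * ‖ξ‖ ^ 2 := by
  have hl := sub_pos.2 h.lam_mem.2
  set PT := M.mixture φs P₀ with hPT
  set b := 1 / (1 - φs.1) with hb
  have hb0 : 0 < b := by positivity
  set b' := φs.1 / (1 - φs.1) with hb'
  have hb'0 : 0 ≤ b' := div_nonneg h.lam_mem.1.le hl.le
  set mT := ∫ x, ‖M.ga x‖ ^ 2 ∂PT with hmT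
  set m1 := ∫ x, ‖M.ga x‖ ^ 2 ∂M.P₁ φs.2.1 with hm1
  have hmT0 : 0 ≤ mT := integral_nonneg fun _ => sq_nonneg _
  have hm10 : 0 ≤ m1 := integral_nonneg fun _ => sq_nonneg _
  set C := b + b' + 2 + mT + m1 with hC
  have hC0 : 0 < C := by positivity
  set e := min 1 (ε / C) with he
  have he0 : 0 < e := lt_min one_pos (by positivity)
  have he1 : e ≤ 1 := min_le_left _ _
  have heC : e * C ≤ ε := by
    calc e * C ≤ ε / C * C := by
          gcongr
          exact min_le_right _ _
      _ = ε := by field_simp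
  have hrem := h.eventually_abs_rem₁_sub_le he0
  obtain ⟨Uθ, hUθ, V, hV, hUV⟩ := mem_prod_iff.1 hrem
  have hcont1 : ∀ᶠ φ : Param d s in 𝓝 φs, |1 / (1 - φ.1) - b| ≤ e := by
    have : ContinuousAt (fun φ : Param d s => 1 / (1 - φ.1)) φs :=
      continuousAt_const.div (continuousAt_const.sub continuousAt_fst) hl.ne'
    filter_upwards [Metric.tendsto_nhds.1 this.tendsto e he0] with φ hφ
    exact hφ.le
  have hcont2 : ∀ᶠ φ : Param d s in 𝓝 φs, |φ.1 / (1 - φ.1) - b'| ≤ e := by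
    have : ContinuousAt (fun φ : Param d s => φ.1 / (1 - φ.1)) φs :=
      continuousAt_fst.div (continuousAt_const.sub continuousAt_fst) hl.ne'
    filter_upwards [Metric.tendsto_nhds.1 this.tendsto e he0] with φ hφ
    exact hφ.le
  have hcont3 : ∀ᶠ φ : Param d s in 𝓝 φs, φ.2.1 ∈ Uθ :=
    (continuousAt_fst.comp continuousAt_snd).eventually hUθ
  refine ⟨_, hcont1.and (hcont2.and hcont3), ?_⟩
  -- at distance `O(1/√n)` of zero, `ξ` is in the neighbourhood where the expansion holds
  have hsmall : ∀ᶠ i : ℕ × Ω in whp μ, ∀ ξ : E (ℓ + 1), ‖√(i.1 : ℝ) • ξ‖ ≤ R → ξ ∈ V := by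
    obtain ⟨δ, hδ, hball⟩ := Metric.mem_nhds_iff.1 hV
    have h1 : Tendsto (fun i : ℕ × Ω => √(i.1 : ℝ)) (whp μ) atTop :=
      Real.tendsto_sqrt_atTop.comp (tendsto_natCast_atTop_atTop.comp tendsto_fst_whp)
    filter_upwards [h1.eventually_gt_atTop ((|R| + 1) / δ)] with i hi ξ hξ
    refine hball ?_
    rw [mem_ball_zero_iff]
    rw [norm_smul, Real.norm_of_nonneg (Real.sqrt_nonneg _)] at hξ
    rw [div_lt_iff₀ hδ] at hi
    by_contra hcon
    have : √(i.1 : ℝ) * δ ≤ √(i.1 : ℝ) * ‖ξ‖ := by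
      gcongr
      exact not_lt.1 hcon
    linarith [le_abs_self R]
  filter_upwards [hsmall, h.eventually_abs_empMean_tilt_sub_le hind hlaw R he0] with i h1 h2 φ hφ ξ hξ
  obtain ⟨g1, g2, g3⟩ := hφ
  have g4 := h2 ξ hξ
  have g5 : |M.rem₁ ψ φ.2.1 ξ - 2⁻¹ * ∫ x, (inner ℝ ξ (M.ga x)) ^ 2 ∂M.P₁ φs.2.1| ≤ e * ‖ξ‖ ^ 2 :=
    hUV (Set.mk_mem_prod g3 (h1 ξ hξ))
  have g6 := integral_sq_le h.integrable_norm_sq ξ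
  have g7 := integral_sq_le h.integrable_norm_sq_P₁ ξ
  have g8 := integral_sq_nonneg (M := M) (M.mixture φs P₀) ξ
  have g9 := integral_sq_nonneg (M := M) (M.P₁ φs.2.1) ξ
  have g10 := h.integral_sq_mixture ξ
  rw [← hPT] at g4 g6 g8 g10
  have hcrit : M.crit ψ PT X i φ ξ - inner ℝ ξ (M.linPart PT X i φ) =
      -(1 / (1 - φ.1)) * empMean X (fun x => tilt ψ (inner ℝ ξ (M.ga x))) i
        + φ.1 / (1 - φ.1) * M.rem₁ ψ φ.2.1 ξ := by
    rw [Model.crit]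
    ring
  have hQ0 : ∫ x, (inner ℝ ξ (M.ga x)) ^ 2 ∂P₀ = b * (∫ x, (inner ℝ ξ (M.ga x)) ^ 2 ∂PT)
      - b' * ∫ x, (inner ℝ ξ (M.ga x)) ^ 2 ∂M.P₁ φs.2.1 := by
    rw [g10, hb, hb']
    field_simp
    ring
  rw [hcrit, hQ0]
  refine (abs_second_order_le hb0.le hb'0 he0.le he1 g1 g2 g4 g5 g8 g6 g9
    g7).trans ?_
  exact mul_le_mul_of_nonneg_right heC (sq_nonneg _)

end Regular

/-! ### The global quadratic bound on the criterion -/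

/-- Error propagation in the lower bound for a difference `T - λ R` of two approximately quadratic
terms. -/
lemma second_order_lower_bound {e N T S Γ l l' R QT Q₁ Q₀ m : ℝ} (he : 0 ≤ e) (hm : 0 ≤ m)
    (hl0 : 0 ≤ l) (hl1 : l ≤ 1) (hN : 0 ≤ N) (hT : 2⁻¹ * S - N * Γ ≤ T) (hΓ : Γ ≤ e)
    (hS : QT - e * N ≤ S) (hR : R - 2⁻¹ * Q₁ ≤ e * N) (hl : l - l' ≤ e / (m + 1))
    (hQ₁ : Q₁ ≤ m * N) (hQ₁' : 0 ≤ Q₁) (hQT : QT = l' * Q₁ + (1 - l') * Q₀)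
    (hQ₀ : 16 * e * N ≤ (1 - l') * Q₀) : e * N ≤ T - l * R := by
  have k1 : N * Γ ≤ N * e := mul_le_mul_of_nonneg_left hΓ hN
  have k2 : l * R ≤ l * (2⁻¹ * Q₁) + e * N := by
    have h5 := mul_le_mul_of_nonneg_left hR hl0
    have h6 : l * (e * N) ≤ 1 * (e * N) :=
      mul_le_mul_of_nonneg_right hl1 (mul_nonneg he hN)
    linarith
  have k3 : (l - l') * Q₁ ≤ e * N := by
    calc (l - l') * Q₁ ≤ e / (m + 1) * (m * N) := mul_le_mul hl hQ₁ hQ₁' (by positivity)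
      _ ≤ e / (m + 1) * ((m + 1) * N) := by gcongr; linarith
      _ = e * N := by field_simp
  have k5 : 0 ≤ e * N := mul_nonneg he hN
  linarith

/-- The integrand `ψ(ξᵗ g) - ξᵗ g`, truncated to `‖g‖ ≤ K`. -/
def Model.truncTilt {r d s ℓ : ℕ} (M : Model r d s ℓ) (ψ : ℝ → ℝ) (ξ : E (ℓ + 1)) (K : ℕ) :
    E r → ℝ :=
  {x | ‖M.ga x‖ ≤ K}.indicator fun x => tilt ψ (inner ℝ ξ (M.ga x))

namespace Regular

variable {r d s ℓ : ℕ} {M : Model r d s ℓ} {ψ : ℝ → ℝ} {φs : Param d s}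
  {P₀ : Measure (E r)} {rt ρ : ℝ} (h : Regular M ψ φs P₀ rt ρ)
include h

omit h in
lemma measurableSet_norm_ga_le (K : ℕ) : MeasurableSet {x | ‖M.ga x‖ ≤ K} :=
  measurableSet_le Model.measurable_ga.norm measurable_const

lemma measurable_truncTilt (ξ : E (ℓ + 1)) (K : ℕ) : Measurable (M.truncTilt ψ ξ K) :=
  (h.measurable_tilt_inner ξ).indicator (measurableSet_norm_ga_le K)

lemma truncTilt_nonneg (ξ : E (ℓ + 1)) (K : ℕ) (x : E r) : 0 ≤ M.truncTilt ψ ξ K x :=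
  Set.indicator_nonneg (fun _ _ => h.conj.tilt_nonneg _) x

lemma integrable_truncTilt (Q : Measure (E r)) [IsFiniteMeasure Q] (ξ : E (ℓ + 1)) (K : ℕ) :
    Integrable (M.truncTilt ψ ξ K) Q := by
  obtain ⟨C, hC⟩ := (isCompact_Icc (a := -(‖ξ‖ * K)) (b := ‖ξ‖ * K)).exists_bound_of_continuousOn
    h.conj.continuous_tilt.continuousOn
  refine Integrable.of_bound (h.measurable_truncTilt ξ K).aestronglyMeasurable (max C 0)
    (ae_of_all _ fun x => ?_)
  by_cases hx : ‖M.ga x‖ ≤ K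
  · rw [Model.truncTilt, Set.indicator_of_mem (by exact hx)]
    refine (hC _ ?_).trans (le_max_left _ _)
    rw [Set.mem_Icc, ← abs_le]
    exact (abs_real_inner_le_norm _ _).trans (by gcongr)
  · rw [Model.truncTilt, Set.indicator_of_notMem (by exact hx)]
    simp

lemma truncTilt_mono (ξ : E (ℓ + 1)) {K K' : ℕ} (hK : K ≤ K') (x : E r) :
    M.truncTilt ψ ξ K x ≤ M.truncTilt ψ ξ K' x := by
  refine Set.indicator_le_indicator_of_subset (fun y hy => ?_) (fun y => h.conj.tilt_nonneg _) x
  exact le_trans (show ‖M.ga y‖ ≤ K from hy) (by exact_mod_cast hK)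

lemma tendsto_truncTilt_P₁ {ξ : E (ℓ + 1)} (hξ : ‖ξ‖ ≤ ρ) :
    Tendsto (fun K : ℕ => ∫ x, M.truncTilt ψ ξ K x ∂M.P₁ φs.2.1) atTop
      (𝓝 (M.rem₁ ψ φs.2.1 ξ)) := by
  rw [← h.integral_tilt_P₁ h.θ_mem]
  refine tendsto_integral_of_dominated_convergence
    (fun x => tilt ψ (inner ℝ ξ (M.ga x)))
    (fun K => (h.measurable_truncTilt ξ K).aestronglyMeasurable) (h.integrable_tilt_P₁ h.θ_mem hξ)
    (fun K => ae_of_all _ fun x => ?_) (ae_of_all _ fun x => ?_)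
  · rw [Real.norm_of_nonneg (h.truncTilt_nonneg ξ K x)]
    exact Set.indicator_le_self' (fun y _ => h.conj.tilt_nonneg _) x
  · refine tendsto_const_nhds.congr' ?_
    obtain ⟨N, hN⟩ := exists_nat_ge ‖M.ga x‖
    filter_upwards [eventually_ge_atTop N] with K hK
    rw [Model.truncTilt, Set.indicator_of_mem]
    exact hN.trans (by exact_mod_cast hK)

/-- For `ξ ≠ 0` the truncated integral under the unknown component is positive: otherwise
`ξᵗ g = 0` almost surely, and the second-moment matrix would be singular. -/
lemma exists_integral_truncTilt_pos {a : ℝ} (ha : 0 < a)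
    (hcoer : ∀ ξ : E (ℓ + 1), a * ‖ξ‖ ^ 2 ≤ ∫ x, (inner ℝ ξ (M.ga x)) ^ 2 ∂P₀) {ξ : E (ℓ + 1)}
    (hξ : ξ ≠ 0) : ∃ K : ℕ, 0 < ∫ x, M.truncTilt ψ ξ K x ∂P₀ := by
  have := h.isProbabilityMeasure_P₀
  by_contra! hcon
  have hae : ∀ᵐ x ∂P₀, ∀ K : ℕ, M.truncTilt ψ ξ K x = 0 := by
    refine ae_all_iff.2 fun K => ?_
    have h0 : ∫ x, M.truncTilt ψ ξ K x ∂P₀ = 0 :=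
      le_antisymm (hcon K) (integral_nonneg (h.truncTilt_nonneg ξ K))
    exact (integral_eq_zero_iff_of_nonneg (h.truncTilt_nonneg ξ K)
      (h.integrable_truncTilt P₀ ξ K)).1 h0
  have hzero : ∫ x, (inner ℝ ξ (M.ga x)) ^ 2 ∂P₀ = ∫ _, (0 : ℝ) ∂P₀ := by
    refine integral_congr_ae (hae.mono fun x hx => ?_)
    obtain ⟨K, hK⟩ := exists_nat_ge ‖M.ga x‖
    have h1 := hx K
    rw [Model.truncTilt, Set.indicator_of_mem (by exact hK)] at h1
    have h2 : (inner ℝ ξ (M.ga x) : ℝ) = 0 := by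
      by_contra h3
      exact (h.conj.tilt_pos h3).ne' h1
    simp [h2]
  have h4 := hcoer ξ
  rw [hzero, integral_zero] at h4
  have h5 : 0 < ‖ξ‖ ^ 2 := by
    have := norm_pos_iff.2 hξ
    positivity
  nlinarith

variable {Ω : Type*} [MeasurableSpace Ω] {μ : Measure Ω} [IsProbabilityMeasure μ]
  {X : ℕ → Ω → E r} (hind : iIndepFun X μ) (hlaw : ∀ k, HasLaw (X k) (M.mixture φs P₀) μ)
include hind hlaw

/-- A lower bound on the second-order part of the criterion, near a nonzero point `ξ₀`. As `tilt ψ` is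
nonnegative, truncating the empirical integrand costs nothing, and the truncated one needs no
moments; its mean still exceeds the parametric term, by the positive integral under `P₀`. -/
lemma lower_bound_ne_zero {a : ℝ} (ha : 0 < a)
    (hcoer : ∀ ξ : E (ℓ + 1), a * ‖ξ‖ ^ 2 ≤ ∫ x, (inner ℝ ξ (M.ga x)) ^ 2 ∂P₀) {ξ₀ : E (ℓ + 1)}
    (hξ₀ : ξ₀ ≠ 0) (hξ₀' : ‖ξ₀‖ ≤ ρ) :
    ∃ V ∈ 𝓝[Metric.closedBall 0 ρ] ξ₀, ∃ c > 0, ∃ U ∈ 𝓝 φs, ∀ᶠ i in whp μ, ∀ φ ∈ U, ∀ ξ ∈ V,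
      ‖ξ‖ ≤ ρ → c * ‖ξ‖ ^ 2 ≤ empMean X (fun x => tilt ψ (inner ℝ ξ (M.ga x))) i
        - φ.1 * M.rem₁ ψ φ.2.1 ξ := by
  have := h.isProbabilityMeasure_P₀
  have := h.isProbabilityMeasure_mixture
  have hl := sub_pos.2 h.lam_mem.2
  obtain ⟨K₀, hK₀⟩ := h.exists_integral_truncTilt_pos ha hcoer hξ₀
  set v₀ := ∫ x, M.truncTilt ψ ξ₀ K₀ x ∂P₀ with hv₀
  -- the margin `(1 - λ*) v₀` is split into four parts
  set e := (1 - φs.1) * v₀ / 4 with he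
  have he0 : 0 < e := by positivity
  obtain ⟨K, hK, hKlt⟩ : ∃ K ≥ K₀, φs.1 * M.rem₁ ψ φs.2.1 ξ₀ - e <
      φs.1 * ∫ x, M.truncTilt ψ ξ₀ K x ∂M.P₁ φs.2.1 := by
    have h1 := (h.tendsto_truncTilt_P₁ hξ₀').const_mul φs.1
    have h2 := h1.eventually (lt_mem_nhds (sub_lt_self _ he0))
    obtain ⟨K, hK⟩ := (h2.and (eventually_ge_atTop K₀)).exists
    exact ⟨K, hK.2, hK.1⟩
  have hPT : φs.1 * M.rem₁ ψ φs.2.1 ξ₀ + 3 * e < ∫ x, M.truncTilt ψ ξ₀ K x ∂M.mixture φs P₀ := by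
    rw [Model.integral_mixture h.lam_mem.1 h.lam_mem.2 (h.integrable_truncTilt _ ξ₀ K),
      smul_eq_mul, smul_eq_mul]
    have h1 : v₀ ≤ ∫ x, M.truncTilt ψ ξ₀ K x ∂P₀ :=
      integral_mono (h.integrable_truncTilt _ _ _) (h.integrable_truncTilt _ _ _)
        (h.truncTilt_mono ξ₀ hK)
    have h2 := mul_le_mul_of_nonneg_left h1 hl.le
    have h3 : (1 - φs.1) * v₀ = 4 * e := by rw [he]; ring
    linarith
  -- the truncated integrands are equicontinuous in `ξ`
  have huc : UniformContinuousOn (tilt ψ) (Set.Icc (-(ρ * K)) (ρ * K)) :=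
    isCompact_Icc.uniformContinuousOn_of_continuous h.conj.continuous_tilt.continuousOn
  obtain ⟨δ, hδ, hδe⟩ := Metric.uniformContinuousOn_iff.1 huc e he0
  have hclose : ∀ ξ : E (ℓ + 1), ‖ξ‖ ≤ ρ → ‖ξ - ξ₀‖ < δ / (K + 1) → ∀ x,
      M.truncTilt ψ ξ₀ K x - e ≤ tilt ψ (inner ℝ ξ (M.ga x)) := by
    intro ξ hξ hd x
    by_cases hx : ‖M.ga x‖ ≤ K
    · rw [Model.truncTilt, Set.indicator_of_mem (by exact hx)]
      have hin : ∀ η : E (ℓ + 1), ‖η‖ ≤ ρ → (inner ℝ η (M.ga x) : ℝ) ∈ Set.Icc (-(ρ * K)) (ρ * K) := by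
        intro η hη
        rw [Set.mem_Icc, ← abs_le]
        exact (abs_real_inner_le_norm _ _).trans (mul_le_mul hη hx (norm_nonneg _) h.ρ_pos.le)
      have hdist : dist (inner ℝ ξ (M.ga x) : ℝ) (inner ℝ ξ₀ (M.ga x)) < δ := by
        rw [Real.dist_eq, ← inner_sub_left]
        rw [lt_div_iff₀ (by positivity)] at hd
        refine (abs_real_inner_le_norm _ _).trans_lt (lt_of_le_of_lt ?_ hd)
        gcongr
        linarith
      have := hδe _ (hin ξ hξ) _ (hin ξ₀ hξ₀') hdist
      rw [Real.dist_eq] at this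
      linarith [(abs_lt.1 this).1]
    · rw [Model.truncTilt, Set.indicator_of_notMem (by exact hx)]
      linarith [h.conj.tilt_nonneg (inner ℝ ξ (M.ga x))]
  have hlln := tendsto_empMean hind hlaw (f := fun x => M.truncTilt ψ ξ₀ K x - e)
    ((h.measurable_truncTilt ξ₀ K).sub_const _)
    ((h.integrable_truncTilt _ ξ₀ K).sub (integrable_const _))
  rw [integral_sub (h.integrable_truncTilt _ ξ₀ K) (integrable_const _), integral_const,
    probReal_univ, one_smul] at hlln
  have hev := hlln.eventually (lt_mem_nhds (show φs.1 * M.rem₁ ψ φs.2.1 ξ₀ + 2 * e < _ by linarith))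
  -- continuity of the parametric part
  have hrem : ∀ᶠ q : Param d s × E (ℓ + 1) in 𝓝 φs ×ˢ 𝓝[Metric.closedBall 0 ρ] ξ₀,
      q.1.1 * M.rem₁ ψ q.1.2.1 q.2 < φs.1 * M.rem₁ ψ φs.2.1 ξ₀ + e := by
    have h1 : Tendsto (fun q : Param d s × E (ℓ + 1) => (q.1.2.1, q.2))
        (𝓝 φs ×ˢ 𝓝[Metric.closedBall 0 ρ] ξ₀) (𝓝 φs.2.1 ×ˢ 𝓝[Metric.closedBall 0 ρ] ξ₀) :=
      (((continuousAt_fst.comp continuousAt_snd :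
        ContinuousAt (fun φ : Param d s => φ.2.1) φs).tendsto).comp tendsto_fst).prodMk tendsto_snd
    have h2 : Tendsto (fun q : Param d s × E (ℓ + 1) => q.1.1)
        (𝓝 φs ×ˢ 𝓝[Metric.closedBall 0 ρ] ξ₀) (𝓝 φs.1) :=
      (continuousAt_fst : ContinuousAt (fun φ : Param d s => φ.1) φs).tendsto.comp tendsto_fst
    exact (h2.mul ((h.tendsto_rem₁ ξ₀).comp h1)).eventually (gt_mem_nhds (by linarith))
  obtain ⟨U, hU, V, hV, hUV⟩ := mem_prod_iff.1 hrem
  have hball : Metric.ball ξ₀ (δ / (K + 1)) ∈ 𝓝[Metric.closedBall 0 ρ] ξ₀ :=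
    mem_nhdsWithin_of_mem_nhds (Metric.ball_mem_nhds _ (by positivity))
  refine ⟨V ∩ Metric.ball ξ₀ (δ / (K + 1)), inter_mem hV hball, e / ρ ^ 2,
    div_pos he0 (pow_pos h.ρ_pos 2), U, hU, ?_⟩
  filter_upwards [hev] with i hi φ hφ ξ hξ hξρ
  have h1 : φ.1 * M.rem₁ ψ φ.2.1 ξ < φs.1 * M.rem₁ ψ φs.2.1 ξ₀ + e :=
    hUV (Set.mk_mem_prod hφ hξ.1)
  have h2 := empMean_mono (X := X) (hclose ξ hξρ (by simpa [dist_eq_norm] using hξ.2)) i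
  have h3 : e / ρ ^ 2 * ‖ξ‖ ^ 2 ≤ e := by
    rw [div_mul_eq_mul_div, div_le_iff₀ (pow_pos h.ρ_pos 2)]
    gcongr
  linarith

/-- A lower bound on the second-order part of the criterion, near zero, from the second moments: up to
small errors it is `½ (E_{P_T} - λ* E_{P₁})⟪ξ, g⟫² = ½ (1 - λ*) E_{P₀}⟪ξ, g⟫²`. -/
lemma lower_bound_zero {a : ℝ} (ha : 0 < a)
    (hcoer : ∀ ξ : E (ℓ + 1), a * ‖ξ‖ ^ 2 ≤ ∫ x, (inner ℝ ξ (M.ga x)) ^ 2 ∂P₀) :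
    ∃ V ∈ 𝓝 (0 : E (ℓ + 1)), ∃ c > 0, ∃ U ∈ 𝓝 φs, ∀ᶠ i in whp μ, ∀ φ ∈ U, ∀ ξ ∈ V,
      c * ‖ξ‖ ^ 2 ≤ empMean X (fun x => tilt ψ (inner ℝ ξ (M.ga x))) i
        - φ.1 * M.rem₁ ψ φ.2.1 ξ := by
  have hl := sub_pos.2 h.lam_mem.2
  have hsq := h.integrable_norm_sq
  set m1 := ∫ x, ‖M.ga x‖ ^ 2 ∂M.P₁ φs.2.1 with hm1
  have hm10 : 0 ≤ m1 := integral_nonneg fun _ => sq_nonneg _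
  set mT := ∫ x, ‖M.ga x‖ ^ 2 ∂M.mixture φs P₀ with hmT
  have hmT0 : 0 ≤ mT := integral_nonneg fun _ => sq_nonneg _
  -- `½ (1 - λ*) E_{P₀}⟪ξ, g⟫² ≥ 8 e ‖ξ‖²` absorbs the errors, which are of the order `e ‖ξ‖²`
  set e := (1 - φs.1) * a / 16 with he
  have he0 : 0 < e := by positivity
  -- the loss by truncation and by the Taylor expansion is at most `‖ξ‖² G`, with `∫ G dP_T ≤ e`
  set e' := e / (2 * (mT + 1)) with he'
  have he'0 : 0 < e' := by positivity
  have htail : Tendsto (fun K : ℕ => ∫ x, {x | ‖M.ga x‖ ≤ K}ᶜ.indicator (fun x => ‖M.ga x‖ ^ 2) x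
      ∂M.mixture φs P₀) atTop (𝓝 (∫ _, (0 : ℝ) ∂M.mixture φs P₀)) := by
    refine tendsto_integral_of_dominated_convergence (fun x => ‖M.ga x‖ ^ 2) (fun K => ?_) hsq
      (fun K => ae_of_all _ fun x => ?_) (ae_of_all _ fun x => ?_)
    · exact ((Model.measurable_ga.norm.pow_const 2).indicator
        (measurableSet_norm_ga_le K).compl).aestronglyMeasurable
    · rw [Real.norm_of_nonneg (Set.indicator_nonneg (fun _ _ => sq_nonneg _) x)]
      exact Set.indicator_le_self' (fun y _ => sq_nonneg _) x
    · refine tendsto_const_nhds.congr' ?_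
      obtain ⟨N, hN⟩ := exists_nat_ge ‖M.ga x‖
      filter_upwards [eventually_ge_atTop N] with K hK
      rw [Set.indicator_of_notMem]
      simp only [Set.mem_compl_iff, not_not]
      exact hN.trans (by exact_mod_cast hK)
  rw [integral_zero] at htail
  obtain ⟨K, hK⟩ := (htail.eventually (gt_mem_nhds (half_pos he0))).exists
  set G : E r → ℝ := fun x => {x | ‖M.ga x‖ ≤ K}ᶜ.indicator (fun x => ‖M.ga x‖ ^ 2) x
    + e' * ‖M.ga x‖ ^ 2 with hG
  have hGi1 : Integrable ({x | ‖M.ga x‖ ≤ K}ᶜ.indicator fun x => ‖M.ga x‖ ^ 2)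
      (M.mixture φs P₀) := hsq.indicator (measurableSet_norm_ga_le K).compl
  have hGlt : ∫ x, G x ∂M.mixture φs P₀ < e := by
    rw [hG, integral_add hGi1 (hsq.const_mul _), integral_const_mul]
    have : e' * mT ≤ e / 2 := by
      rw [he', div_mul_eq_mul_div, div_le_div_iff₀ (by positivity) two_pos]
      nlinarith
    linarith
  obtain ⟨δ, hδ, htilt⟩ := h.conj.exists_abs_tilt_sub_le he'0
  have hlow : ∀ ξ : E (ℓ + 1), ‖ξ‖ ≤ δ / (K + 1) → ∀ x,
      2⁻¹ * (inner ℝ ξ (M.ga x)) ^ 2 - ‖ξ‖ ^ 2 * G x ≤ tilt ψ (inner ℝ ξ (M.ga x)) := by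
    intro ξ hξ x
    have h1 := inner_sq_le (M := M) ξ x
    rw [hG]
    by_cases hx : ‖M.ga x‖ ≤ K
    · simp only
      rw [Set.indicator_of_notMem (by simpa using hx), zero_add]
      have h2 : |(inner ℝ ξ (M.ga x) : ℝ)| ≤ δ := by
        rw [le_div_iff₀ (by positivity)] at hξ
        refine (abs_real_inner_le_norm _ _).trans (le_trans ?_ hξ)
        gcongr
        linarith
      have h3 := (abs_le.1 (htilt _ h2)).1
      have h4 := mul_le_mul_of_nonneg_left h1 he'0.le
      linarith
    · simp only
      rw [Set.indicator_of_mem (by simpa using hx)]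
      have h2 := h.conj.tilt_nonneg (inner ℝ ξ (M.ga x))
      have h3 : 0 ≤ ‖ξ‖ ^ 2 * (e' * ‖M.ga x‖ ^ 2) := by positivity
      have h4 : 0 ≤ ‖ξ‖ ^ 2 * ‖M.ga x‖ ^ 2 := by positivity
      rw [mul_add]
      linarith
  have hGm : Measurable G := by
    refine ((Model.measurable_ga.norm.pow_const 2).indicator
      (measurableSet_norm_ga_le K).compl).add ((Model.measurable_ga.norm.pow_const 2).const_mul _)
  have hlln := (tendsto_empMean hind hlaw hGm (hGi1.add (hsq.const_mul _))).eventually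
    (gt_mem_nhds hGlt)
  have hrem := h.eventually_abs_rem₁_sub_le he0
  obtain ⟨Uθ, hUθ, V, hV, hUV⟩ := mem_prod_iff.1 hrem
  have hcont1 : ∀ᶠ φ : Param d s in 𝓝 φs, |φ.1 - φs.1| ≤ e / (m1 + 1) ∧ 0 < φ.1 ∧ φ.1 < 1 := by
    have hc : ContinuousAt (fun φ : Param d s => φ.1) φs := continuousAt_fst
    filter_upwards [Metric.tendsto_nhds.1 hc.tendsto (e / (m1 + 1)) (by positivity),
      hc.eventually (lt_mem_nhds h.lam_mem.1), hc.eventually (gt_mem_nhds h.lam_mem.2)]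
      with φ h1 h2 h3
    exact ⟨h1.le, h2, h3⟩
  have hcont3 : ∀ᶠ φ : Param d s in 𝓝 φs, φ.2.1 ∈ Uθ :=
    (continuousAt_fst.comp continuousAt_snd).eventually hUθ
  have hball : Metric.closedBall (0 : E (ℓ + 1)) (δ / (K + 1)) ∈ 𝓝 0 :=
    Metric.closedBall_mem_nhds _ (by positivity)
  refine ⟨_, inter_mem hV hball, e, he0, _, hcont1.and hcont3, ?_⟩
  filter_upwards [hlln, h.eventually_abs_empMean_sq_sub_le hind hlaw he0] with i h1 h2 φ hφ ξ hξ
  obtain ⟨⟨g1, g2, g2'⟩, g3⟩ := hφ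
  have g5 : |M.rem₁ ψ φ.2.1 ξ - 2⁻¹ * ∫ x, (inner ℝ ξ (M.ga x)) ^ 2 ∂M.P₁ φs.2.1| ≤ e * ‖ξ‖ ^ 2 :=
    hUV (Set.mk_mem_prod g3 hξ.1)
  have g7 := integral_sq_le h.integrable_norm_sq_P₁ ξ
  have g9 := integral_sq_nonneg (M := M) (M.P₁ φs.2.1) ξ
  have g10 := h.integral_sq_mixture ξ
  have g11 := empMean_mono (X := X) (hlow ξ (by simpa using hξ.2)) i
  rw [empMean_sub, empMean_const_mul, empMean_const_mul] at g11
  have g12 := (abs_le.1 (h2 ξ)).1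
  have g13 := hcoer ξ
  rw [← hm1] at g7
  have g14 : 16 * e * ‖ξ‖ ^ 2 ≤ (1 - φs.1) * ∫ x, (inner ℝ ξ (M.ga x)) ^ 2 ∂P₀ := by
    have : 16 * e * ‖ξ‖ ^ 2 = (1 - φs.1) * (a * ‖ξ‖ ^ 2) := by rw [he]; ring
    rw [this]
    exact mul_le_mul_of_nonneg_left g13 hl.le
  exact second_order_lower_bound he0.le hm10 g2.le g2'.le (sq_nonneg _) g11 h1.le
    (by linarith) (abs_le.1 g5).2 ((le_abs_self _).trans g1) g7 g9 g10 g14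

/-- The second-order part of the criterion is bounded below by a quadratic function on the ball of
radius `ρ`, by compactness. -/
lemma exists_lower_bound {a : ℝ} (ha : 0 < a)
    (hcoer : ∀ ξ : E (ℓ + 1), a * ‖ξ‖ ^ 2 ≤ ∫ x, (inner ℝ ξ (M.ga x)) ^ 2 ∂P₀) :
    ∃ c > 0, ∃ U ∈ 𝓝 φs, ∀ᶠ i in whp μ, ∀ φ ∈ U, ∀ ξ : E (ℓ + 1), ‖ξ‖ ≤ ρ →
      c * ‖ξ‖ ^ 2 ≤ empMean X (fun x => tilt ψ (inner ℝ ξ (M.ga x))) i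
        - φ.1 * M.rem₁ ψ φ.2.1 ξ := by
  have key := (isCompact_closedBall (0 : E (ℓ + 1)) ρ).induction_on
    (p := fun t => ∃ c > 0, ∃ U ∈ 𝓝 φs, ∀ᶠ i in whp μ, ∀ φ ∈ U, ∀ ξ ∈ t, ‖ξ‖ ≤ ρ →
      c * ‖ξ‖ ^ 2 ≤ empMean X (fun x => tilt ψ (inner ℝ ξ (M.ga x))) i
        - φ.1 * M.rem₁ ψ φ.2.1 ξ) ?_ ?_ ?_ ?_
  · obtain ⟨c, hc, U, hU, hev⟩ := key
    exact ⟨c, hc, U, hU, hev.mono fun i hi φ hφ ξ hξ => hi φ hφ ξ (by simpa using hξ) hξ⟩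
  · exact ⟨1, one_pos, Set.univ, univ_mem, Eventually.of_forall fun i φ _ ξ hξ => by simp at hξ⟩
  · rintro t t' htt' ⟨c, hc, U, hU, hev⟩
    exact ⟨c, hc, U, hU, hev.mono fun i hi φ hφ ξ hξ => hi φ hφ ξ (htt' hξ)⟩
  · rintro t t' ⟨c, hc, U, hU, hev⟩ ⟨c', hc', U', hU', hev'⟩
    refine ⟨min c c', lt_min hc hc', U ∩ U', inter_mem hU hU', ?_⟩
    filter_upwards [hev, hev'] with i hi hi' φ hφ ξ hξ hξρ
    rcases hξ with hξ | hξ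
    · refine le_trans ?_ (hi φ hφ.1 ξ hξ hξρ)
      gcongr
      exact min_le_left _ _
    · refine le_trans ?_ (hi' φ hφ.2 ξ hξ hξρ)
      gcongr
      exact min_le_right _ _
  · intro ξ₀ hξ₀
    rcases eq_or_ne ξ₀ 0 with rfl | hne
    · obtain ⟨V, hV, c, hc, U, hU, hev⟩ := h.lower_bound_zero hind hlaw ha hcoer
      exact ⟨V, mem_nhdsWithin_of_mem_nhds hV, c, hc, U, hU,
        hev.mono fun i hi φ hφ ξ hξ _ => hi φ hφ ξ hξ⟩
    · obtain ⟨V, hV, c, hc, U, hU, hev⟩ := h.lower_bound_ne_zero hind hlaw ha hcoer hne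
        (by simpa using hξ₀)
      exact ⟨V, hV, c, hc, U, hU, hev⟩

/-- With high probability the criterion lies below a concave quadratic function with the same linear
part, for all parameters near the true one and all `ξ` in the ball of radius `ρ`. -/
lemma exists_upper_bound {a : ℝ} (ha : 0 < a)
    (hcoer : ∀ ξ : E (ℓ + 1), a * ‖ξ‖ ^ 2 ≤ ∫ x, (inner ℝ ξ (M.ga x)) ^ 2 ∂P₀) :
    ∃ c > 0, ∃ U ∈ 𝓝 φs, ∀ᶠ i in whp μ, ∀ φ ∈ U, ∀ ξ : E (ℓ + 1), ‖ξ‖ ≤ ρ →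
      M.crit ψ (M.mixture φs P₀) X i φ ξ ≤
        inner ℝ ξ (M.linPart (M.mixture φs P₀) X i φ) - c * ‖ξ‖ ^ 2 := by
  obtain ⟨c, hc, U, hU, hev⟩ := h.exists_lower_bound hind hlaw ha hcoer
  have hcont : ∀ᶠ φ : Param d s in 𝓝 φs, 0 < φ.1 ∧ φ.1 < 1 := by
    have hc : ContinuousAt (fun φ : Param d s => φ.1) φs := continuousAt_fst
    exact (hc.eventually (lt_mem_nhds h.lam_mem.1)).and (hc.eventually (gt_mem_nhds h.lam_mem.2))
  refine ⟨c, hc, _, inter_mem hU hcont, hev.mono fun i hi φ hφ ξ hξ => ?_⟩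
  obtain ⟨hφ1, hφ2, hφ3⟩ := hφ
  have h1 := hi φ hφ1 ξ hξ
  have h2 : M.crit ψ (M.mixture φs P₀) X i φ ξ =
      inner ℝ ξ (M.linPart (M.mixture φs P₀) X i φ)
      - (empMean X (fun x => tilt ψ (inner ℝ ξ (M.ga x))) i - φ.1 * M.rem₁ ψ φ.2.1 ξ)
        / (1 - φ.1) := by
    rw [Model.crit]
    ring
  rw [h2]
  have h3 : c * ‖ξ‖ ^ 2 ≤ (empMean X (fun x => tilt ψ (inner ℝ ξ (M.ga x))) i
      - φ.1 * M.rem₁ ψ φ.2.1 ξ) / (1 - φ.1) := by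
    rw [le_div_iff₀ (sub_pos.2 hφ3)]
    have : 0 ≤ c * ‖ξ‖ ^ 2 := by positivity
    nlinarith
  linarith

end Regular

/-! ### The multivariate central limit theorem -/

section CLT

variable {Ω α : Type*} [MeasurableSpace Ω] [MeasurableSpace α] {μ : Measure Ω}
  [IsProbabilityMeasure μ] {P : Measure α} {X : ℕ → Ω → α}

/-- The centred and rescaled sum of the first `n` values of `f` along the sample. -/
def normSum {F : Type*} [NormedAddCommGroup F] [NormedSpace ℝ F] (P : Measure α) (X : ℕ → Ω → α)
    (f : α → F) (n : ℕ) (ω : Ω) : F :=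
  (√(n : ℝ))⁻¹ • (∑ k ∈ Finset.range n, f (X k ω) - (n : ℝ) • ∫ x, f x ∂P)

variable {F : Type*} [NormedAddCommGroup F] [InnerProductSpace ℝ F] [FiniteDimensional ℝ F]
  [MeasurableSpace F] [BorelSpace F]

omit [IsProbabilityMeasure μ] in
lemma aemeasurable_normSum (hlaw : ∀ k, HasLaw (X k) P μ) {f : α → F} (hf : Measurable f) (n : ℕ) :
    AEMeasurable (normSum P X f n) μ :=
  ((Finset.aemeasurable_fun_sum _ fun k _ => hf.comp_aemeasurable (hlaw k).aemeasurable).sub_const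
    _).const_smul _

/-- The Cramér-Wold device: the characteristic function of the normalised sum at `t` is that of a
real normalised sum at `1`, to which the one-dimensional central limit theorem applies. -/
lemma tendsto_charFun_normSum (hind : iIndepFun X μ) (hlaw : ∀ k, HasLaw (X k) P μ) {f : α → F}
    (hf : Measurable f) (hf2 : MemLp f 2 P) (t : F) :
    Tendsto (fun n => charFun (μ.map (normSum P X f n)) t) atTop
      (𝓝 (Complex.exp (-(Var[fun x => (inner ℝ (f x) t : ℝ); P] : ℝ) / 2))) := by
  have : IsProbabilityMeasure P := by
    rw [← (hlaw 0).map_eq]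
    exact Measure.isProbabilityMeasure_map (hlaw 0).aemeasurable
  set g : α → ℝ := fun x => inner ℝ (f x) t with hg
  have hgm : Measurable g := hf.inner_const
  have hg2 : MemLp g 2 P := hf2.inner_const t
  have hfi : Integrable f P := hf2.integrable (by norm_num)
  have hident : ∀ k, IdentDistrib (fun ω => g (X k ω)) (fun ω => g (X 0 ω)) μ μ := fun k =>
    (IdentDistrib.mk (hlaw k).aemeasurable (hlaw 0).aemeasurable
      ((hlaw k).map_eq.trans (hlaw 0).map_eq.symm)).comp hgm
  have hexp : ∫ ω, g (X 0 ω) ∂μ = ∫ x, g x ∂P := by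
    rw [← (hlaw 0).map_eq, integral_map (hlaw 0).aemeasurable hgm.aestronglyMeasurable]
  have hvar : Var[fun ω => g (X 0 ω); μ] = Var[g; P] := by
    rw [← (hlaw 0).map_eq, variance_map hgm.aemeasurable (hlaw 0).aemeasurable]
    rfl
  have hX2 : MemLp (fun ω => g (X 0 ω)) 2 μ := by
    have h1 := hg2
    rw [← (hlaw 0).map_eq] at h1
    exact h1.comp_of_map (hlaw 0).aemeasurable
  have hY : HasLaw (id : ℝ → ℝ) (gaussianReal 0 Var[fun ω => g (X 0 ω); μ].toNNReal)
      (gaussianReal 0 Var[fun ω => g (X 0 ω); μ].toNNReal) := ⟨aemeasurable_id, Measure.map_id⟩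
  have hclt := tendstoInDistribution_inv_sqrt_mul_sum_sub (X := fun k ω => g (X k ω)) hY hX2
    (hind.comp (fun _ => g) fun _ => hgm) hident
  have h2 := (ProbabilityMeasure.tendsto_iff_tendsto_charFun.1 hclt.tendsto) 1
  simp only [ProbabilityMeasure.coe_mk, Measure.map_id, charFun_gaussianReal, hexp, hvar,
    Real.coe_toNNReal _ (variance_nonneg g P)] at h2
  have h3 : Complex.exp (((1 : ℝ) : ℂ) * ((0 : ℝ) : ℂ) * Complex.I
      - (Var[g; P] : ℝ) * ((1 : ℝ) : ℂ) ^ 2 / 2) = Complex.exp (-(Var[g; P] : ℝ) / 2) := by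
    congr 1
    simp
    ring
  rw [h3] at h2
  refine h2.congr fun n => ?_
  have hm1 := aemeasurable_normSum (F := F) hlaw hf n
  have hm2 : AEMeasurable (fun ω => (√(n : ℝ))⁻¹ *
      (∑ k ∈ Finset.range n, g (X k ω) - n * ∫ x, g x ∂P)) μ := hexp ▸ hclt.forall_aemeasurable n
  rw [charFun_apply, charFun_apply, integral_map hm2 (by fun_prop), integral_map hm1 (by fun_prop)]
  refine integral_congr_ae (ae_of_all _ fun ω => ?_)
  have h4 : (inner ℝ (normSum P X f n ω) t : ℝ) = (√(n : ℝ))⁻¹ *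
      (∑ k ∈ Finset.range n, g (X k ω) - n * ∫ x, g x ∂P) := by
    have h5 : (inner ℝ (∫ x, f x ∂P) t : ℝ) = ∫ x, g x ∂P := by
      rw [real_inner_comm, ← integral_inner hfi]
      simp only [hg, real_inner_comm]
    rw [normSum, real_inner_smul_left, inner_sub_left, sum_inner, real_inner_smul_left, h5]
  simp only [h4]
  simp

/-- Normalised sums of a square-integrable function along an i.i.d. sample are tight. -/
lemma exists_measure_norm_normSum_gt_le (hind : iIndepFun X μ) (hlaw : ∀ k, HasLaw (X k) P μ)
    {f : α → F} (hf : Measurable f) (hf2 : MemLp f 2 P) (ε : ℝ≥0∞) (hε : 0 < ε) :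
    ∃ R : ℝ, ∀ n, μ {ω | R < ‖normSum P X f n ω‖} ≤ ε := by
  have : IsProbabilityMeasure P := by
    rw [← (hlaw 0).map_eq]
    exact Measure.isProbabilityMeasure_map (hlaw 0).aemeasurable
  have hm := fun n => aemeasurable_normSum (F := F) hlaw hf n
  have := fun n => Measure.isProbabilityMeasure_map (hm n)
  have hcont : Continuous fun t : F =>
      Complex.exp (-(Var[fun x => (inner ℝ (f x) t : ℝ); P] : ℝ) / 2) := by
    have h1 : ∀ t : F, Var[fun x => (inner ℝ (f x) t : ℝ); P] =
        covarianceBilin (P.map f) t t := by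
      intro t
      have hfP : MemLp id 2 (P.map f) := by
        rw [memLp_map_measure_iff (by fun_prop) hf.aemeasurable]
        exact hf2
      rw [covarianceBilin_self hfP, variance_map (by fun_prop) hf.aemeasurable]
      congr 1
      funext x
      simp [real_inner_comm]
    simp only [h1]
    fun_prop
  have htight := isTightMeasureSet_of_tendsto_charFun (μ := fun n => μ.map (normSum P X f n))
    hcont.continuousAt (fun t => tendsto_charFun_normSum hind hlaw hf hf2 t)
  have h2 := tendsto_measure_norm_gt_of_isTightMeasureSet htight
  obtain ⟨R, hR⟩ := (h2.eventually (gt_mem_nhds hε)).exists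
  refine ⟨R, fun n => ?_⟩
  have h3 : μ {ω | R < ‖normSum P X f n ω‖} = μ.map (normSum P X f n) {x | R < ‖x‖} := by
    rw [Measure.map_apply_of_aemeasurable (hm n) (measurableSet_lt measurable_const measurable_norm)]
    rfl
  rw [h3]
  exact (le_iSup₂ (f := fun (ν : Measure F) (_ : ν ∈ Set.range fun n => μ.map (normSum P X f n)) =>
    ν {x | R < ‖x‖}) _ ⟨n, rfl⟩).trans hR.le

/-- The multivariate central limit theorem. -/
lemma tendstoInDistribution_normSum {κ : Type*} [Fintype κ] [DecidableEq κ]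
    (hind : iIndepFun X μ) (hlaw : ∀ k, HasLaw (X k) P μ) {f : α → EuclideanSpace ℝ κ}
    (hf : Measurable f) (hf2 : MemLp f 2 P) {S : Matrix κ κ ℝ} (hS : S.PosSemidef)
    (hvar : ∀ t : EuclideanSpace ℝ κ, t.ofLp ⬝ᵥ S *ᵥ t.ofLp = Var[fun x => (inner ℝ (f x) t : ℝ); P]) :
    TendstoInDistribution (normSum P X f) atTop id (fun _ => μ) (multivariateGaussian 0 S) where
  forall_aemeasurable n := aemeasurable_normSum hlaw hf n
  aemeasurable_limit := aemeasurable_id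
  tendsto := by
    refine ProbabilityMeasure.tendsto_iff_tendsto_charFun.2 fun t => ?_
    have h1 := tendsto_charFun_normSum hind hlaw hf hf2 t
    simp only [ProbabilityMeasure.coe_mk, Measure.map_id]
    rw [charFun_multivariateGaussian hS, hvar]
    convert h1 using 3
    simp
    ring

end CLT

/-! ### The matrices of the limit law -/

section Matrices

variable {ι κ : Type*} [Fintype ι] [DecidableEq ι] [Fintype κ] [DecidableEq κ]
  {J : Matrix κ ι ℝ} {K : Matrix κ κ ℝ}

/-- The saddle-point equations for the matrices `H` and `W`: stationarity in `ξ`. -/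
lemma mul_matW (hK : IsUnit K) : K * matW J K = 1 - J * matH J K := by
  have hK' := K.mul_nonsing_inv ((Matrix.isUnit_iff_isUnit_det K).1 hK)
  rw [matW, matH, Matrix.mul_sub, hK']
  simp only [← Matrix.mul_assoc, hK', Matrix.one_mul]

/-- The saddle-point equations for the matrices `H` and `W`: stationarity in `φ`. -/
lemma transpose_mul_matW (hJ : IsUnit (Jᵀ * K⁻¹ * J)) : Jᵀ * matW J K = 0 := by
  have h1 := (Jᵀ * K⁻¹ * J).mul_nonsing_inv ((Matrix.isUnit_iff_isUnit_det _).1 hJ)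
  have h2 : Jᵀ * (K⁻¹ * J * matSigma J K * Jᵀ * K⁻¹) =
      (Jᵀ * K⁻¹ * J) * matSigma J K * (Jᵀ * K⁻¹) := by
    simp only [Matrix.mul_assoc]
  rw [matW, Matrix.mul_sub, h2, matSigma, h1, Matrix.one_mul, sub_self]

omit [DecidableEq κ] in
lemma mulVec_injective_of_isUnit (h : IsUnit (Jᵀ * K * J)) :
    Function.Injective J.mulVec := by
  have h1 := Matrix.mulVec_injective_iff_isUnit.2 h
  intro v w hvw
  refine h1 ?_
  simp only [← Matrix.mulVec_mulVec, hvw]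

/-- The matrix `Jᵗ K⁻¹ J` is invertible when `K` is negative definite and `J` injective. -/
lemma isUnit_transpose_inv_mul (hK : IsUnit K)
    (hneg : ∀ v, v ⬝ᵥ K *ᵥ v = 0 → v = 0) (hJ : Function.Injective J.mulVec) :
    IsUnit (Jᵀ * K⁻¹ * J) := by
  have hK' := K.mul_nonsing_inv ((Matrix.isUnit_iff_isUnit_det K).1 hK)
  rw [← Matrix.mulVec_injective_iff_isUnit]
  have hlin : Function.Injective (Matrix.mulVecLin (Jᵀ * K⁻¹ * J)) := by
    rw [injective_iff_map_eq_zero]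
    intro v hv
    rw [Matrix.mulVecLin_apply] at hv
    set y := K⁻¹ *ᵥ (J *ᵥ v) with hy
    have hKy : K *ᵥ y = J *ᵥ v := by rw [hy, Matrix.mulVec_mulVec, hK', Matrix.one_mulVec]
    have h1 : y ⬝ᵥ K *ᵥ y = 0 := by
      have h2 : v ⬝ᵥ (Jᵀ * K⁻¹ * J) *ᵥ v = 0 := by rw [hv, dotProduct_zero]
      rw [Matrix.mul_assoc, ← Matrix.mulVec_mulVec, ← Matrix.mulVec_mulVec, ← hy,
        Matrix.dotProduct_mulVec, Matrix.vecMul_transpose] at h2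
      rw [hKy, dotProduct_comm]
      exact h2
    have h3 := hneg y h1
    rw [h3, Matrix.mulVec_zero] at hKy
    refine hJ ?_
    rw [← hKy, Matrix.mulVec_zero]
  exact hlin

end Matrices

/-! ### The quadratic limit of the criterion -/

/-- A quadratic form which is positive off `0` is coercive in finite dimension. -/
lemma exists_pos_mul_norm_sq_le {V : Type*} [NormedAddCommGroup V] [InnerProductSpace ℝ V]
    [FiniteDimensional ℝ V] [Nontrivial V] (A : V →L[ℝ] V)
    (hA : ∀ v, v ≠ 0 → (0 : ℝ) < inner ℝ v (A v)) :
    ∃ a : ℝ, 0 < a ∧ ∀ v, a * ‖v‖ ^ 2 ≤ inner ℝ v (A v) := by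
  obtain ⟨v₀, hv₀, hmin⟩ := (isCompact_sphere (0 : V) 1).exists_isMinOn
    (NormedSpace.sphere_nonempty.2 zero_le_one)
    (f := fun v => (inner ℝ v (A v) : ℝ)) (by fun_prop)
  have hv₀' : v₀ ≠ 0 := by
    rintro rfl
    simp at hv₀
  refine ⟨_, hA v₀ hv₀', fun v => ?_⟩
  rcases eq_or_ne v 0 with rfl | hv
  · simp
  have hn : ‖v‖ ≠ 0 := norm_ne_zero_iff.2 hv
  have h1 : ‖v‖⁻¹ • v ∈ Metric.sphere (0 : V) 1 := by
    simp [norm_smul, hn]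
  have h2 := hmin h1
  simp only [Set.mem_ofPred_eq, map_smul, real_inner_smul_left, real_inner_smul_right] at h2
  calc _ ≤ ‖v‖⁻¹ * (‖v‖⁻¹ * inner ℝ v (A v)) * ‖v‖ ^ 2 := by gcongr
    _ = _ := by field_simp

/-- The linear map `S ↦ N S` with a given matrix, from a Euclidean space to the parameters. -/
def toParamCLM {d s k : ℕ} (N : Matrix (ParamIdx d s) (Fin k) ℝ) : E k →L[ℝ] Param d s :=
  LinearMap.toContinuousLinearMap
    { toFun := fun S => ((N *ᵥ S.ofLp) (Sum.inl ()),
        WithLp.toLp 2 fun j => (N *ᵥ S.ofLp) (Sum.inr (Sum.inl j)),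
        WithLp.toLp 2 fun j => (N *ᵥ S.ofLp) (Sum.inr (Sum.inr j)))
      map_add' := fun S T => by
        simp only [WithLp.ofLp_add, Matrix.mulVec_add]
        rfl
      map_smul' := fun c S => by
        simp only [WithLp.ofLp_smul, Matrix.mulVec_smul]
        rfl }

lemma paramCoords_toParamCLM {d s k : ℕ} (N : Matrix (ParamIdx d s) (Fin k) ℝ) (S : E k) :
    paramCoords (toParamCLM N S) = N *ᵥ S.ofLp := by
  ext c
  rcases c with c | c | c <;> rfl

lemma paramCoords_injective {d s : ℕ} : Function.Injective (paramCoords (d := d) (s := s)) := by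
  intro φ φ' hφ
  refine Prod.ext (congrFun hφ (Sum.inl ())) (Prod.ext ?_ ?_)
  · ext j
    exact congrFun hφ (Sum.inr (Sum.inl j))
  · ext j
    exact congrFun hφ (Sum.inr (Sum.inr j))

lemma exists_pos_mul_norm_le_paramCLM {d s k : ℕ} {N : Matrix (Fin k) (ParamIdx d s) ℝ}
    (hN : Function.Injective N.mulVec) :
    ∃ κ : ℝ, 0 < κ ∧ ∀ φ, κ * ‖φ‖ ≤ ‖paramCLM N φ‖ := by
  have hinj : Function.Injective (paramCLM N) := by
    intro φ φ' hφ
    rw [paramCLM_apply, paramCLM_apply] at hφ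
    exact paramCoords_injective (hN (WithLp.toLp_injective 2 hφ))
  obtain ⟨K, hK, hanti⟩ := (paramCLM N).toLinearMap.exists_antilipschitzWith
    (LinearMap.ker_eq_bot.2 hinj)
  have hK' : (0 : ℝ) < K := NNReal.coe_pos.2 hK
  refine ⟨(K : ℝ)⁻¹, inv_pos.2 hK', fun φ => ?_⟩
  have h1 := hanti.le_mul_dist φ 0
  simp only [dist_zero_right, map_zero] at h1
  rw [inv_mul_le_iff₀ hK']
  exact h1

/-- The operator `v ↦ E_{P₀}[⟪v, g⟫ g]`, given by the matrix `-Jξξ`. -/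
def Model.gram {r d s ℓ : ℕ} (M : Model r d s ℓ) (P₀ : Measure (E r)) :
    E (ℓ + 1) →L[ℝ] E (ℓ + 1) := Matrix.toEuclideanCLM (𝕜 := ℝ) (-M.Jξξ P₀)

namespace Regular

variable {r d s ℓ : ℕ} {M : Model r d s ℓ} {ψ : ℝ → ℝ} {φs : Param d s}
  {P₀ : Measure (E r)} {rt ρ : ℝ} (h : Regular M ψ φs P₀ rt ρ)
include h

lemma inner_gram (v w : E (ℓ + 1)) : inner ℝ v (M.gram P₀ w) =
    ∫ x, (inner ℝ v (M.ga x) : ℝ) * inner ℝ w (M.ga x) ∂P₀ := by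
  have hint : ∀ i j, Integrable (fun x => M.ga x i * M.ga x j) P₀ := fun i j => by
    have := integrable_inner_mul_inner h.integrable_norm_sq_P₀
      (EuclideanSpace.single i 1) (EuclideanSpace.single j 1)
    simpa [EuclideanSpace.inner_single_left] using this
  have h1 : ∀ x, (inner ℝ v (M.ga x) : ℝ) * inner ℝ w (M.ga x) =
      ∑ i, ∑ j, v i * w j * (M.ga x i * M.ga x j) := by
    intro x
    simp only [PiLp.inner_apply, RCLike.inner_apply, conj_trivial]
    rw [Finset.sum_mul_sum]
    refine Finset.sum_congr rfl fun i _ => Finset.sum_congr rfl fun j _ => ?_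
    ring
  simp only [h1]
  rw [integral_finsetSum _ fun i _ => integrable_finsetSum _ fun j _ => (hint i j).const_mul _]
  simp only [integral_finsetSum _ fun j _ => (hint _ j).const_mul _, integral_const_mul]
  rw [Model.gram, Matrix.inner_toEuclideanCLM]
  simp only [dotProduct, Matrix.mulVec, Matrix.neg_apply, Model.Jξξ, Matrix.of_apply, neg_neg,
    Finset.mul_sum]
  refine Finset.sum_congr rfl fun i _ => Finset.sum_congr rfl fun j _ => ?_
  ring

lemma inner_gram_comm (v w : E (ℓ + 1)) :
    (inner ℝ v (M.gram P₀ w) : ℝ) = inner ℝ w (M.gram P₀ v) := by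
  rw [h.inner_gram, h.inner_gram]
  simp only [mul_comm]

lemma inner_gram_self (v : E (ℓ + 1)) :
    (inner ℝ v (M.gram P₀ v) : ℝ) = ∫ x, (inner ℝ v (M.ga x) : ℝ) ^ 2 ∂P₀ := by
  rw [h.inner_gram]
  simp only [sq]

/-- The Gram operator is positive semidefinite, so that its invertibility makes it definite. -/
lemma eq_zero_of_inner_gram_self (hK : IsUnit (M.Jξξ P₀)) {v : E (ℓ + 1)}
    (hv : (inner ℝ v (M.gram P₀ v) : ℝ) = 0) : v = 0 := by
  rw [h.inner_gram] at hv
  have h1 := (integral_eq_zero_iff_of_nonneg (fun x => mul_self_nonneg _)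
    (integrable_inner_mul_inner h.integrable_norm_sq_P₀ v v)).1 hv
  have h2 : M.gram P₀ v = 0 := by
    refine ext_inner_left ℝ fun w => ?_
    rw [h.inner_gram, inner_zero_right]
    refine integral_eq_zero_of_ae ?_
    filter_upwards [h1] with x hx
    have : (inner ℝ v (M.ga x) : ℝ) = 0 := mul_self_eq_zero.1 hx
    simp [this]
  have h3 : (-M.Jξξ P₀) *ᵥ v.ofLp = 0 := congrArg WithLp.ofLp h2
  have h4 := Matrix.mulVec_injective_iff_isUnit.2 hK.neg (h3.trans (Matrix.mulVec_zero _).symm)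
  exact WithLp.ofLp_injective 2 h4

lemma exists_pos_mul_norm_sq_le_inner_gram (hK : IsUnit (M.Jξξ P₀)) :
    ∃ a : ℝ, 0 < a ∧ ∀ v, a * ‖v‖ ^ 2 ≤ inner ℝ v (M.gram P₀ v) := by
  refine exists_pos_mul_norm_sq_le _ fun v hv => lt_of_le_of_ne ?_ fun hcon =>
    hv (h.eq_zero_of_inner_gram_self hK hcon.symm)
  rw [h.inner_gram_self]
  exact integral_nonneg fun x => sq_nonneg _

lemma isUnit_transpose_inv_mul_Jφξ (hK : IsUnit (M.Jξξ P₀))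
    {J : Matrix (Fin (ℓ + 1)) (ParamIdx d s) ℝ} (hJ : IsUnit (Jᵀ * M.Jξξ P₀ * J)) :
    IsUnit (Jᵀ * (M.Jξξ P₀)⁻¹ * J) := by
  refine isUnit_transpose_inv_mul hK (fun v hv => ?_) (mulVec_injective_of_isUnit hJ)
  have h1 : (inner ℝ (WithLp.toLp 2 v) (M.gram P₀ (WithLp.toLp 2 v)) : ℝ) = 0 := by
    rw [Model.gram, Matrix.inner_toEuclideanCLM, Matrix.neg_mulVec, dotProduct_neg, hv, neg_zero]
  exact congrArg WithLp.ofLp (h.eq_zero_of_inner_gram_self hK h1)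

omit h in
/-- Stationarity in `ξ` of the quadratic limit at its saddle point `(-H S, -W S)`. -/
lemma gram_matW (hK : IsUnit (M.Jξξ P₀)) (J : Matrix (Fin (ℓ + 1)) (ParamIdx d s) ℝ)
    (S : E (ℓ + 1)) :
    M.gram P₀ (Matrix.toEuclideanCLM (𝕜 := ℝ) (-matW J (M.Jξξ P₀)) S) =
      S + paramCLM J (toParamCLM (-matH J (M.Jξξ P₀)) S) := by
  refine WithLp.ofLp_injective 2 ?_
  rw [Model.gram, Matrix.ofLp_toEuclideanCLM, Matrix.ofLp_toEuclideanCLM, WithLp.ofLp_add,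
    paramCLM_apply, paramCoords_toParamCLM, Matrix.mulVec_mulVec, Matrix.mulVec_mulVec,
    neg_mul_neg, mul_matW hK, Matrix.sub_mulVec, Matrix.one_mulVec, Matrix.mul_neg,
    Matrix.neg_mulVec, sub_eq_add_neg]

/-- Stationarity in `φ` of the quadratic limit at its saddle point `(-H S, -W S)`. -/
lemma inner_matW_paramCLM (hK : IsUnit (M.Jξξ P₀))
    {J : Matrix (Fin (ℓ + 1)) (ParamIdx d s) ℝ} (hJ : IsUnit (Jᵀ * M.Jξξ P₀ * J))
    (S : E (ℓ + 1)) (φ : Param d s) :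
    (inner ℝ (Matrix.toEuclideanCLM (𝕜 := ℝ) (-matW J (M.Jξξ P₀)) S) (paramCLM J φ) : ℝ) = 0 := by
  have h1 : Jᵀ * matW J (M.Jξξ P₀) = 0 :=
    transpose_mul_matW (h.isUnit_transpose_inv_mul_Jφξ hK hJ)
  rw [paramCLM_apply, EuclideanSpace.inner_eq_star_dotProduct, star_trivial,
    Matrix.ofLp_toEuclideanCLM, dotProduct_comm, Matrix.dotProduct_mulVec, ← Matrix.mulVec_transpose,
    Matrix.mulVec_mulVec, Matrix.mul_neg, h1]
  simp

/-! ### The covariance matrix of the limit law -/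

lemma memLp_ga : MemLp M.ga 2 (M.mixture φs P₀) := by
  refine (memLp_two_iff_integrable_sq_norm Model.measurable_ga.aestronglyMeasurable).2 ?_
  exact h.integrable_norm_sq

lemma dotProduct_varG (w : E (ℓ + 1)) : w.ofLp ⬝ᵥ M.varG (M.mixture φs P₀) *ᵥ w.ofLp =
    Var[fun x => (inner ℝ (M.ga x) w : ℝ); M.mixture φs P₀] := by
  have := h.isProbabilityMeasure_mixture
  have hmem : ∀ i, MemLp (fun x => w i * M.ga x i) 2 (M.mixture φs P₀) := fun i => by
    have h1 := h.memLp_ga.inner_const (𝕜 := ℝ) (EuclideanSpace.single i (1 : ℝ))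
    have h2 : MemLp (fun x => M.ga x i) 2 (M.mixture φs P₀) := by
      simpa [EuclideanSpace.inner_single_right] using h1
    exact h2.const_mul _
  have h1 : (fun x => (inner ℝ (M.ga x) w : ℝ)) = fun x => ∑ i, w i * M.ga x i := by
    funext x
    simp [PiLp.inner_apply]
  rw [h1, ← covariance_self (by
    exact (Finset.aemeasurable_fun_sum _ fun i _ => (hmem i).aestronglyMeasurable.aemeasurable)),
    covariance_fun_sum_fun_sum hmem hmem]
  simp only [covariance_const_mul_left, covariance_const_mul_right, dotProduct, Matrix.mulVec,
    Model.varG, Matrix.of_apply, Finset.mul_sum]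
  refine Finset.sum_congr rfl fun i _ => Finset.sum_congr rfl fun j _ => ?_
  ring

end Regular

/-- The linear map with a given matrix between Euclidean spaces. -/
def matCLM {ι κ : Type*} [Fintype ι] [Fintype κ] [DecidableEq κ] (N : Matrix ι κ ℝ) :
    EuclideanSpace ℝ κ →L[ℝ] EuclideanSpace ℝ ι :=
  LinearMap.toContinuousLinearMap (Matrix.toEuclideanLin N)

lemma matCLM_apply {ι κ : Type*} [Fintype ι] [Fintype κ] [DecidableEq κ] (N : Matrix ι κ ℝ)
    (v : EuclideanSpace ℝ κ) : matCLM N v = WithLp.toLp 2 (N *ᵥ v.ofLp) := rfl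

lemma inner_matCLM {ι κ : Type*} [Fintype ι] [Fintype κ] [DecidableEq κ] (N : Matrix ι κ ℝ)
    (v : EuclideanSpace ℝ κ) (t : EuclideanSpace ℝ ι) :
    (inner ℝ (matCLM N v) t : ℝ) = inner ℝ v (WithLp.toLp 2 (Nᵀ *ᵥ t.ofLp)) := by
  rw [matCLM_apply, EuclideanSpace.inner_eq_star_dotProduct, star_trivial,
    EuclideanSpace.inner_eq_star_dotProduct, star_trivial, Matrix.dotProduct_mulVec,
    ← Matrix.mulVec_transpose]

lemma limitCov_eq {ι κ : Type*} [Fintype ι] [DecidableEq ι] [Fintype κ] [DecidableEq κ] (lam : ℝ)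
    (J : Matrix κ ι ℝ) (K V : Matrix κ κ ℝ) :
    limitCov lam J K V = ((1 / (1 - lam)) • Matrix.fromRows (matH J K) (matW J K)) * V *
      ((1 / (1 - lam)) • Matrix.fromRows (matH J K) (matW J K))ᵀ := by
  rw [limitCov, Matrix.transpose_smul, Matrix.smul_mul, Matrix.smul_mul, Matrix.mul_smul,
    smul_smul, sq, one_div_mul_one_div]

namespace Regular

variable {r d s ℓ : ℕ} {M : Model r d s ℓ} {ψ : ℝ → ℝ} {φs : Param d s}
  {P₀ : Measure (E r)} {rt ρ : ℝ} (h : Regular M ψ φs P₀ rt ρ)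
include h

/-- `N V Nᵗ` is the covariance matrix of `N g(X)`. -/
lemma dotProduct_conj_varG {κ : Type*} [Fintype κ] (N : Matrix κ (Fin (ℓ + 1)) ℝ)
    (t : EuclideanSpace ℝ κ) :
    t.ofLp ⬝ᵥ (N * M.varG (M.mixture φs P₀) * Nᵀ) *ᵥ t.ofLp =
      Var[fun x => (inner ℝ (matCLM N (M.ga x)) t : ℝ); M.mixture φs P₀] := by
  simp only [inner_matCLM]
  rw [← h.dotProduct_varG, ← Matrix.mulVec_mulVec, ← Matrix.mulVec_mulVec,
    Matrix.dotProduct_mulVec, ← Matrix.mulVec_transpose]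

lemma posSemidef_conj_varG {κ : Type*} [Fintype κ] (N : Matrix κ (Fin (ℓ + 1)) ℝ) :
    (N * M.varG (M.mixture φs P₀) * Nᵀ).PosSemidef := by
  refine Matrix.PosSemidef.of_dotProduct_mulVec_nonneg ?_ fun t => ?_
  · have h1 : (M.varG (M.mixture φs P₀))ᵀ = M.varG (M.mixture φs P₀) := by
      ext i j
      exact covariance_comm _ _
    rw [Matrix.IsHermitian, Matrix.conjTranspose_eq_transpose_of_trivial, Matrix.transpose_mul,
      Matrix.transpose_mul, Matrix.transpose_transpose, h1, Matrix.mul_assoc]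
  · rw [star_trivial]
    exact (h.dotProduct_conj_varG N (WithLp.toLp 2 t)).symm ▸ variance_nonneg _ _

end Regular

/-! ### The rescaled criterion as a saddle-point problem -/

lemma normSum_clm {Ω α F G : Type*} [MeasurableSpace α] [NormedAddCommGroup F] [NormedSpace ℝ F]
    [CompleteSpace F] [NormedAddCommGroup G] [NormedSpace ℝ G] [CompleteSpace G] {P : Measure α}
    (X : ℕ → Ω → α) {f : α → F} (hf : Integrable f P) (L : F →L[ℝ] G) (n : ℕ) (ω : Ω) :
    normSum P X (fun x => L (f x)) n ω = L (normSum P X f n ω) := by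
  simp only [normSum, map_smul, map_sub, map_sum, L.integral_comp_comm hf]

lemma Model.sqrt_smul_noise {r d s ℓ : ℕ} (M : Model r d s ℓ) {Ω : Type*} (PT : Measure (E r))
    (X : ℕ → Ω → E r) (i : ℕ × Ω) :
    √(i.1 : ℝ) • M.noise PT X i = normSum PT X M.ga i.1 i.2 := by
  rcases Nat.eq_zero_or_pos i.1 with h0 | h0
  · simp [normSum, h0]
  have h1 : (0 : ℝ) < i.1 := Nat.cast_pos.2 h0
  have h2 : √(i.1 : ℝ) ≠ 0 := (Real.sqrt_pos.2 h1).ne'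
  have h3 : √(i.1 : ℝ) = (√(i.1 : ℝ))⁻¹ * i.1 := by
    rw [eq_inv_mul_iff_mul_eq₀ h2, Real.mul_self_sqrt h1.le]
  rw [Model.noise, normSum, h3, mul_smul, smul_sub (i.1 : ℝ), smul_smul, mul_one_div_cancel h1.ne',
    one_smul, ← h3]

lemma jointVec_eq {d s ℓ : ℕ} (φ : Param d s) (ξ : E (ℓ + 1)) :
    jointVec φ ξ = WithLp.toLp 2 (Sum.elim (paramCoords φ) ξ.ofLp) := rfl

lemma continuous_jointVec {d s ℓ : ℕ} :
    Continuous fun q : Param d s × E (ℓ + 1) => jointVec q.1 q.2 := by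
  refine (PiLp.continuous_toLp 2 _).comp (continuous_pi fun c => ?_)
  rcases c with (c | c | c) | c <;> simp only [Sum.elim_inl, Sum.elim_inr] <;> fun_prop

lemma jointVec_sub {d s ℓ : ℕ} (φ φ' : Param d s) (ξ ξ' : E (ℓ + 1)) :
    jointVec φ ξ - jointVec φ' ξ' = jointVec (φ - φ') (ξ - ξ') := by
  ext c
  rcases c with (c | c | c) | c <;> simp [jointVec]

lemma jointVec_zero {d s ℓ : ℕ} : jointVec (0 : Param d s) (0 : E (ℓ + 1)) = 0 := by
  ext c
  rcases c with (c | c | c) | c <;> simp [jointVec]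

/-- The saddle point `(-H S, -W S)` of the quadratic limit, at `S = -b T`. -/
lemma jointVec_saddle {d s ℓ : ℕ} (N : Matrix (ParamIdx d s) (Fin (ℓ + 1)) ℝ)
    (N' : Matrix (Fin (ℓ + 1)) (Fin (ℓ + 1)) ℝ) (b : ℝ) (T : E (ℓ + 1)) :
    jointVec (toParamCLM (-N) (-(b • T))) (Matrix.toEuclideanCLM (𝕜 := ℝ) (-N') (-(b • T))) =
      matCLM (b • Matrix.fromRows N N') T := by
  rw [jointVec_eq, paramCoords_toParamCLM, Matrix.ofLp_toEuclideanCLM, matCLM_apply,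
    Matrix.smul_mulVec, Matrix.fromRows_mulVec]
  congr 1
  funext c
  rcases c with c | c <;>
    simp [Matrix.neg_mulVec, Matrix.mulVec_neg, Matrix.mulVec_smul]

namespace Regular

variable {r d s ℓ : ℕ} {M : Model r d s ℓ} {ψ : ℝ → ℝ} {φs : Param d s}
  {P₀ : Measure (E r)} {rt ρ : ℝ} (h : Regular M ψ φs P₀ rt ρ)
  {Ω : Type*} [MeasurableSpace Ω] {μ : Measure Ω} [IsProbabilityMeasure μ] {X : ℕ → Ω → E r}
  {φhat : ℕ → Ω → Param d s} {ξn : ℕ → Ω → Param d s → E (ℓ + 1)}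
include h

omit [MeasurableSpace Ω] in
/-- The inner maximisers maximise the real-valued criterion over the ball of radius `ρ`. -/
lemma crit_le_crit_of_isInnerArgmax {i : ℕ × Ω} {φ : Param d s} (hφ : φ ∈ Metric.ball φs rt)
    {ξ : E (ℓ + 1)} (hmax : M.IsInnerArgmax ψ i.1 (fun k => X k i.2) φ ξ) (hξ : ‖ξ‖ ≤ ρ)
    {ξ' : E (ℓ + 1)} (hξ' : ‖ξ'‖ ≤ ρ) :
    M.crit ψ (M.mixture φs P₀) X i φ ξ' ≤ M.crit ψ (M.mixture φs P₀) X i φ ξ := by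
  have h1 := hmax ξ'
  rw [h.Hn_eq X _ _ hφ hξ, h.Hn_eq X _ _ hφ hξ', EReal.coe_le_coe_iff] at h1
  exact h1

omit [MeasurableSpace Ω] in
/-- The estimate minimises the profile `φ ↦ sup_ξ Hₙ(φ, ξ)`, real-valued near `φs`. -/
lemma crit_le_crit_of_isEstimate {i : ℕ × Ω} {φ φ' : Param d s} {ξ ξ' : E (ℓ + 1)}
    (hest : M.IsEstimate ψ i.1 (fun k => X k i.2) φ)
    (hφ : φ ∈ Metric.ball φs rt) (hξ : ‖ξ‖ ≤ ρ) (hφ' : φ' ∈ Metric.ball φs rt)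
    (hmax' : M.IsInnerArgmax ψ i.1 (fun k => X k i.2) φ' ξ') (hξ' : ‖ξ'‖ ≤ ρ) :
    M.crit ψ (M.mixture φs P₀) X i φ ξ ≤ M.crit ψ (M.mixture φs P₀) X i φ' ξ' := by
  have h1 : M.Hn ψ i.1 (fun k => X k i.2) φ ξ ≤ M.Hn ψ i.1 (fun k => X k i.2) φ' ξ' :=
    (le_iSup (fun ξ => M.Hn ψ i.1 (fun k => X k i.2) φ ξ) ξ).trans
      ((hest.2 φ' (h.ball_subset hφ')).trans (iSup_le hmax'))
  rw [h.Hn_eq X _ _ hφ hξ, h.Hn_eq X _ _ hφ' hξ', EReal.coe_le_coe_iff] at h1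
  exact h1

/-- With high probability, and as long as the noise is bounded, the criterion rescaled by `√n` is a
saddle-point problem in the sense of `SaddleProblem`. -/
lemma exists_saddleProblem (hind : iIndepFun X μ) (hlaw : ∀ k, HasLaw (X k) (M.mixture φs P₀) μ)
    (hest : ∀ᶠ i in whp μ, M.IsEstimate ψ i.1 (fun k => X k i.2) (φhat i.1 i.2))
    (hmax : ∀ᶠ i in whp μ, ∀ φ ∈ Metric.ball φs rt,
      M.IsInnerArgmax ψ i.1 (fun k => X k i.2) φ (ξn i.1 i.2 φ) ∧ ‖ξn i.1 i.2 φ‖ ≤ ρ)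
    (hcons : Tendsto (fun i : ℕ × Ω => φhat i.1 i.2) (whp μ) (𝓝 φs))
    (hK : IsUnit (M.Jξξ P₀)) (hJ : IsUnit ((M.Jφξ φs (M.mixture φs P₀))ᵀ * M.Jξξ P₀ *
      M.Jφξ φs (M.mixture φs P₀))) (R₀ : ℝ) :
    ∃ (U : Set (Param d s)) (c a κ : ℝ) (B : E (ℓ + 1) →L[ℝ] E (ℓ + 1)),
      SaddleProblem (whp μ ⊓ 𝓟 {i | ‖normSum (M.mixture φs P₀) X M.ga i.1 i.2‖ ≤ R₀})
        (fun i => √(i.1 : ℝ)) (M.crit ψ (M.mixture φs P₀) X) (M.linPart (M.mixture φs P₀) X)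
        (M.linLim (M.mixture φs P₀)) (fun φ => 1 / (1 - φ.1)) (M.noise (M.mixture φs P₀) X) φs U c ρ
        (M.gram P₀) B (paramCLM (M.Jφξ φs (M.mixture φs P₀))) a κ (fun i => φhat i.1 i.2)
        (fun i => ξn i.1 i.2) := by
  obtain ⟨a, ha, hcoer⟩ := h.exists_pos_mul_norm_sq_le_inner_gram hK
  obtain ⟨κ, hκ, hinj⟩ := exists_pos_mul_norm_le_paramCLM (mulVec_injective_of_isUnit hJ)
  obtain ⟨c, hc, U, hU, hupper⟩ := h.exists_upper_bound hind hlaw ha fun ξ =>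
    (hcoer ξ).trans_eq (h.inner_gram_self ξ)
  have hlam := h.lam_mem
  have hball : Metric.ball φs rt ∈ 𝓝 φs := Metric.ball_mem_nhds _ h.rt_pos
  have hK' := (-M.Jξξ P₀).mul_nonsing_inv ((Matrix.isUnit_iff_isUnit_det _).1 hK.neg)
  refine ⟨U ∩ Metric.ball φs rt, c, a, κ, Matrix.toEuclideanCLM (𝕜 := ℝ) (-M.Jξξ P₀)⁻¹,
    { scale := ?_
      nhds := inter_mem hU hball
      c_pos := hc
      ρ_pos := h.ρ_pos
      a_pos := ha
      κ_pos := hκ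
      coercive := hcoer
      symm := h.inner_gram_comm
      right_inv := fun v => ?_
      inj := hinj
      h_zero := h.crit_zero _ X
      upper := ?_
      loc := fun R ε hε => ?_
      Z_eq := fun i φ => rfl
      z_zero := h.linLim_zero
      z_deriv := h.hasFDerivAt_linLim
      b_cont := ?_
      noise := ?_
      φhat_tendsto := hcons.mono_left inf_le_left
      isMax := ?_
      isMin := ?_ }⟩
  · exact (Real.tendsto_sqrt_atTop.comp (tendsto_natCast_atTop_atTop.comp tendsto_fst_whp)).mono_left
      inf_le_left
  · refine WithLp.ofLp_injective 2 ?_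
    rw [Model.gram, Matrix.ofLp_toEuclideanCLM, Matrix.ofLp_toEuclideanCLM, Matrix.mulVec_mulVec,
      hK', Matrix.one_mulVec]
  · filter_upwards [hupper.filter_mono inf_le_left] with i hi φ hφ ξ hξ
    exact hi φ hφ.1 ξ hξ
  · -- the local expansion has the relative error `ε / (R² + 1) ‖ξ‖²`, at most `ε / n` here
    obtain ⟨U', hU', hloc⟩ := h.local_expansion hind hlaw R
      (div_pos hε (by positivity : (0 : ℝ) < R ^ 2 + 1))
    refine ⟨U', hU', ?_⟩
    filter_upwards [hloc.filter_mono inf_le_left] with i hi φ hφ ξ hξ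
    have h1 := hi φ hφ ξ hξ
    rw [← h.inner_gram_self] at h1
    have hn : √(i.1 : ℝ) ^ 2 = i.1 := Real.sq_sqrt (Nat.cast_nonneg _)
    have h2 : (i.1 : ℝ) * ‖ξ‖ ^ 2 ≤ R ^ 2 := by
      have h3 : ‖√(i.1 : ℝ) • ξ‖ ^ 2 ≤ R ^ 2 := by gcongr
      rwa [norm_smul, mul_pow, Real.norm_eq_abs, sq_abs, hn] at h3
    rw [map_smul, real_inner_smul_left, real_inner_smul_right, hn]
    have h4 : (i.1 : ℝ) * (M.crit ψ (M.mixture φs P₀) X i φ ξ -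
        inner ℝ ξ (M.linPart (M.mixture φs P₀) X i φ)) +
        2⁻¹ * (√(i.1 : ℝ) * (√(i.1 : ℝ) * inner ℝ ξ (M.gram P₀ ξ))) =
        (i.1 : ℝ) * (M.crit ψ (M.mixture φs P₀) X i φ ξ -
          inner ℝ ξ (M.linPart (M.mixture φs P₀) X i φ) +
          2⁻¹ * inner ℝ ξ (M.gram P₀ ξ)) := by
      rw [← mul_assoc √(i.1 : ℝ), ← sq, hn]
      ring
    rw [h4, abs_mul, Nat.abs_cast]
    calc _ ≤ (i.1 : ℝ) * (ε / (R ^ 2 + 1) * ‖ξ‖ ^ 2) := by gcongr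
      _ = ε / (R ^ 2 + 1) * (i.1 * ‖ξ‖ ^ 2) := by ring
      _ ≤ ε / (R ^ 2 + 1) * (R ^ 2 + 1) := by gcongr; linarith
      _ = ε := by field_simp
  · have : (1 : ℝ) - φs.1 ≠ 0 := (sub_pos.2 hlam.2).ne'
    fun_prop (disch := assumption)
  · refine Asymptotics.IsBigO.of_bound R₀ ?_
    filter_upwards [mem_inf_of_right (mem_principal_self _)] with i hi
    rw [Model.sqrt_smul_noise]
    simpa using hi
  · filter_upwards [hmax.filter_mono inf_le_left] with i hi φ hφ
    exact ⟨(hi φ hφ.2).2, fun ξ hξ =>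
      h.crit_le_crit_of_isInnerArgmax hφ.2 (hi φ hφ.2).1 (hi φ hφ.2).2 hξ⟩
  · filter_upwards [hmax.filter_mono inf_le_left, hest.filter_mono inf_le_left,
      (hcons.eventually_mem hball).filter_mono inf_le_left] with i hi hi' hi'' φ hφ
    exact h.crit_le_crit_of_isEstimate hi' hi'' (hi _ hi'').2 hφ.2 (hi φ hφ.2).1 (hi φ hφ.2).2

/-- The estimator and the inner maximiser are asymptotically linear: with the noise
`T = √n (Pₙ g - E g)`, the rescaled pair is `(1 - λ*)⁻¹ (H T, W T) + o_P(1)`. -/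
lemma tendstoInMeasure_jointVec_sub (hind : iIndepFun X μ)
    (hlaw : ∀ k, HasLaw (X k) (M.mixture φs P₀) μ)
    (hest : ∀ᶠ i in whp μ, M.IsEstimate ψ i.1 (fun k => X k i.2) (φhat i.1 i.2))
    (hmax : ∀ᶠ i in whp μ, ∀ φ ∈ Metric.ball φs rt,
      M.IsInnerArgmax ψ i.1 (fun k => X k i.2) φ (ξn i.1 i.2 φ) ∧ ‖ξn i.1 i.2 φ‖ ≤ ρ)
    (hcons : Tendsto (fun i : ℕ × Ω => φhat i.1 i.2) (whp μ) (𝓝 φs))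
    (hK : IsUnit (M.Jξξ P₀)) (hJ : IsUnit ((M.Jφξ φs (M.mixture φs P₀))ᵀ * M.Jξξ P₀ *
      M.Jφξ φs (M.mixture φs P₀))) :
    TendstoInMeasure μ (fun (n : ℕ) ω =>
      jointVec (√(n : ℝ) • (φhat n ω - φs)) (√(n : ℝ) • ξn n ω (φhat n ω)) -
        matCLM ((1 / (1 - φs.1)) • Matrix.fromRows
          (matH (M.Jφξ φs (M.mixture φs P₀)) (M.Jξξ P₀))
          (matW (M.Jφξ φs (M.mixture φs P₀)) (M.Jξξ P₀)))
          (normSum (M.mixture φs P₀) X M.ga n ω)) atTop 0 := by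
  refine tendstoInMeasure_of_tight (S := normSum (M.mixture φs P₀) X M.ga)
    (exists_measure_norm_normSum_gt_le hind hlaw Model.measurable_ga h.memLp_ga) fun R₀ => ?_
  obtain ⟨U, c, a, κ, B, hp⟩ := h.exists_saddleProblem hind hlaw hest hmax hcons hK hJ R₀
  obtain ⟨h1, h2⟩ := hp.tendsto_saddle
    (toParamCLM (-matH (M.Jφξ φs (M.mixture φs P₀)) (M.Jξξ P₀)))
    (Matrix.toEuclideanCLM (𝕜 := ℝ) (-matW (M.Jφξ φs (M.mixture φs P₀)) (M.Jξξ P₀)))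
    (gram_matW hK _) (h.inner_matW_paramCLM hK hJ)
  have h3 := (continuous_jointVec.tendsto _).comp (h1.prodMk_nhds h2)
  simp only [jointVec_zero] at h3
  refine h3.congr fun i => ?_
  rw [Function.comp_apply, ← jointVec_sub, jointVec_saddle, Model.sqrt_smul_noise]

end Regular

end

end SemiparamMixture

open SemiparamMixture in
theorem mainTheorem2
    {r d s ℓ : ℕ} (M : Model r d s ℓ)
    -- the divergence and its convex conjugate `ψ`
    (φgen : ℝ → ℝ≥0∞) (hφgen : IsDivergenceGenerator φgen)
    (ψ : ℝ → ℝ) (hψ : ∀ t, (ψ t : EReal) = fenchelLegendre φgen t)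
    (hψC2 : ContDiff ℝ 2 ψ) (hψ1 : deriv ψ 0 = 1) (hψ2 : deriv (deriv ψ) 0 = 1)
    -- the true parameter, an interior point of `Φ`, and the true unknown component
    (φs : Param d s) (rt : ℝ) (hrt : 0 < rt) (hint : Metric.ball φs rt ⊆ M.Φ)
    (P₀ : Measure (E r)) (hP₀ : P₀ ∈ M.constraintSet φs.2.2)
    -- the i.i.d. sample from `P_T = λ* P₁(· | θ*) + (1 - λ*) P₀*`
    {Ω : Type*} [MeasurableSpace Ω] (μ : Measure Ω) [IsProbabilityMeasure μ]
    (X : ℕ → Ω → E r) (hXindep : iIndepFun X μ)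
    (hXlaw : ∀ i, HasLaw (X i) (M.mixture φs P₀) μ)
    -- the estimator `φ̂ₙ`, defined with probability tending to one
    (φhat : ℕ → Ω → Param d s) (hφhat_meas : ∀ n, AEMeasurable (φhat n) μ)
    (hφhat : Tendsto (fun n => μ {ω | ¬ M.IsEstimate ψ n (fun i => X i ω) (φhat n ω)})
      atTop (𝓝 0))
    -- the inner maximisers `ξₙ(φ)`: with probability tending to one they exist, and are bounded,
    -- for all `φ` near `φ*`
    (ρ : ℝ) (hρ : 0 < ρ) (ξn : ℕ → Ω → Param d s → E (ℓ + 1))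
    (hξn_meas : ∀ n, AEMeasurable (fun ω => ξn n ω (φhat n ω)) μ)
    (hξn : Tendsto (fun n => μ {ω | ¬ ∀ φ ∈ Metric.ball φs rt,
        M.IsInnerArgmax ψ n (fun i => X i ω) φ (ξn n ω φ) ∧ ‖ξn n ω φ‖ ≤ ρ})
      atTop (𝓝 0))
    -- 1. consistency
    (hconsist : TendstoInMeasure μ φhat atTop (fun _ => φs))
    -- 2. `m`, and the densities as functions of `θ`, are of class `C²`
    (hp₁C2 : ∀ᵐ x, ContDiffOn ℝ 2 (fun θ => M.p₁ θ x) (interior M.Θ))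
    (hmC2 : ContDiffOn ℝ 2 M.m (interior M.𝒜))
    -- 3. domination of the derivatives in `ξ`
    (h₁₁ h₁₂ : E r → ℝ) (hh₁₁ : Integrable h₁₁) (hh₁₂ : Integrable h₁₂)
    (hdom₁₁ : ∀ᵐ x, ∀ φ ∈ Metric.ball φs rt, ∀ ξ : E (ℓ + 1), ‖ξ‖ ≤ ρ →
      ‖deriv ψ (inner ℝ ξ (M.ga x)) • M.ga x‖ * M.p₁ φ.2.1 x ≤ h₁₁ x)
    (hdom₁₂ : ∀ᵐ x, ∀ φ ∈ Metric.ball φs rt, ∀ ξ : E (ℓ + 1), ‖ξ‖ ≤ ρ →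
      |deriv (deriv ψ) (inner ℝ ξ (M.ga x))| * ‖M.ga x‖ ^ 2 * M.p₁ φ.2.1 x ≤ h₁₂ x)
    -- 4. domination of the derivatives in `θ`
    (h₂₁ h₂₂ : E r → ℝ) (hh₂₁ : Integrable h₂₁) (hh₂₂ : Integrable h₂₂)
    (hdom₂₁ : ∀ᵐ x, ∀ φ ∈ Metric.ball φs rt, ∀ ξ : E (ℓ + 1), ‖ξ‖ ≤ ρ →
      ‖ψ (inner ℝ ξ (M.ga x)) • gradient (fun θ => M.p₁ θ x) φ.2.1‖ ≤ h₂₁ x)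
    (hdom₂₂ : ∀ᵐ x, ∀ φ ∈ Metric.ball φs rt, ∀ ξ : E (ℓ + 1), ‖ξ‖ ≤ ρ →
      ‖ψ (inner ℝ ξ (M.ga x)) • iteratedFDeriv ℝ 2 (fun θ => M.p₁ θ x) φ.2.1‖ ≤ h₂₂ x)
    -- 5. domination of the mixed derivatives
    (h₃ : E r → ℝ) (hh₃ : Integrable h₃)
    (hdom₃ : ∀ᵐ x, ∀ φ ∈ Metric.ball φs rt, ∀ ξ : E (ℓ + 1), ‖ξ‖ ≤ ρ →
      ‖deriv ψ (inner ℝ ξ (M.ga x)) • M.ga x‖ * ‖gradient (fun θ => M.p₁ θ x) φ.2.1‖ ≤ h₃ x)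
    -- 6. second moments
    (hmom : ∀ i j : Fin ℓ, Integrable (fun x => M.g x i * M.g x j) (M.mixture φs P₀))
    -- 7. invertibility
    (hJξξ : IsUnit (M.Jξξ P₀))
    (hJφξ : IsUnit ((M.Jφξ φs (M.mixture φs P₀))ᵀ * M.Jξξ P₀ * M.Jφξ φs (M.mixture φs P₀))) :
    TendstoInDistribution
      (fun (n : ℕ) ω => jointVec (√(n : ℝ) • (φhat n ω - φs)) (√(n : ℝ) • ξn n ω (φhat n ω)))
      atTop id (fun _ => μ)
      (multivariateGaussian 0
        (limitCov φs.1 (M.Jφξ φs (M.mixture φs P₀)) (M.Jξξ P₀) (M.varG (M.mixture φs P₀)))) := by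
  have h : Regular M ψ φs P₀ rt ρ :=
    { conj :=
        { contDiff := hψC2
          zero := conjugate_zero hφgen.map_one hψ
          deriv_zero := hψ1
          deriv2_zero := hψ2
          le := le_conjugate hφgen.map_one hψ
          convex := convexOn_conjugate hψ }
      rt_pos := hrt
      ρ_pos := hρ
      ball_subset := hint
      mem_constraintSet := hP₀
      p₁_C2 := hp₁C2
      m_C2 := hmC2
      dom₁₂ := ⟨h₁₂, hh₁₂, hdom₁₂⟩
      dom₃ := ⟨h₃, hh₃, hdom₃⟩
      moments := hmom }
  have hlin := h.tendstoInMeasure_jointVec_sub hXindep hXlaw (eventually_whp.2 hφhat)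
    (eventually_whp.2 hξn) hconsist.tendsto_whp hJξξ hJφξ
  have := h.isProbabilityMeasure_mixture
  rw [limitCov_eq]
  set N := (1 / (1 - φs.1)) • Matrix.fromRows (matH (M.Jφξ φs (M.mixture φs P₀)) (M.Jξξ P₀))
    (matW (M.Jφξ φs (M.mixture φs P₀)) (M.Jξξ P₀)) with hN
  have hclt := tendstoInDistribution_normSum hXindep hXlaw
    (f := fun x => matCLM N (M.ga x)) ((matCLM N).continuous.measurable.comp Model.measurable_ga)
    ((matCLM N).comp_memLp' h.memLp_ga) (h.posSemidef_conj_varG N) (h.dotProduct_conj_varG N)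
  refine tendstoInDistribution_of_tendstoInMeasure_sub _ _ hclt (hlin.congr' ?_ ?_) fun n => ?_
  · refine Eventually.of_forall fun n => ae_of_all _ fun ω => ?_
    simp only [Pi.sub_apply]
    rw [normSum_clm X (h.memLp_ga.integrable (by norm_num)) (matCLM N)]
  · rfl
  · exact continuous_jointVec.measurable.comp_aemeasurable
      ((((hφhat_meas n).sub_const φs).const_smul √(n : ℝ)).prodMk
        ((hξn_meas n).const_smul √(n : ℝ)))
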